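/- **Theorem 5.25 (Hecke's Prime Number Theorem for $\mathbb{Z}[i]$).** Call two elements of $\mathbb{Z}[i]$ associated if they differ by a factor $1,-1,i$ or $-i$, and for $\omega\in\mathbb{Z}[i]\setminus\{0\}$ let $\arg(\omega)\in[0,2\pi)$ be its argument as a complex number. For functions $f,g$ of a real variable with $g(x)\neq 0$ for all large $x$, write $f(x)\sim g(x)$ if $f(x)/g(x)\to1$ as $x\to\infty$. (a) For real $x$ let $\pi_i(x)$ be the number of prime elements $\mathfrak p$ of $\mathbb{Z}[i]$ with $|\mathfrak p|^2\le x$, counted up to associates; equivalently, $\pi_i(x)$ is the number of prime elements $\mathfrak p$ of $\mathbb{Z}[i]$ with $|\mathfrak p|^2\le x$ and $0\le\arg(\mathfrak p)<\pi/2$. Then $$\pi_i(x)\sim\frac{x}{\ln x}.$$ (b) For real numbers $\alpha,\beta$ with $0\le\alpha<\beta\le2\pi$ and real $x$, let $\pi_i(x;\alpha,\beta)$ be the number of all prime elements $\mathfrak p$ of $\mathbb{Z}[i]$ (associated primes being counted separately) with $|\mathfrak p|^2\le x$ and $\alpha\le\arg(\mathfrak p)<\beta$. Then $$\pi_i(x;\alpha,\beta)\sim\frac{2}{\pi}\,(\beta-\alpha)\,\frac{x}{\ln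 x}.$$ -/

import Mathlib

noncomputable section

namespace GaussianPNT

/-- The argument of a Gaussian integer, normalised to lie in `[0, 2π)`.
(For `ω = 0` the value is `0`; only arguments of primes matter below.) -/
def arg (ω : GaussianInt) : ℝ :=
  toIcoMod Real.two_pi_pos 0 (Complex.arg (GaussianInt.toComplex ω))

/-- The set `B_x(i)` of Gaussian integers `ω` with `|ω|² ≤ x`, where
`Zsqrtd.norm (a + b i) = a² + b²`. -/
def ball (x : ℝ) : Set GaussianInt :=
  {ω | ((Zsqrtd.norm ω : ℤ) : ℝ) ≤ x}

/-- The set of all prime elements of `ℤ[i]`. -/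
def primes : Set GaussianInt :=
  {p | Prime p}

/-- The prime elements of `ℤ[i]` in the first quadrant: `0 ≤ arg p < π/2`. -/
def primesPlus : Set GaussianInt :=
  {p | p ∈ primes ∧ 0 ≤ arg p ∧ arg p < Real.pi / 2}

/-- `π_i(x)`: the number of pairwise non-associated prime elements `p` with `|p|² ≤ x`, that is,
the number of classes of such primes up to multiplication by units. -/
def primeCount (x : ℝ) : ℕ :=
  (Associates.mk '' (primes ∩ ball x)).ncard

/-- `π_i(x; α, β)`: the number of all prime elements `p` with `|p|² ≤ x` and `α ≤ arg p < β`
(associated primes are counted separately). -/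
def sectorPrimeCount (α β x : ℝ) : ℕ :=
  {p | p ∈ primes ∩ ball x ∧ α ≤ arg p ∧ arg p < β}.ncard

/-- The sets counted above are finite, so `Set.ncard` is their true cardinality. -/
theorem ball_finite (x : ℝ) : (ball x).Finite := by
  have hinj : Set.InjOn (fun ω : GaussianInt => (ω.re, ω.im)) (ball x) := by
    intro a _ b _ h
    simp only [Prod.mk.injEq] at h
    exact Zsqrtd.ext h.1 h.2
  refine Set.Finite.of_finite_image ?_ hinj
  refine ((Set.finite_Icc (-⌈x⌉) ⌈x⌉).prod (Set.finite_Icc (-⌈x⌉) ⌈x⌉)).subset ?_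
  rintro _ ⟨ω, hω, rfl⟩
  have h : ω.norm ≤ ⌈x⌉ := by
    have h1 : ((Zsqrtd.norm ω : ℤ) : ℝ) ≤ (⌈x⌉ : ℝ) := le_trans hω (Int.le_ceil x)
    exact_mod_cast h1
  rw [Zsqrtd.norm_def] at h
  have hre : |ω.re| ≤ ω.re * ω.re := by
    rw [← abs_mul_abs_self]; rcases eq_or_ne ω.re 0 with h0 | h0
    · simp [h0]
    · nlinarith [Int.one_le_abs h0]
  have him : |ω.im| ≤ ω.im * ω.im := by
    rw [← abs_mul_abs_self]; rcases eq_or_ne ω.im 0 with h0 | h0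
    · simp [h0]
    · nlinarith [Int.one_le_abs h0]
  have h2 := mul_self_nonneg ω.re
  have h3 := mul_self_nonneg ω.im
  exact ⟨abs_le.1 (by linarith), abs_le.1 (by linarith)⟩

end GaussianPNT

end

/-!
For an integer `n`, the Hecke `L`-series of the angular character `ω ↦ (ω / |ω|) ^ n` extends
analytically to `Re s > 3 / 4` (with a simple pole at `s = 1` when `n = 0`), because partial sums
of the character over the lattice points of a disc are close to the corresponding area integral.
When `4 ∣ n`, the inequality `3 + 4 cos θ + cos 2θ ≥ 0` excludes zeros with `Re s = 1`, so the
Wiener–Ikehara theorem gives the asymptotics of `∑ log |p|² (p / |p|) ^ n` over the Gaussian primes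
with `|p|² ≤ x`; for all other `n` this sum vanishes, because multiplication by `i` permutes the
primes. By Weyl's criterion the arguments of the primes, weighted by `log |p|²`, become
equidistributed; the weights are removed by comparing `log |p|²` with `log x`.
-/

noncomputable section

namespace HeckePNT

open MeasureTheory Set Filter Topology

/-! ### The Fejér kernel -/

/-- The tent function `t ↦ (1 - |t| / T)₊` supported on `[-T, T]`. -/
def tent (T t : ℝ) : ℝ := max 0 (1 - |t| / T)

/-- The Fejér kernel of width `T`, normalised as the Fourier transform of `tent T`. -/
def fejer (T v : ℝ) : ℝ := T * Real.sinc (T / 2 * v) ^ 2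

/-- The total mass of the Fejér kernel, which does not depend on the width. Its value `2π` is never
needed. -/
def fejerMass : ℝ := 2 * ∫ x, Real.sinc x ^ 2

lemma continuous_tent (T : ℝ) : Continuous (tent T) := by
  unfold tent; fun_prop

lemma tent_eq_zero {T t : ℝ} (hT : 0 < T) (ht : T ≤ |t|) : tent T t = 0 :=
  max_eq_left (sub_nonpos.2 ((one_le_div₀ hT).2 ht))

lemma tent_eq {T t : ℝ} (hT : 0 < T) (ht : |t| ≤ T) : tent T t = 1 - |t| / T :=
  max_eq_right (sub_nonneg.2 (div_le_one_of_le₀ ht hT.le))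

lemma tent_neg (T t : ℝ) : tent T (-t) = tent T t := by
  simp only [tent, abs_neg]

lemma tent_eq_zero_of_notMem {T t : ℝ} (hT : 0 < T) (ht : t ∉ Icc (-T) T) : tent T t = 0 :=
  tent_eq_zero hT (not_le.1 fun h => ht (abs_le.1 h)).le

lemma hasCompactSupport_tent {T : ℝ} (hT : 0 < T) : HasCompactSupport (tent T) :=
  HasCompactSupport.intro isCompact_Icc fun _ => tent_eq_zero_of_notMem hT

lemma integrable_tent {T : ℝ} (hT : 0 < T) : Integrable (tent T) :=
  (continuous_tent T).integrable_of_hasCompactSupport (hasCompactSupport_tent hT)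

lemma continuous_fejer (T : ℝ) : Continuous (fejer T) := by
  have := Real.continuous_sinc
  unfold fejer; fun_prop

lemma fejer_nonneg {T : ℝ} (hT : 0 ≤ T) (v : ℝ) : 0 ≤ fejer T v := by
  unfold fejer; positivity

lemma abs_fejer_le (T v : ℝ) : |fejer T v| ≤ |T| := by
  rw [fejer, abs_mul, abs_pow]
  exact mul_le_of_le_one_right (abs_nonneg T) (pow_le_one₀ (abs_nonneg _) (Real.abs_sinc_le_one _))

lemma sinc_sq_le (x : ℝ) : Real.sinc x ^ 2 ≤ 2 * (1 + x ^ 2)⁻¹ := by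
  have h₁ : Real.sinc x ^ 2 ≤ 1 := (sq_le_one_iff_abs_le_one _).2 (Real.abs_sinc_le_one x)
  have h₂ : x ^ 2 * Real.sinc x ^ 2 ≤ 1 := by
    rcases eq_or_ne x 0 with rfl | hx
    · simp
    · rw [Real.sinc_of_ne_zero hx, div_pow, mul_div_cancel₀ _ (by positivity)]
      exact Real.sin_sq_le_one x
  rw [← div_eq_mul_inv, le_div_iff₀ (by positivity)]
  linarith

lemma integrable_sinc_sq : Integrable (fun x => Real.sinc x ^ 2) := by
  refine (integrable_inv_one_add_sq.const_mul 2).mono'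
    (Real.continuous_sinc.pow 2).aestronglyMeasurable (Eventually.of_forall fun x => ?_)
  rw [Real.norm_of_nonneg (sq_nonneg _)]
  exact sinc_sq_le x

lemma integrable_fejer (T : ℝ) : Integrable (fejer T) := by
  rcases eq_or_ne T 0 with rfl | hT
  · exact (integrable_zero ℝ ℝ volume).congr (Eventually.of_forall fun v => (zero_mul _).symm)
  · exact (integrable_sinc_sq.comp_mul_left' (by positivity : T / 2 ≠ 0)).const_mul T

lemma fejerMass_pos : 0 < fejerMass := by
  refine mul_pos two_pos ?_
  rw [integral_pos_iff_support_of_nonneg (fun x => sq_nonneg _) integrable_sinc_sq]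
  exact (Real.continuous_sinc.pow 2).isOpen_support.measure_pos _ ⟨0, by simp⟩

lemma integral_fejer {T : ℝ} (hT : 0 < T) : ∫ v, fejer T v = fejerMass := by
  simp_rw [fejer, integral_const_mul]
  rw [Measure.integral_comp_mul_left (fun x => Real.sinc x ^ 2) (T / 2), fejerMass,
    abs_of_pos (by positivity), smul_eq_mul]
  field_simp

lemma setIntegral_Icc_fejer {T δ : ℝ} (hT : 0 < T) (hδ : 0 ≤ δ) :
    ∫ v in Icc (-δ) δ, fejer T v = 2 * ∫ x in Icc (-(T / 2 * δ)) (T / 2 * δ), Real.sinc x ^ 2 := by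
  have hTδ : -(T / 2 * δ) ≤ T / 2 * δ := neg_le_self (by positivity)
  simp_rw [integral_Icc_eq_integral_Ioc, ← intervalIntegral.integral_of_le hTδ,
    ← intervalIntegral.integral_of_le (neg_le_self hδ), fejer, intervalIntegral.integral_const_mul]
  rw [intervalIntegral.integral_comp_mul_left (fun x => Real.sinc x ^ 2) (by positivity),
    smul_eq_mul, mul_neg]
  field_simp

lemma tendsto_setIntegral_Icc_fejer {δ : ℝ} (hδ : 0 < δ) :
    Tendsto (fun T => ∫ v in Icc (-δ) δ, fejer T v) atTop (𝓝 fejerMass) := by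
  have hsinc : Tendsto (fun R : ℝ => 2 * ∫ x in Icc (-R) R, Real.sinc x ^ 2) atTop (𝓝 fejerMass) :=
    ((aecover_Icc tendsto_neg_atTop_atBot tendsto_id)
      |>.integral_tendsto_of_countably_generated integrable_sinc_sq).const_mul 2
  have hscale : Tendsto (fun T : ℝ => T / 2 * δ) atTop atTop :=
    (tendsto_id.atTop_div_const two_pos).atTop_mul_const hδ
  refine (hsinc.comp hscale).congr' ?_
  filter_upwards [eventually_gt_atTop 0] with T hT
  exact (setIntegral_Icc_fejer hT hδ.le).symm

lemma fejer_eq_one_sub_cos {T v : ℝ} (hT : T ≠ 0) (hv : v ≠ 0) :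
    fejer T v = 2 * ((1 - Real.cos (v * T)) / (T * v ^ 2)) := by
  rw [fejer, Real.sinc_of_ne_zero (by positivity), div_pow, Real.sin_sq_eq_half_sub]
  field_simp

lemma integral_one_sub_div_mul_cos {T v : ℝ} (hT : T ≠ 0) (hv : v ≠ 0) :
    ∫ t in (0 : ℝ)..T, (1 - t / T) * Real.cos (v * t) = (1 - Real.cos (v * T)) / (T * v ^ 2) := by
  have hderiv (t : ℝ) : HasDerivAt (fun t => (1 - t / T) * (Real.sin (v * t) / v)
      - Real.cos (v * t) / (T * v ^ 2)) ((1 - t / T) * Real.cos (v * t)) t := by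
    have hvt : HasDerivAt (fun t => v * t) v t := by simpa using (hasDerivAt_id t).const_mul v
    refine (((((hasDerivAt_id t).div_const T).const_sub 1).mul (hvt.sin.div_const v)).sub
      (hvt.cos.div_const (T * v ^ 2))).congr_deriv ?_
    simp only [id]
    field_simp
    ring
  rw [intervalIntegral.integral_eq_sub_of_hasDerivAt (fun t _ => hderiv t)
    (Continuous.intervalIntegrable (by fun_prop) _ _), div_self hT]
  simp only [mul_zero, Real.sin_zero, Real.cos_zero]
  ring

lemma integral_one_sub_div {T : ℝ} (hT : T ≠ 0) : ∫ t in (0 : ℝ)..T, (1 - t / T) = T / 2 := by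
  rw [intervalIntegral.integral_sub (Continuous.intervalIntegrable (by fun_prop) _ _)
    (Continuous.intervalIntegrable (by fun_prop) _ _), intervalIntegral.integral_div,
    intervalIntegral.integral_const, integral_id, smul_eq_mul]
  field_simp
  ring

lemma two_mul_integral_one_sub_div_mul_cos {T : ℝ} (hT : T ≠ 0) (v : ℝ) :
    2 * ∫ t in (0 : ℝ)..T, (1 - t / T) * Real.cos (v * t) = fejer T v := by
  rcases eq_or_ne v 0 with rfl | hv
  · simp only [zero_mul, Real.cos_zero, mul_one, integral_one_sub_div hT, fejer, mul_zero,
      Real.sinc_zero, one_pow]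
    ring
  · rw [integral_one_sub_div_mul_cos hT hv, fejer_eq_one_sub_cos hT hv]

lemma integral_tent_mul {T : ℝ} (hT : 0 < T) {g : ℝ → ℂ} (hg : Continuous g) :
    ∫ t : ℝ, (tent T t : ℂ) * g t
      = ∫ t in (0 : ℝ)..T, ((1 - t / T : ℝ) : ℂ) * (g t + g (-t)) := by
  have hcont : Continuous fun t => (tent T t : ℂ) * g t := by
    have := continuous_tent T
    fun_prop
  have hsupp : ∫ t : ℝ, (tent T t : ℂ) * g t = ∫ t in (-T)..T, (tent T t : ℂ) * g t := by
    rw [intervalIntegral.integral_of_le (neg_le_self hT.le), ← integral_Icc_eq_integral_Ioc,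
      setIntegral_eq_integral_of_forall_compl_eq_zero]
    intro t ht
    rw [tent_eq_zero_of_notMem hT ht, Complex.ofReal_zero, zero_mul]
  have hneg : ∫ t in (-T)..0, (tent T t : ℂ) * g t
      = ∫ t in (0 : ℝ)..T, (tent T t : ℂ) * g (-t) := by
    simpa [tent_neg] using
      (intervalIntegral.integral_comp_neg (a := 0) (b := T) fun t => (tent T t : ℂ) * g t).symm
  rw [hsupp, ← intervalIntegral.integral_add_adjacent_intervals (hcont.intervalIntegrable (-T) 0)
    (hcont.intervalIntegrable 0 T), hneg, add_comm, ← intervalIntegral.integral_add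
      (hcont.intervalIntegrable 0 T) ?_]
  · refine intervalIntegral.integral_congr fun t ht => ?_
    rw [uIcc_of_le hT.le] at ht
    simp only [tent_eq hT ((abs_of_nonneg ht.1).trans_le ht.2), abs_of_nonneg ht.1, mul_add]
  · have := continuous_tent T
    exact Continuous.intervalIntegrable (by fun_prop) 0 T

lemma integral_tent_mul_exp {T : ℝ} (hT : 0 < T) (v : ℝ) :
    ∫ t : ℝ, (tent T t : ℂ) * Complex.exp (Complex.I * v * t) = fejer T v := by
  have hcos (t : ℝ) : Complex.exp (Complex.I * v * t) + Complex.exp (Complex.I * v * (-t : ℝ))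
      = 2 * (Real.cos (v * t) : ℂ) := by
    push_cast
    rw [Complex.two_cos]
    ring_nf
  rw [integral_tent_mul hT (by fun_prop), ← two_mul_integral_one_sub_div_mul_cos hT.ne',
    Complex.ofReal_mul, ← intervalIntegral.integral_ofReal, Complex.ofReal_ofNat,
    ← intervalIntegral.integral_const_mul]
  refine intervalIntegral.integral_congr fun t _ => ?_
  simp only [hcos, Complex.ofReal_mul]
  ring

/-! ### The Wiener–Ikehara theorem -/

section Abel

lemma tendsto_exp_neg_mul_one (u : ℝ) :
    Tendsto (fun ε : ℝ => Real.exp (-ε * u)) (𝓝[>] 0) (𝓝 1) := by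
  refine Tendsto.mono_left (Continuous.tendsto' (by fun_prop) _ _ ?_) nhdsWithin_le_nhds
  rw [neg_zero, zero_mul, Real.exp_zero]

lemma tendsto_one_div_nat_add_one_nhdsGT :
    Tendsto (fun n : ℕ => 1 / ((n : ℝ) + 1)) atTop (𝓝[>] 0) :=
  tendsto_nhdsWithin_iff.2 ⟨tendsto_one_div_add_atTop_nhds_zero_nat,
    Eventually.of_forall fun n => mem_Ioi.2 (by positivity)⟩

lemma tendsto_integral_mul_exp_neg {f : ℝ → ℝ} (hf : IntegrableOn f (Ioi 0)) :
    Tendsto (fun ε => ∫ u in Ioi (0 : ℝ), f u * Real.exp (-ε * u)) (𝓝[>] 0)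
      (𝓝 (∫ u in Ioi (0 : ℝ), f u)) := by
  refine tendsto_integral_filter_of_dominated_convergence (fun u => ‖f u‖)
    (Eventually.of_forall fun ε =>
      hf.aestronglyMeasurable.mul (Continuous.aestronglyMeasurable (by fun_prop))) ?_ hf.norm
    (Eventually.of_forall fun u => ?_)
  · filter_upwards [self_mem_nhdsWithin] with ε hε
    filter_upwards [ae_restrict_mem measurableSet_Ioi] with u hu
    rw [norm_mul, Real.norm_of_nonneg (Real.exp_pos _).le]
    refine mul_le_of_le_one_right (norm_nonneg _) (Real.exp_le_one_iff.2 ?_)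
    exact mul_nonpos_of_nonpos_of_nonneg (neg_nonpos.2 (le_of_lt hε)) (le_of_lt hu)
  · simpa only [mul_one] using (tendsto_exp_neg_mul_one u).const_mul (f u)

lemma integrable_of_tendsto_integral {μ : Measure ℝ} {G : ℕ → ℝ → ℝ} {f : ℝ → ℝ} {L : ℝ}
    (hnn : ∀ n u, 0 ≤ G n u) (hG : ∀ n, Integrable (G n) μ)
    (hlim : ∀ᵐ u ∂μ, Tendsto (fun n => G n u) atTop (𝓝 (f u)))
    (hL : Tendsto (fun n => ∫ u, G n u ∂μ) atTop (𝓝 L)) : Integrable f μ := by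
  refine integrable_of_tendsto hlim (fun n => (hG n).aestronglyMeasurable) ?_
  have hlintegral (n : ℕ) : ∫⁻ u, ‖G n u‖ₑ ∂μ = ENNReal.ofReal (∫ u, G n u ∂μ) := by
    rw [ofReal_integral_eq_lintegral_ofReal (hG n) (Eventually.of_forall (hnn n))]
    exact lintegral_congr fun u => Real.enorm_eq_ofReal (hnn n u)
  simp_rw [hlintegral]
  rw [(ENNReal.tendsto_ofReal hL).liminf_eq]
  exact ENNReal.ofReal_ne_top

lemma integrableOn_of_tendsto_integral_mul_exp_neg {f : ℝ → ℝ} {L : ℝ} (hnn : ∀ u, 0 ≤ f u)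
    (hint : ∀ ε > 0, IntegrableOn (fun u => f u * Real.exp (-ε * u)) (Ioi 0))
    (hL : Tendsto (fun ε => ∫ u in Ioi (0 : ℝ), f u * Real.exp (-ε * u)) (𝓝[>] 0) (𝓝 L)) :
    IntegrableOn f (Ioi 0) := by
  have hseq := tendsto_one_div_nat_add_one_nhdsGT
  refine integrable_of_tendsto_integral
    (G := fun n u => f u * Real.exp (-(1 / ((n : ℝ) + 1)) * u))
    (fun n u => mul_nonneg (hnn u) (Real.exp_pos _).le) (fun n => hint _ (by positivity))
    (Eventually.of_forall fun u => ?_) (hL.comp hseq)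
  simpa only [mul_one, Function.comp_def] using
    ((tendsto_exp_neg_mul_one u).comp hseq).const_mul (f u)

end Abel

section Smoothing

variable {B : ℝ → ℝ} {h : ℂ → ℂ} {T : ℝ}

lemma integrableOn_mul_fejer {f : ℝ → ℝ} {s : Set ℝ} (hf : IntegrableOn f s) (T y : ℝ) :
    IntegrableOn (fun u => f u * fejer T (y - u)) s :=
  hf.mul_bdd ((continuous_fejer T).comp (by fun_prop)).aestronglyMeasurable
    (Eventually.of_forall fun _ => abs_fejer_le T _)

lemma integral_tent_mul_laplace {b : ℝ → ℝ} {ε : ℝ} (hT : 0 < T)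
    (hb : IntegrableOn (fun u => b u * Real.exp (-ε * u)) (Ioi 0)) (y : ℝ) :
    ∫ t : ℝ, (tent T t : ℂ) * (∫ u in Ioi (0 : ℝ), (b u : ℂ)
        * Complex.exp (-(ε + Complex.I * t) * u)) * Complex.exp (Complex.I * y * t)
      = ((∫ u in Ioi (0 : ℝ), b u * Real.exp (-ε * u) * fejer T (y - u) : ℝ) : ℂ) := by
  set Φ : ℝ → ℝ → ℂ := fun t u => (tent T t : ℂ) * ((b u * Real.exp (-ε * u) : ℝ) : ℂ)
    * Complex.exp (Complex.I * (y - u : ℝ) * t) with hΦ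
  have hint : Integrable (Function.uncurry Φ) (volume.prod (volume.restrict (Ioi 0))) := by
    refine ((integrable_tent hT).ofReal (𝕜 := ℂ) |>.mul_prod hb.ofReal).mul_bdd (c := 1)
      (Continuous.aestronglyMeasurable (by fun_prop)) (Eventually.of_forall fun p => ?_)
    rw [mul_assoc, ← Complex.ofReal_mul, mul_comm, Complex.norm_exp_ofReal_mul_I]
  have hinner (t : ℝ) : (tent T t : ℂ) * (∫ u in Ioi (0 : ℝ), (b u : ℂ)
      * Complex.exp (-(ε + Complex.I * t) * u)) * Complex.exp (Complex.I * y * t)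
      = ∫ u in Ioi (0 : ℝ), Φ t u := by
    rw [mul_assoc, ← integral_mul_const, ← integral_const_mul]
    refine integral_congr_ae (Eventually.of_forall fun u => ?_)
    simp only [hΦ]
    push_cast
    rw [mul_assoc (b u : ℂ), ← Complex.exp_add, mul_assoc (tent T t : ℂ), mul_assoc (b u : ℂ),
      ← Complex.exp_add]
    ring_nf
  simp_rw [hinner]
  rw [integral_integral_swap hint, ← integral_complex_ofReal]
  refine integral_congr_ae (Eventually.of_forall fun u => ?_)
  simp only [hΦ, Complex.ofReal_mul _ (fejer _ _), ← integral_tent_mul_exp hT,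
    ← integral_const_mul]
  congr 1 with t
  ring

lemma tendsto_integral_tent_mul (hc : ContinuousOn h {z | 0 ≤ z.re}) (hT : 0 < T) (y : ℝ) :
    Tendsto (fun ε : ℝ => ∫ t : ℝ, (tent T t : ℂ) * h (ε + Complex.I * t)
        * Complex.exp (Complex.I * y * t)) (𝓝[>] 0)
      (𝓝 (∫ t : ℝ, (tent T t : ℂ) * h (Complex.I * t) * Complex.exp (Complex.I * y * t))) := by
  have hcont : ContinuousOn (fun ε : ℝ => ∫ t : ℝ, (tent T t : ℂ)
      * h (ε + Complex.I * t) * Complex.exp (Complex.I * y * t)) (Ici 0) := by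
    have := continuous_tent T
    refine continuousOn_integral_of_compact_support (isCompact_Icc (a := -T) (b := T))
      (((Continuous.continuousOn (by fun_prop)).mul (hc.comp
        (Continuous.continuousOn (by fun_prop)) ?_)).mul (Continuous.continuousOn (by fun_prop))) ?_
    · rintro ⟨ε, t⟩ ⟨hε, -⟩
      simpa using hε
    · intro ε t _ ht
      rw [tent_eq_zero_of_notMem hT ht, Complex.ofReal_zero, zero_mul, zero_mul]
  simpa only [Complex.ofReal_zero, zero_add] using
    (hcont 0 self_mem_Ici).tendsto.mono_left (nhdsWithin_mono _ Ioi_subset_Ici_self)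

lemma tendsto_integral_tent_mul_atTop (T : ℝ) (g : ℝ → ℂ) :
    Tendsto (fun y : ℝ => ∫ t : ℝ, (tent T t : ℂ) * g t * Complex.exp (Complex.I * y * t)) atTop
      (𝓝 0) := by
  have hscale : Tendsto (fun y : ℝ => -(y / (2 * Real.pi))) atTop (cocompact ℝ) :=
    (tendsto_neg_atTop_atBot.comp (tendsto_id.atTop_div_const Real.two_pi_pos)).mono_right
      atBot_le_cocompact
  refine ((Real.tendsto_integral_exp_smul_cocompact
    (fun t => (tent T t : ℂ) * g t)).comp hscale).congr fun y => ?_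
  simp only [Function.comp]
  congr 1 with t
  rw [Circle.smul_def, Real.fourierChar_apply, smul_eq_mul, mul_comm]
  have : (Real.pi : ℂ) ≠ 0 := Complex.ofReal_ne_zero.2 Real.pi_ne_zero
  congr 2
  push_cast
  field_simp

lemma tendsto_integral_fejer_sub (hT : 0 < T) :
    Tendsto (fun y => ∫ u in Ioi (0 : ℝ), fejer T (y - u)) atTop (𝓝 fejerMass) := by
  have hIio : Tendsto (fun y => ∫ v in Iio y, fejer T v) atTop (𝓝 (∫ v, fejer T v)) :=
    (aecover_Iio (μ := volume) tendsto_id).integral_tendsto_of_countably_generated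
      (integrable_fejer T)
  rw [integral_fejer hT] at hIio
  refine hIio.congr fun y => ?_
  rw [← integral_indicator measurableSet_Iio, ← integral_indicator measurableSet_Ioi,
    ← integral_sub_left_eq_self _ volume y]
  congr 1 with u
  simp [indicator]

/-- The mean of `B` against the Fejér kernel of width `T` centred at `y`. -/
def fejerMean (B : ℝ → ℝ) (T y : ℝ) : ℝ := ∫ u in Ioi (0 : ℝ), B u * fejer T (y - u)

lemma integral_mul_exp_neg_mul_fejer {ε : ℝ} (hε : 0 < ε)
    (hint : IntegrableOn (fun u => B u * Real.exp (-ε * u)) (Ioi 0)) (hT : 0 < T)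
    (heq : ∀ z : ℂ, 0 < z.re →
      ∫ u in Ioi (0 : ℝ), ((B u - 1 : ℝ) : ℂ) * Complex.exp (-z * u) = h z) (y : ℝ) :
    ∫ u in Ioi (0 : ℝ), B u * fejer T (y - u) * Real.exp (-ε * u)
      = (∫ u in Ioi (0 : ℝ), fejer T (y - u) * Real.exp (-ε * u))
        + (∫ t : ℝ, (tent T t : ℂ) * h (ε + Complex.I * t)
          * Complex.exp (Complex.I * y * t)).re := by
  have hexp : IntegrableOn (fun u : ℝ => Real.exp (-ε * u)) (Ioi 0) := by
    simpa only [mul_comm] using exp_neg_integrableOn_Ioi 0 hε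
  have hsub : IntegrableOn (fun u => (B u - 1) * Real.exp (-ε * u)) (Ioi 0) := by
    simpa only [sub_mul, one_mul, Pi.sub_def] using hint.sub hexp
  have hh (t : ℝ) : h (ε + Complex.I * t)
      = ∫ u in Ioi (0 : ℝ), ((B u - 1 : ℝ) : ℂ) * Complex.exp (-(ε + Complex.I * t) * u) :=
    (heq _ (by simpa using hε)).symm
  simp_rw [hh]
  rw [integral_tent_mul_laplace hT hsub, Complex.ofReal_re]
  simp_rw [mul_comm (fejer T _)]
  rw [← integral_add (integrableOn_mul_fejer hexp T y) (integrableOn_mul_fejer hsub T y)]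
  congr 1 with u
  ring

lemma tendsto_integral_mul_exp_neg_mul_fejer
    (hint : ∀ ε > 0, IntegrableOn (fun u => B u * Real.exp (-ε * u)) (Ioi 0))
    (hc : ContinuousOn h {z | 0 ≤ z.re})
    (heq : ∀ z : ℂ, 0 < z.re →
      ∫ u in Ioi (0 : ℝ), ((B u - 1 : ℝ) : ℂ) * Complex.exp (-z * u) = h z)
    (hT : 0 < T) (y : ℝ) :
    Tendsto (fun ε => ∫ u in Ioi (0 : ℝ), B u * fejer T (y - u) * Real.exp (-ε * u)) (𝓝[>] 0)
      (𝓝 ((∫ u in Ioi (0 : ℝ), fejer T (y - u)) + (∫ t : ℝ, (tent T t : ℂ) * h (Complex.I * t)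
        * Complex.exp (Complex.I * y * t)).re)) := by
  have hfejer : IntegrableOn (fun u => fejer T (y - u)) (Ioi 0) :=
    ((integrable_fejer T).comp_sub_left y).integrableOn
  refine ((tendsto_integral_mul_exp_neg hfejer).add ((Complex.continuous_re.tendsto _).comp
    (tendsto_integral_tent_mul hc hT y))).congr' ?_
  filter_upwards [self_mem_nhdsWithin] with ε hε
  exact (integral_mul_exp_neg_mul_fejer hε (hint ε hε) hT heq y).symm

lemma integrableOn_mul_fejer_of_laplace (hnn : ∀ u, 0 ≤ B u)
    (hint : ∀ ε > 0, IntegrableOn (fun u => B u * Real.exp (-ε * u)) (Ioi 0))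
    (hc : ContinuousOn h {z | 0 ≤ z.re})
    (heq : ∀ z : ℂ, 0 < z.re →
      ∫ u in Ioi (0 : ℝ), ((B u - 1 : ℝ) : ℂ) * Complex.exp (-z * u) = h z)
    (hT : 0 < T) (y : ℝ) :
    IntegrableOn (fun u => B u * fejer T (y - u)) (Ioi 0) := by
  refine integrableOn_of_tendsto_integral_mul_exp_neg
    (fun u => mul_nonneg (hnn u) (fejer_nonneg hT.le _)) (fun ε hε => ?_)
    (tendsto_integral_mul_exp_neg_mul_fejer hint hc heq hT y)
  simpa only [mul_right_comm] using integrableOn_mul_fejer (hint ε hε) T y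

lemma tendsto_fejerMean_of_laplace (hnn : ∀ u, 0 ≤ B u)
    (hint : ∀ ε > 0, IntegrableOn (fun u => B u * Real.exp (-ε * u)) (Ioi 0))
    (hc : ContinuousOn h {z | 0 ≤ z.re})
    (heq : ∀ z : ℂ, 0 < z.re →
      ∫ u in Ioi (0 : ℝ), ((B u - 1 : ℝ) : ℂ) * Complex.exp (-z * u) = h z) (hT : 0 < T) :
    Tendsto (fejerMean B T) atTop (𝓝 fejerMass) := by
  have hmean (y : ℝ) := tendsto_nhds_unique
    (tendsto_integral_mul_exp_neg (integrableOn_mul_fejer_of_laplace hnn hint hc heq hT y))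
    (tendsto_integral_mul_exp_neg_mul_fejer hint hc heq hT y)
  have hlim := (tendsto_integral_fejer_sub hT).add ((Complex.continuous_re.tendsto _).comp
    (tendsto_integral_tent_mul_atTop T fun t => h (Complex.I * t)))
  rw [Complex.zero_re, add_zero] at hlim
  exact hlim.congr fun y => (hmean y).symm

end Smoothing

section Tauberian

variable {B : ℝ → ℝ} {T : ℝ}

lemma setIntegral_Icc_fejer_sub (T c δ : ℝ) :
    ∫ u in Icc (c - δ) (c + δ), fejer T (c - u) = ∫ v in Icc (-δ) δ, fejer T v := by
  have hpre : (fun u => c - u) ⁻¹' Icc (-δ) δ = Icc (c - δ) (c + δ) := by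
    rw [preimage_const_sub_Icc, sub_neg_eq_add]
  rw [← hpre]
  exact (Measure.measurePreserving_sub_left volume c).setIntegral_preimage_emb
    (MeasurableEquiv.subLeft c).measurableEmbedding (fejer T) _

lemma integrableOn_fejer_sub (T y : ℝ) (s : Set ℝ) : IntegrableOn (fun u => fejer T (y - u)) s :=
  ((integrable_fejer T).comp_sub_left y).integrableOn

lemma integral_fejer_sub (hT : 0 < T) (y : ℝ) : ∫ u, fejer T (y - u) = fejerMass := by
  rw [integral_sub_left_eq_self (fejer T), integral_fejer hT]

lemma le_mul_exp_of_monotone (hB : Monotone fun u => B u * Real.exp u) {u v : ℝ} (huv : u ≤ v) :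
    B u ≤ B v * Real.exp (v - u) := by
  rw [Real.exp_sub, mul_div_assoc', le_div_iff₀ (Real.exp_pos u)]
  exact hB huv

lemma mul_setIntegral_fejer_le_fejerMean (hnn : ∀ u, 0 ≤ B u)
    (hB : Monotone fun u => B u * Real.exp u) (hT : 0 ≤ T) {y δ : ℝ} (hy : 0 < y)
    (hint : IntegrableOn (fun u => B u * fejer T (y + δ - u)) (Ioi 0)) :
    B y * (Real.exp (-(2 * δ)) * ∫ v in Icc (-δ) δ, fejer T v) ≤ fejerMean B T (y + δ) := by
  have hsub : Icc (y + δ - δ) (y + δ + δ) ⊆ Ioi (0 : ℝ) := fun u hu =>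
    mem_Ioi.2 (by linarith [hu.1])
  rw [← setIntegral_Icc_fejer_sub T (y + δ) δ, ← mul_assoc, ← integral_const_mul]
  refine (setIntegral_mono_on ((integrableOn_fejer_sub T _ _).const_mul _) (hint.mono_set hsub)
    measurableSet_Icc fun u hu => ?_).trans (setIntegral_mono_set hint (Eventually.of_forall
      fun u => mul_nonneg (hnn u) (fejer_nonneg hT _)) (Eventually.of_forall hsub))
  refine mul_le_mul_of_nonneg_right ?_ (fejer_nonneg hT _)
  have hdelay : Real.exp (u - y) ≤ Real.exp (2 * δ) := Real.exp_le_exp.2 (by linarith [hu.2])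
  rw [Real.exp_neg, ← div_eq_mul_inv, div_le_iff₀ (Real.exp_pos _)]
  exact (le_mul_exp_of_monotone hB (by linarith [hu.1])).trans
    (mul_le_mul_of_nonneg_left hdelay (hnn u))

lemma eventually_lt_of_tendsto_fejerMean (hnn : ∀ u, 0 ≤ B u)
    (hB : Monotone fun u => B u * Real.exp u)
    (hint : ∀ T > 0, ∀ y, IntegrableOn (fun u => B u * fejer T (y - u)) (Ioi 0))
    (hmean : ∀ T > 0, Tendsto (fejerMean B T) atTop (𝓝 fejerMass)) {b : ℝ} (hb : 1 < b) :
    ∀ᶠ y in atTop, B y < b := by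
  obtain ⟨δ, hδb, hδ⟩ : ∃ δ : ℝ, 1 < b * Real.exp (-(2 * δ)) ∧ 0 < δ := by
    have hcont : Tendsto (fun δ : ℝ => b * Real.exp (-(2 * δ))) (𝓝[>] 0) (𝓝 b) :=
      (Continuous.tendsto' (by fun_prop) _ _ (by simp)).mono_left nhdsWithin_le_nhds
    exact ((hcont.eventually_const_lt hb).and self_mem_nhdsWithin).exists
  have hwindow : ∀ᶠ T in atTop,
      fejerMass < b * Real.exp (-(2 * δ)) * ∫ v in Icc (-δ) δ, fejer T v :=
    ((tendsto_setIntegral_Icc_fejer hδ).const_mul _).eventually_const_lt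
      (lt_mul_of_one_lt_left fejerMass_pos hδb)
  obtain ⟨T, hTb, hT⟩ := (hwindow.and (eventually_gt_atTop 0)).exists
  have hpos : 0 < Real.exp (-(2 * δ)) * ∫ v in Icc (-δ) δ, fejer T v :=
    pos_of_mul_pos_right ((fejerMass_pos.trans hTb).trans_eq (mul_assoc ..)) (by positivity)
  have hshift : Tendsto (fun y : ℝ => y + δ) atTop atTop :=
    tendsto_atTop_add_const_right _ _ tendsto_id
  filter_upwards [((hmean T hT).comp hshift).eventually_lt_const hTb, eventually_gt_atTop 0]
    with y hy hy0
  refine lt_of_mul_lt_mul_right ?_ hpos.le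
  exact (mul_setIntegral_fejer_le_fejerMean hnn hB hT.le hy0 (hint T hT _)).trans_lt
    (hy.trans_eq (mul_assoc ..))

lemma exists_pos_bound_of_tendsto_fejerMean (hnn : ∀ u, 0 ≤ B u)
    (hB : Monotone fun u => B u * Real.exp u)
    (hint : ∀ T > 0, ∀ y, IntegrableOn (fun u => B u * fejer T (y - u)) (Ioi 0))
    (hmean : ∀ T > 0, Tendsto (fejerMean B T) atTop (𝓝 fejerMass)) :
    ∃ M, 0 < M ∧ ∀ u, 0 < u → B u ≤ M := by
  obtain ⟨Y, hY⟩ := eventually_atTop.1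
    (eventually_lt_of_tendsto_fejerMean hnn hB hint hmean one_lt_two)
  refine ⟨max 2 (B Y * Real.exp Y), lt_max_of_lt_left two_pos, fun u hu => ?_⟩
  rcases le_total Y u with hYu | huY
  · exact (hY u hYu).le.trans (le_max_left _ _)
  · exact ((le_mul_of_one_le_right (hnn u) (Real.one_le_exp hu.le)).trans (hB huY)).trans
      (le_max_right _ _)

lemma setIntegral_mul_fejer_window_le (hnn : ∀ u, 0 ≤ B u)
    (hB : Monotone fun u => B u * Real.exp u) (hT : 0 < T) {y δ : ℝ}
    (hint : IntegrableOn (fun u => B u * fejer T (y - δ - u)) (Icc (y - δ - δ) (y - δ + δ))) :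
    ∫ u in Icc (y - δ - δ) (y - δ + δ), B u * fejer T (y - δ - u)
      ≤ B y * Real.exp (2 * δ) * fejerMass := by
  have hfejer (u : ℝ) : 0 ≤ fejer T (y - δ - u) := fejer_nonneg hT.le _
  calc ∫ u in Icc (y - δ - δ) (y - δ + δ), B u * fejer T (y - δ - u)
      ≤ ∫ u in Icc (y - δ - δ) (y - δ + δ), (B y * Real.exp (2 * δ)) * fejer T (y - δ - u) := by
        refine setIntegral_mono_on hint ((integrableOn_fejer_sub T _ _).const_mul _)
          measurableSet_Icc fun u hu => mul_le_mul_of_nonneg_right ?_ (hfejer u)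
        exact (le_mul_exp_of_monotone hB (by linarith [hu.2])).trans
          (mul_le_mul_of_nonneg_left (Real.exp_le_exp.2 (by linarith [hu.1])) (hnn y))
    _ = (B y * Real.exp (2 * δ)) * ∫ u in Icc (y - δ - δ) (y - δ + δ), fejer T (y - δ - u) :=
        integral_const_mul _ _
    _ ≤ B y * Real.exp (2 * δ) * fejerMass := by
        refine mul_le_mul_of_nonneg_left ?_ (mul_nonneg (hnn y) (Real.exp_pos _).le)
        rw [← integral_fejer_sub hT (y - δ)]
        exact setIntegral_le_integral ((integrable_fejer T).comp_sub_left _)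
          (Eventually.of_forall hfejer)

lemma setIntegral_mul_fejer_tail_le {M : ℝ} (hM : 0 ≤ M) (hBM : ∀ u, 0 < u → B u ≤ M)
    (hT : 0 < T) {c δ : ℝ} (hint : IntegrableOn (fun u => B u * fejer T (c - u)) (Ioi 0)) :
    ∫ u in Ioi 0 \ Icc (c - δ) (c + δ), B u * fejer T (c - u)
      ≤ M * (fejerMass - ∫ v in Icc (-δ) δ, fejer T v) := by
  have hfejer (u : ℝ) : 0 ≤ fejer T (c - u) := fejer_nonneg hT.le _
  calc ∫ u in Ioi 0 \ Icc (c - δ) (c + δ), B u * fejer T (c - u)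
      ≤ ∫ u in Ioi 0 \ Icc (c - δ) (c + δ), M * fejer T (c - u) :=
        setIntegral_mono_on (hint.mono_set sdiff_subset)
          ((integrableOn_fejer_sub T _ _).const_mul _) (measurableSet_Ioi.diff measurableSet_Icc)
          fun u hu => mul_le_mul_of_nonneg_right (hBM u hu.1) (hfejer u)
    _ = M * ∫ u in Ioi 0 \ Icc (c - δ) (c + δ), fejer T (c - u) := integral_const_mul _ _
    _ ≤ M * (fejerMass - ∫ v in Icc (-δ) δ, fejer T v) := by
        refine mul_le_mul_of_nonneg_left ?_ hM
        rw [← setIntegral_Icc_fejer_sub T c δ, ← integral_fejer_sub hT c,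
          ← setIntegral_compl measurableSet_Icc ((integrable_fejer T).comp_sub_left _)]
        exact setIntegral_mono_set (integrableOn_fejer_sub T _ _) (Eventually.of_forall hfejer)
          (Eventually.of_forall fun u hu => hu.2)

lemma fejerMean_le (hnn : ∀ u, 0 ≤ B u) (hB : Monotone fun u => B u * Real.exp u) {M : ℝ}
    (hM : 0 ≤ M) (hBM : ∀ u, 0 < u → B u ≤ M) (hT : 0 < T) {y δ : ℝ} (hy : 2 * δ < y)
    (hint : IntegrableOn (fun u => B u * fejer T (y - δ - u)) (Ioi 0)) :
    fejerMean B T (y - δ)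
      ≤ B y * Real.exp (2 * δ) * fejerMass + M * (fejerMass - ∫ v in Icc (-δ) δ, fejer T v) := by
  have hsub : Icc (y - δ - δ) (y - δ + δ) ⊆ Ioi (0 : ℝ) := fun u hu =>
    mem_Ioi.2 (by linarith [hu.1])
  rw [fejerMean, ← integral_inter_add_sdiff measurableSet_Icc hint (t := Icc _ _),
    inter_eq_self_of_subset_right hsub]
  exact add_le_add (setIntegral_mul_fejer_window_le hnn hB hT (hint.mono_set hsub))
    (setIntegral_mul_fejer_tail_le hM hBM hT hint)

lemma eventually_gt_of_tendsto_fejerMean (hnn : ∀ u, 0 ≤ B u)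
    (hB : Monotone fun u => B u * Real.exp u)
    (hint : ∀ T > 0, ∀ y, IntegrableOn (fun u => B u * fejer T (y - u)) (Ioi 0))
    (hmean : ∀ T > 0, Tendsto (fejerMean B T) atTop (𝓝 fejerMass)) {a : ℝ} (ha : a < 1) :
    ∀ᶠ y in atTop, a < B y := by
  obtain ⟨M, hM, hBM⟩ := exists_pos_bound_of_tendsto_fejerMean hnn hB hint hmean
  obtain ⟨δ, hδa, hδ⟩ : ∃ δ : ℝ, a * Real.exp (2 * δ) < 1 ∧ 0 < δ := by
    have hcont : Tendsto (fun δ : ℝ => a * Real.exp (2 * δ)) (𝓝[>] 0) (𝓝 a) :=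
      (Continuous.tendsto' (by fun_prop) _ _ (by simp)).mono_left nhdsWithin_le_nhds
    exact ((hcont.eventually_lt_const ha).and self_mem_nhdsWithin).exists
  have hwindow : ∀ᶠ T in atTop, a * Real.exp (2 * δ) * fejerMass
      + M * (fejerMass - ∫ v in Icc (-δ) δ, fejer T v) < fejerMass := by
    refine ((((tendsto_setIntegral_Icc_fejer hδ).const_sub fejerMass).const_mul M).const_add
      (a * Real.exp (2 * δ) * fejerMass)).eventually_lt_const ?_
    rw [sub_self, mul_zero, add_zero]
    exact mul_lt_of_lt_one_left fejerMass_pos hδa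
  obtain ⟨T, hTa, hT⟩ := (hwindow.and (eventually_gt_atTop 0)).exists
  have hshift : Tendsto (fun y : ℝ => y - δ) atTop atTop :=
    tendsto_atTop_add_const_right _ (-δ) tendsto_id
  filter_upwards [((hmean T hT).comp hshift).eventually_const_lt hTa, eventually_gt_atTop (2 * δ)]
    with y hy hyδ
  have hle := hy.trans_le (fejerMean_le hnn hB hM.le hBM hT hyδ (hint T hT _))
  refine lt_of_mul_lt_mul_right ?_ (mul_pos (Real.exp_pos (2 * δ)) fejerMass_pos).le
  linarith

end Tauberian

/-- **Wiener–Ikehara theorem**, in Laplace transform form, for `S u = B u * exp u`. -/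
theorem wiener_ikehara {B : ℝ → ℝ} {h : ℂ → ℂ} (hB : Monotone fun u => B u * Real.exp u)
    (hnn : ∀ u, 0 ≤ B u)
    (hint : ∀ ε > 0, IntegrableOn (fun u => B u * Real.exp (-ε * u)) (Ioi 0))
    (hc : ContinuousOn h {z | 0 ≤ z.re})
    (heq : ∀ z : ℂ, 0 < z.re →
      ∫ u in Ioi (0 : ℝ), ((B u - 1 : ℝ) : ℂ) * Complex.exp (-z * u) = h z) :
    Tendsto B atTop (𝓝 1) := by
  have hint' : ∀ T > 0, ∀ y, IntegrableOn (fun u => B u * fejer T (y - u)) (Ioi 0) :=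
    fun T hT => integrableOn_mul_fejer_of_laplace hnn hint hc heq hT
  have hmean : ∀ T > 0, Tendsto (fejerMean B T) atTop (𝓝 fejerMass) :=
    fun T hT => tendsto_fejerMean_of_laplace hnn hint hc heq hT
  exact tendsto_order.2 ⟨fun a => eventually_gt_of_tendsto_fejerMean hnn hB hint' hmean,
    fun b => eventually_lt_of_tendsto_fejerMean hnn hB hint' hmean⟩

/-! ### Generalised Dirichlet series as Laplace transforms -/

lemma norm_cexp_neg_mul (s : ℂ) (u : ℝ) : ‖Complex.exp (-s * u)‖ = Real.exp (-s.re * u) := by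
  rw [Complex.norm_exp, Complex.re_mul_ofReal, Complex.neg_re]

lemma integrableOn_cexp_neg_mul {s : ℂ} (hs : 0 < s.re) (a : ℝ) :
    IntegrableOn (fun u : ℝ => Complex.exp (-s * u)) (Ioi a) :=
  integrableOn_exp_mul_complex_Ioi (by rwa [Complex.neg_re, neg_lt_zero]) a

lemma integral_cexp_neg_mul_Ioi {s : ℂ} (hs : 0 < s.re) (a : ℝ) :
    ∫ u in Ioi a, Complex.exp (-s * u) = Complex.exp (-s * a) / s := by
  rw [integral_exp_mul_complex_Ioi (by rwa [Complex.neg_re, neg_lt_zero]), neg_div_neg_eq]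

section Differentiability

variable {f : ℝ → ℂ} {C θ δ : ℝ} {s s₀ : ℂ}

lemma norm_mul_cexp_neg_le (hf : ∀ u, 0 < u → ‖f u‖ ≤ C * Real.exp (θ * u))
    (hs : θ + δ ≤ s.re) {u : ℝ} (hu : 0 < u) :
    ‖f u * Complex.exp (-s * u)‖ ≤ C * Real.exp (-δ * u) := by
  have hexp : Real.exp (-s.re * u) ≤ Real.exp (-(θ + δ) * u) := by gcongr
  calc ‖f u * Complex.exp (-s * u)‖
      = ‖f u‖ * Real.exp (-s.re * u) := by rw [norm_mul, norm_cexp_neg_mul]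
    _ ≤ (C * Real.exp (θ * u)) * Real.exp (-(θ + δ) * u) :=
      mul_le_mul (hf u hu) hexp (Real.exp_pos _).le ((norm_nonneg _).trans (hf u hu))
    _ = C * Real.exp (-δ * u) := by rw [mul_assoc, ← Real.exp_add]; ring_nf

lemma sub_le_re_of_mem_ball (hs : s ∈ Metric.ball s₀ δ) : s₀.re - δ ≤ s.re := by
  have h := (Complex.abs_re_le_norm (s - s₀)).trans (mem_ball_iff_norm.1 hs).le
  rw [Complex.sub_re, abs_le] at h
  linarith [h.1]

lemma self_le_div_mul_exp (hδ : 0 < δ) (u : ℝ) : u ≤ 1 / δ * Real.exp (δ * u) := by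
  have h := Real.add_one_le_exp (δ * u)
  rw [one_div_mul_eq_div, le_div_iff₀ hδ]
  linarith

lemma norm_self_mul_mul_cexp_neg_le (hδ : 0 < δ)
    (hf : ∀ u, 0 < u → ‖f u‖ ≤ C * Real.exp (θ * u)) (hs : θ + 2 * δ ≤ s.re) {u : ℝ} (hu : 0 < u) :
    ‖-(u : ℂ) * (f u * Complex.exp (-s * u))‖ ≤ 1 / δ * C * Real.exp (-δ * u) := by
  rw [norm_mul, norm_neg, Complex.norm_real, Real.norm_of_nonneg hu.le]
  calc u * ‖f u * Complex.exp (-s * u)‖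
      ≤ (1 / δ * Real.exp (δ * u)) * (C * Real.exp (-(2 * δ) * u)) :=
        mul_le_mul (self_le_div_mul_exp hδ u) (norm_mul_cexp_neg_le hf hs hu) (norm_nonneg _)
          (by positivity)
    _ = 1 / δ * C * (Real.exp (δ * u) * Real.exp (-(2 * δ) * u)) := by ring
    _ = 1 / δ * C * Real.exp (-δ * u) := by rw [← Real.exp_add]; ring_nf

lemma differentiableOn_laplace (hfm : Measurable f)
    (hf : ∀ u, 0 < u → ‖f u‖ ≤ C * Real.exp (θ * u)) :
    DifferentiableOn ℂ (fun s => ∫ u in Ioi (0 : ℝ), f u * Complex.exp (-s * u))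
      {s | θ < s.re} := by
  intro s₀ hs₀
  obtain ⟨δ, hδ, hs₀δ⟩ : ∃ δ, 0 < δ ∧ s₀.re = θ + 3 * δ :=
    ⟨(s₀.re - θ) / 3, by linarith [mem_ofPred.1 hs₀], by ring⟩
  have hre {s : ℂ} (hs : s ∈ Metric.ball s₀ δ) : θ + 2 * δ ≤ s.re := by
    linarith [sub_le_re_of_mem_ball hs]
  have hmeas (s : ℂ) : Measurable fun u : ℝ => f u * Complex.exp (-s * u) :=
    hfm.mul (by fun_prop)
  have hint : IntegrableOn (fun u => f u * Complex.exp (-s₀ * u)) (Ioi 0) := by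
    refine Integrable.mono' ((exp_neg_integrableOn_Ioi 0 hδ).const_mul C)
      (hmeas s₀).aestronglyMeasurable ?_
    filter_upwards [ae_restrict_mem measurableSet_Ioi] with u hu
    exact norm_mul_cexp_neg_le hf (by linarith) hu
  have hderiv (u : ℝ) (s : ℂ) : HasDerivAt (fun s : ℂ => f u * Complex.exp (-s * u))
      (-(u : ℂ) * (f u * Complex.exp (-s * u))) s := by
    refine ((((hasDerivAt_id s).neg.mul_const (u : ℂ)).cexp).const_mul (f u)).congr_deriv ?_
    simp only [Pi.neg_apply, id_eq]
    ring
  refine (hasDerivAt_integral_of_dominated_loc_of_deriv_le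
    (bound := fun u => 1 / δ * C * Real.exp (-δ * u)) (Metric.ball_mem_nhds s₀ hδ)
    (Eventually.of_forall fun s => (hmeas s).aestronglyMeasurable) hint
    (Measurable.mul (by fun_prop) (hmeas s₀)).aestronglyMeasurable ?_
    ((exp_neg_integrableOn_Ioi 0 hδ).const_mul _)
    (Eventually.of_forall fun u s _ =>
      hderiv u s)).2.differentiableAt.differentiableWithinAt
  filter_upwards [ae_restrict_mem measurableSet_Ioi] with u hu s hs
  exact norm_self_mul_mul_cexp_neg_le hδ hf (hre hs) hu

end Differentiability

/-- The summatory function `∑_{ℓ i ≤ u} w i` of the coefficients of the generalised Dirichlet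
series `∑ i, w i * exp (-s * ℓ i)`. -/
def summatory {ι E : Type*} [AddCommMonoid E] [TopologicalSpace E] (w : ι → E) (ℓ : ι → ℝ)
    (u : ℝ) : E :=
  ∑' i, if ℓ i ≤ u then w i else 0

section Summatory

variable {ι E F : Type*} [NormedAddCommGroup E] [CompleteSpace E] {w v : ι → E} {ℓ : ι → ℝ} {σ : ℝ}

lemma summable_ite_le (hσ : 0 ≤ σ) (hw : Summable fun i => ‖w i‖ * Real.exp (-σ * ℓ i)) (u : ℝ) :
    Summable fun i => if ℓ i ≤ u then w i else 0 := by
  refine Summable.of_norm_bounded (hw.mul_left (Real.exp (σ * u))) fun i => ?_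
  split_ifs with h
  · rw [mul_left_comm, ← Real.exp_add]
    refine le_mul_of_one_le_right (norm_nonneg _) (Real.one_le_exp ?_)
    nlinarith
  · rw [norm_zero]
    positivity

lemma summatory_add (hσ : 0 ≤ σ) (hv : Summable fun i => ‖v i‖ * Real.exp (-σ * ℓ i))
    (hw : Summable fun i => ‖w i‖ * Real.exp (-σ * ℓ i)) (u : ℝ) :
    summatory (fun i => v i + w i) ℓ u = summatory v ℓ u + summatory w ℓ u := by
  rw [summatory, summatory, summatory,
    ← (summable_ite_le hσ hv u).tsum_add (summable_ite_le hσ hw u)]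
  exact tsum_congr fun i => by split_ifs <;> simp

lemma summatory_map [NormedAddCommGroup F] [NormedSpace ℝ E] [NormedSpace ℝ F] (L : E →L[ℝ] F)
    (hσ : 0 ≤ σ) (hw : Summable fun i => ‖w i‖ * Real.exp (-σ * ℓ i)) (u : ℝ) :
    summatory (fun i => L (w i)) ℓ u = L (summatory w ℓ u) := by
  rw [summatory, summatory, L.map_tsum (summable_ite_le hσ hw u)]
  exact tsum_congr fun i => by split_ifs <;> simp

end Summatory

lemma summatory_nonneg {ι : Type*} {w : ι → ℝ} (hw : ∀ i, 0 ≤ w i) (ℓ : ι → ℝ) (u : ℝ) :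
    0 ≤ summatory w ℓ u :=
  tsum_nonneg fun i => by split_ifs; exacts [hw i, le_rfl]

lemma monotone_summatory {ι : Type*} {w ℓ : ι → ℝ} {σ : ℝ} (hσ : 0 ≤ σ) (hw : ∀ i, 0 ≤ w i)
    (hsum : Summable fun i => ‖w i‖ * Real.exp (-σ * ℓ i)) : Monotone (summatory w ℓ) := by
  intro u v huv
  refine (summable_ite_le hσ hsum u).tsum_le_tsum (fun i => ?_) (summable_ite_le hσ hsum v)
  split_ifs with hu hv hv
  exacts [le_rfl, absurd (hu.trans huv) hv, hw i, le_rfl]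

lemma measurable_summatory {ι : Type*} [Countable ι] (w : ι → ℂ) (ℓ : ι → ℝ) :
    Measurable (summatory w ℓ) :=
  Measurable.tsum fun _ => Measurable.ite measurableSet_Ici measurable_const measurable_const

section Laplace

variable {ι : Type*} {w : ι → ℂ} {ℓ : ι → ℝ} {s : ℂ}

lemma integrable_tsum_of_summable_integral_norm {α E : Type*} [Countable ι] [MeasurableSpace α]
    {μ : Measure α} [NormedAddCommGroup E] [MeasurableSpace E] [BorelSpace E]
    [SecondCountableTopology E] [CompleteSpace E] {F : ι → α → E} (hF : ∀ i, Integrable (F i) μ)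
    (hmeas : ∀ i, Measurable (F i)) (hsum : Summable fun i => ∫ a, ‖F i a‖ ∂μ) :
    Integrable (fun a => ∑' i, F i a) μ := by
  refine ⟨(Measurable.tsum hmeas).aestronglyMeasurable, ?_⟩
  refine (lintegral_mono fun a => enorm_tsum_le_tsum_enorm).trans_lt ?_
  rw [lintegral_tsum fun i => (hmeas i).enorm.aemeasurable]
  simp_rw [← fun i => ofReal_integral_norm_eq_lintegral_enorm (hF i)]
  exact hsum.tsum_ofReal_lt_top

lemma summatory_mul_cexp (w : ι → ℂ) (ℓ : ι → ℝ) (s : ℂ) (u : ℝ) :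
    summatory w ℓ u * Complex.exp (-s * u)
      = ∑' i, (Ici (ℓ i)).indicator (fun u : ℝ => w i * Complex.exp (-s * u)) u := by
  rw [summatory, ← tsum_mul_right]
  exact tsum_congr fun i => by by_cases h : ℓ i ≤ u <;> simp [h]

lemma setIntegral_Ioi_indicator_Ici {E : Type*} [NormedAddCommGroup E] [NormedSpace ℝ E] {a b : ℝ}
    (hab : a ≤ b) (f : ℝ → E) : ∫ u in Ioi a, (Ici b).indicator f u = ∫ u in Ioi b, f u := by
  have hae : (Ioi a ∩ Ici b : Set ℝ) =ᵐ[volume] (Ioi a ∩ Ioi b : Set ℝ) :=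
    (ae_eq_refl _).inter Ioi_ae_eq_Ici.symm
  rw [setIntegral_indicator measurableSet_Ici, setIntegral_congr_set hae, Ioi_inter_Ioi,
    sup_eq_right.2 hab]

lemma integral_indicator_mul_cexp (hs : 0 < s.re) {a : ℝ} (ha : 0 ≤ a) (z : ℂ) :
    ∫ u in Ioi (0 : ℝ), (Ici a).indicator (fun u : ℝ => z * Complex.exp (-s * u)) u
      = z * Complex.exp (-s * a) / s := by
  rw [setIntegral_Ioi_indicator_Ici ha, integral_const_mul, integral_cexp_neg_mul_Ioi hs,
    mul_div_assoc]

lemma integral_norm_indicator_mul_cexp (hs : 0 < s.re) {a : ℝ} (ha : 0 ≤ a) (z : ℂ) :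
    ∫ u in Ioi (0 : ℝ), ‖(Ici a).indicator (fun u : ℝ => z * Complex.exp (-s * u)) u‖
      = ‖z‖ * Real.exp (-s.re * a) / s.re := by
  simp_rw [norm_indicator_eq_indicator_norm, norm_mul, norm_cexp_neg_mul]
  rw [setIntegral_Ioi_indicator_Ici ha, integral_const_mul,
    integral_exp_mul_Ioi (neg_lt_zero.2 hs), neg_div_neg_eq, mul_div_assoc]

lemma integrableOn_indicator_mul_cexp (hs : 0 < s.re) (a : ℝ) (z : ℂ) (t : Set ℝ) :
    IntegrableOn ((Ici a).indicator fun u : ℝ => z * Complex.exp (-s * u)) t :=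
  ((integrable_indicator_iff measurableSet_Ici).2 ((integrableOn_Ici_iff_integrableOn_Ioi
    (by finiteness)).2 ((integrableOn_cexp_neg_mul hs a).const_mul z))).integrableOn

lemma summable_integral_norm_indicator_mul_cexp (hℓ : ∀ i, 0 ≤ ℓ i) (hs : 0 < s.re)
    (hsum : Summable fun i => ‖w i‖ * Real.exp (-s.re * ℓ i)) :
    Summable fun i => ∫ u in Ioi (0 : ℝ),
      ‖(Ici (ℓ i)).indicator (fun u : ℝ => w i * Complex.exp (-s * u)) u‖ := by
  simp_rw [fun i => integral_norm_indicator_mul_cexp hs (hℓ i) (w i)]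
  exact hsum.div_const _

variable [Countable ι]

lemma integrableOn_summatory_mul_cexp (hℓ : ∀ i, 0 ≤ ℓ i) (hs : 0 < s.re)
    (hsum : Summable fun i => ‖w i‖ * Real.exp (-s.re * ℓ i)) :
    IntegrableOn (fun u => summatory w ℓ u * Complex.exp (-s * u)) (Ioi 0) := by
  simp_rw [summatory_mul_cexp]
  exact integrable_tsum_of_summable_integral_norm
    (fun i => integrableOn_indicator_mul_cexp hs (ℓ i) (w i) _)
    (fun i => Measurable.indicator (by fun_prop) measurableSet_Ici)
    (summable_integral_norm_indicator_mul_cexp hℓ hs hsum)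

lemma integral_summatory_mul_cexp (hℓ : ∀ i, 0 ≤ ℓ i) (hs : 0 < s.re)
    (hsum : Summable fun i => ‖w i‖ * Real.exp (-s.re * ℓ i)) :
    ∫ u in Ioi (0 : ℝ), summatory w ℓ u * Complex.exp (-s * u)
      = (∑' i, w i * Complex.exp (-s * ℓ i)) / s := by
  simp_rw [summatory_mul_cexp, ← tsum_div_const, ← integral_indicator_mul_cexp hs (hℓ _)]
  exact (integral_tsum_of_summable_integral_norm
    (fun i => integrableOn_indicator_mul_cexp hs (ℓ i) (w i) _)
    (summable_integral_norm_indicator_mul_cexp hℓ hs hsum)).symm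

end Laplace

section WienerIkehara

open ComplexConjugate

variable {ι : Type*} {ℓ : ι → ℝ} {w : ι → ℝ} {c : ℝ} {R : ℂ → ℂ}

lemma ne_zero_of_re_pos {z : ℂ} (hz : 0 < z.re) : z ≠ 0 := by
  rintro rfl
  exact lt_irrefl _ hz

lemma summatory_ofReal {σ : ℝ} (hσ : 0 ≤ σ)
    (hsum : Summable fun i => ‖w i‖ * Real.exp (-σ * ℓ i)) (u : ℝ) :
    summatory (fun i => (w i : ℂ)) ℓ u = summatory w ℓ u :=
  summatory_map Complex.ofRealCLM hσ hsum u

lemma integrableOn_mul_exp_neg_of_cexp {f : ℝ → ℝ} {σ : ℝ} {t : Set ℝ}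
    (hf : IntegrableOn (fun u => (f u : ℂ) * Complex.exp (-σ * u)) t) :
    IntegrableOn (fun u => f u * Real.exp (-σ * u)) t := by
  refine hf.re.congr (Eventually.of_forall fun u => ?_)
  simp only [RCLike.re_to_complex, Complex.re_ofReal_mul]
  rw [← Complex.ofReal_neg, ← Complex.ofReal_mul, Complex.exp_ofReal_re]

lemma laplace_normalised_sub_one {f : ℝ → ℝ} {c : ℝ} {z : ℂ} (hz : 0 < z.re)
    (hf : IntegrableOn (fun u => (f u : ℂ) * Complex.exp (-(1 + z) * u)) (Ioi 0)) :
    ∫ u in Ioi (0 : ℝ), ((f u * Real.exp (-u) / c - 1 : ℝ) : ℂ) * Complex.exp (-z * u)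
      = (∫ u in Ioi (0 : ℝ), (f u : ℂ) * Complex.exp (-(1 + z) * u)) / c - 1 / z := by
  have hsplit (u : ℝ) : ((f u * Real.exp (-u) / c - 1 : ℝ) : ℂ) * Complex.exp (-z * u)
      = (f u : ℂ) * Complex.exp (-(1 + z) * u) / c - Complex.exp (-z * u) := by
    have hexp : Complex.exp (-(1 + z) * u) = Complex.exp (-u) * Complex.exp (-z * u) := by
      rw [← Complex.exp_add]
      ring_nf
    rw [hexp]
    push_cast
    ring
  simp_rw [hsplit]
  rw [integral_sub (hf.div_const _) (integrableOn_cexp_neg_mul hz 0), integral_div,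
    integral_cexp_neg_mul_Ioi hz, Complex.ofReal_zero, mul_zero, Complex.exp_zero]

lemma summable_mul_cexp {w : ι → ℂ} {s : ℂ}
    (hw : Summable fun i => ‖w i‖ * Real.exp (-s.re * ℓ i)) :
    Summable fun i => w i * Complex.exp (-s * ℓ i) :=
  Summable.of_norm (by simpa only [norm_mul, norm_cexp_neg_mul] using hw)

lemma tsum_conj_mul_cexp (w : ι → ℂ) (ℓ : ι → ℝ) (s : ℂ) :
    ∑' i, conj (w i) * Complex.exp (-s * ℓ i)
      = conj (∑' i, w i * Complex.exp (-conj s * ℓ i)) := by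
  rw [Complex.conj_tsum]
  refine tsum_congr fun i => ?_
  simp only [map_mul, ← Complex.exp_conj, map_neg, Complex.conj_conj, Complex.conj_ofReal]

variable [Countable ι]

lemma integrableOn_ofReal_summatory_mul_cexp (hℓ : ∀ i, 0 ≤ ℓ i) {s : ℂ} (hs : 0 < s.re)
    (hsum : Summable fun i => ‖w i‖ * Real.exp (-s.re * ℓ i)) :
    IntegrableOn (fun u => ((summatory w ℓ u : ℝ) : ℂ) * Complex.exp (-s * u)) (Ioi 0) := by
  simp_rw [← summatory_ofReal hs.le hsum]
  exact integrableOn_summatory_mul_cexp hℓ hs (by simpa only [Complex.norm_real] using hsum)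

lemma integral_ofReal_summatory_mul_cexp (hℓ : ∀ i, 0 ≤ ℓ i) {s : ℂ} (hs : 0 < s.re)
    (hsum : Summable fun i => ‖w i‖ * Real.exp (-s.re * ℓ i)) :
    ∫ u in Ioi (0 : ℝ), ((summatory w ℓ u : ℝ) : ℂ) * Complex.exp (-s * u)
      = (∑' i, (w i : ℂ) * Complex.exp (-s * ℓ i)) / s := by
  simp_rw [← summatory_ofReal hs.le hsum]
  exact integral_summatory_mul_cexp hℓ hs (by simpa only [Complex.norm_real] using hsum)

theorem tendsto_summatory_mul_exp_neg (hw : ∀ i, 0 ≤ w i) (hℓ : ∀ i, 0 ≤ ℓ i)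
    (hsum : ∀ σ : ℝ, 1 < σ → Summable fun i => w i * Real.exp (-σ * ℓ i)) (hc : 0 < c)
    (hR : ContinuousOn R {s | 1 ≤ s.re})
    (heq : ∀ s : ℂ, 1 < s.re → ∑' i, (w i : ℂ) * Complex.exp (-s * ℓ i) = c / (s - 1) + R s) :
    Tendsto (fun u => summatory w ℓ u * Real.exp (-u)) atTop (𝓝 c) := by
  have hnorm (σ : ℝ) (hσ : 1 < σ) : Summable fun i => ‖w i‖ * Real.exp (-σ * ℓ i) := by
    simpa only [Real.norm_of_nonneg (hw _)] using hsum σ hσ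
  have hint {s : ℂ} (hs : 1 < s.re) :=
    integrableOn_ofReal_summatory_mul_cexp hℓ (one_pos.trans hs) (hnorm s.re hs)
  suffices h : Tendsto (fun u => summatory w ℓ u * Real.exp (-u) / c) atTop (𝓝 1) by
    simpa only [div_mul_cancel₀ _ hc.ne', one_mul] using h.mul_const c
  refine wiener_ikehara (h := fun z => (R (1 + z) / c - 1) / (1 + z)) (fun u v huv => ?_)
    (fun u => ?_) (fun ε hε => ?_) ?_ fun z hz => ?_
  · simp only [div_mul_eq_mul_div, mul_assoc, ← Real.exp_add, neg_add_cancel, Real.exp_zero,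
      mul_one]
    exact div_le_div_of_nonneg_right
      (monotone_summatory zero_le_two hw (hnorm 2 one_lt_two) huv) hc.le
  · exact div_nonneg (mul_nonneg (summatory_nonneg hw ℓ u) (Real.exp_pos _).le) hc.le
  · have hre : 1 < ((1 + ε : ℝ) : ℂ).re := by simpa using hε
    refine ((integrableOn_mul_exp_neg_of_cexp (hint hre)).div_const c).congr
      (Eventually.of_forall fun u => ?_)
    simp only [div_mul_eq_mul_div, mul_assoc, ← Real.exp_add]
    ring_nf
  · have hmaps : MapsTo (fun z : ℂ => 1 + z) {z | 0 ≤ z.re} {s | 1 ≤ s.re} := fun z hz => by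
      simpa using hz
    exact ((((hR.comp (by fun_prop) hmaps).div_const _).sub continuousOn_const).div
      (by fun_prop) fun z hz => ne_zero_of_re_pos (one_pos.trans_le (hmaps hz)))
  · have hz1 : 1 < (1 + z).re := by simpa using hz
    have hz0 := ne_zero_of_re_pos hz
    have hz10 := ne_zero_of_re_pos (one_pos.trans hz1)
    have hc0 : (c : ℂ) ≠ 0 := Complex.ofReal_ne_zero.2 hc.ne'
    rw [laplace_normalised_sub_one hz (hint hz1),
      integral_ofReal_summatory_mul_cexp hℓ (one_pos.trans hz1) (hnorm _ hz1), heq _ hz1,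
      add_sub_cancel_left]
    field_simp
    ring

lemma tendsto_summatory_mul_exp_neg_zero_of_real {v : ι → ℝ} {R₁ : ℂ → ℂ}
    (hwv : ∀ i, |w i| ≤ v i) (hℓ : ∀ i, 0 ≤ ℓ i)
    (hsum : ∀ σ : ℝ, 1 < σ → Summable fun i => v i * Real.exp (-σ * ℓ i)) (hc : 0 < c)
    (hR : ContinuousOn R {s | 1 ≤ s.re})
    (heq : ∀ s : ℂ, 1 < s.re → ∑' i, (v i : ℂ) * Complex.exp (-s * ℓ i) = c / (s - 1) + R s)
    (hR₁ : ContinuousOn R₁ {s | 1 ≤ s.re})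
    (heq₁ : ∀ s : ℂ, 1 < s.re → ∑' i, (w i : ℂ) * Complex.exp (-s * ℓ i) = R₁ s) :
    Tendsto (fun u => summatory w ℓ u * Real.exp (-u)) atTop (𝓝 0) := by
  have hv (i : ι) : 0 ≤ v i := (abs_nonneg _).trans (hwv i)
  have hsumv (σ : ℝ) (hσ : 1 < σ) : Summable fun i => ‖v i‖ * Real.exp (-σ * ℓ i) := by
    simpa only [Real.norm_of_nonneg (hv _)] using hsum σ hσ
  have hsumw (σ : ℝ) (hσ : 1 < σ) : Summable fun i => ‖w i‖ * Real.exp (-σ * ℓ i) :=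
    (hsum σ hσ).of_nonneg_of_le (fun i => by positivity)
      fun i => mul_le_mul_of_nonneg_right (hwv i) (Real.exp_pos _).le
  have hvw : Tendsto (fun u => summatory (fun i => v i + w i) ℓ u * Real.exp (-u)) atTop (𝓝 c) := by
    refine tendsto_summatory_mul_exp_neg (fun i => by linarith [neg_le_of_abs_le (hwv i)]) hℓ
      (fun σ hσ => ?_) hc (hR.add hR₁) fun s hs => ?_
    · simpa only [add_mul] using (hsum σ hσ).add (Summable.of_norm (by simpa using hsumw σ hσ))
    · simp only [Complex.ofReal_add, add_mul]
      rw [Summable.tsum_add (summable_mul_cexp (by simpa using hsumv s.re hs))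
        (summable_mul_cexp (by simpa using hsumw s.re hs)), heq s hs, heq₁ s hs,
        add_assoc, Pi.add_apply]
  have hsub := hvw.sub (tendsto_summatory_mul_exp_neg hv hℓ hsum hc hR heq)
  rw [sub_self] at hsub
  refine hsub.congr fun u => ?_
  rw [summatory_add zero_le_two (hsumv 2 one_lt_two) (hsumw 2 one_lt_two)]
  ring

lemma tendsto_summatory_re_mul_exp_neg_zero {v : ι → ℝ} {w : ι → ℂ} {R₁ : ℂ → ℂ}
    (hwv : ∀ i, ‖w i‖ ≤ v i) (hℓ : ∀ i, 0 ≤ ℓ i)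
    (hsum : ∀ σ : ℝ, 1 < σ → Summable fun i => v i * Real.exp (-σ * ℓ i)) (hc : 0 < c)
    (hR : ContinuousOn R {s | 1 ≤ s.re})
    (heq : ∀ s : ℂ, 1 < s.re → ∑' i, (v i : ℂ) * Complex.exp (-s * ℓ i) = c / (s - 1) + R s)
    (hR₁ : ContinuousOn R₁ {s | 1 ≤ s.re})
    (heq₁ : ∀ s : ℂ, 1 < s.re → ∑' i, w i * Complex.exp (-s * ℓ i) = R₁ s) :
    Tendsto (fun u => summatory (fun i => (w i).re) ℓ u * Real.exp (-u)) atTop (𝓝 0) := by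
  have hconj : ContinuousOn (fun s => conj (R₁ (conj s))) {s | 1 ≤ s.re} :=
    Complex.continuous_conj.comp_continuousOn
      (hR₁.comp Complex.continuous_conj.continuousOn fun s hs => by simpa using hs)
  refine tendsto_summatory_mul_exp_neg_zero_of_real (R₁ := fun s => (R₁ s + conj (R₁ (conj s))) / 2)
    (fun i => (Complex.abs_re_le_norm _).trans (hwv i)) hℓ hsum hc hR heq
    ((hR₁.add hconj).div_const 2) fun s hs => ?_
  have hsumw : Summable fun i => ‖w i‖ * Real.exp (-s.re * ℓ i) :=
    (hsum s.re hs).of_nonneg_of_le (fun i => by positivity)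
      fun i => mul_le_mul_of_nonneg_right (hwv i) (Real.exp_pos _).le
  rw [← heq₁ s hs, ← heq₁ (conj s) (by simpa using hs), ← tsum_conj_mul_cexp,
    ← (summable_mul_cexp hsumw).tsum_add (summable_mul_cexp (by simpa using hsumw)),
    ← tsum_div_const]
  exact tsum_congr fun i => by rw [Complex.re_eq_add_conj]; ring

theorem tendsto_summatory_mul_exp_neg_zero {v : ι → ℝ} {w : ι → ℂ} {R₁ : ℂ → ℂ}
    (hwv : ∀ i, ‖w i‖ ≤ v i) (hℓ : ∀ i, 0 ≤ ℓ i)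
    (hsum : ∀ σ : ℝ, 1 < σ → Summable fun i => v i * Real.exp (-σ * ℓ i)) (hc : 0 < c)
    (hR : ContinuousOn R {s | 1 ≤ s.re})
    (heq : ∀ s : ℂ, 1 < s.re → ∑' i, (v i : ℂ) * Complex.exp (-s * ℓ i) = c / (s - 1) + R s)
    (hR₁ : ContinuousOn R₁ {s | 1 ≤ s.re})
    (heq₁ : ∀ s : ℂ, 1 < s.re → ∑' i, w i * Complex.exp (-s * ℓ i) = R₁ s) :
    Tendsto (fun u => summatory w ℓ u * Complex.exp (-u)) atTop (𝓝 0) := by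
  have hre := tendsto_summatory_re_mul_exp_neg_zero hwv hℓ hsum hc hR heq hR₁ heq₁
  have him := tendsto_summatory_re_mul_exp_neg_zero (w := fun i => -Complex.I * w i)
    (R₁ := fun s => -Complex.I * R₁ s) (by simpa using hwv) hℓ hsum hc hR heq
    (continuousOn_const.mul hR₁) fun s hs => by simp_rw [mul_assoc, tsum_mul_left, heq₁ s hs]
  have hsumw : Summable fun i => ‖w i‖ * Real.exp (-2 * ℓ i) :=
    (hsum 2 one_lt_two).of_nonneg_of_le (fun i => by positivity)
      fun i => mul_le_mul_of_nonneg_right (hwv i) (Real.exp_pos _).le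
  have h := (Complex.continuous_ofReal.tendsto' 0 0 Complex.ofReal_zero |>.comp hre).add
    ((Complex.continuous_ofReal.tendsto' 0 0 Complex.ofReal_zero |>.comp him).mul_const Complex.I)
  rw [zero_mul, add_zero] at h
  refine h.congr fun u => ?_
  have hre' : summatory (fun i => (w i).re) ℓ u = (summatory w ℓ u).re :=
    summatory_map Complex.reCLM zero_le_two hsumw u
  have him' : summatory (fun i => (w i).im) ℓ u = (summatory w ℓ u).im :=
    summatory_map Complex.imCLM zero_le_two hsumw u
  simp only [Function.comp_apply, neg_mul, Complex.neg_re, Complex.I_mul_re, neg_neg, hre', him']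
  conv_rhs => rw [← Complex.re_add_im (summatory w ℓ u)]
  push_cast
  ring

end WienerIkehara

open GaussianPNT

/-! ### Angular characters -/

/-- The angular character `z ↦ (z / |z|) ^ n`, extended by zero. -/
def angChar (n : ℤ) (z : ℂ) : ℂ := if z = 0 then 0 else (z / ‖z‖) ^ n

@[simp] lemma angChar_apply_zero (n : ℤ) : angChar n 0 = 0 := if_pos rfl

lemma angChar_of_ne_zero {z : ℂ} (hz : z ≠ 0) (n : ℤ) : angChar n z = (z / ‖z‖) ^ n := if_neg hz

lemma norm_div_norm {z : ℂ} (hz : z ≠ 0) : ‖z / ‖z‖‖ = 1 := by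
  rw [norm_div, Complex.norm_real, norm_norm, div_self (norm_ne_zero_iff.2 hz)]

lemma norm_angChar {z : ℂ} (hz : z ≠ 0) (n : ℤ) : ‖angChar n z‖ = 1 := by
  rw [angChar_of_ne_zero hz, norm_zpow, norm_div_norm hz, one_zpow]

lemma norm_angChar_le (n : ℤ) (z : ℂ) : ‖angChar n z‖ ≤ 1 := by
  rcases eq_or_ne z 0 with rfl | hz
  · simp
  · exact (norm_angChar hz n).le

lemma angChar_mul (n : ℤ) (z w : ℂ) : angChar n (z * w) = angChar n z * angChar n w := by
  rcases eq_or_ne z 0 with rfl | hz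
  · simp
  rcases eq_or_ne w 0 with rfl | hw
  · simp
  rw [angChar_of_ne_zero hz, angChar_of_ne_zero hw, angChar_of_ne_zero (mul_ne_zero hz hw),
    ← mul_zpow, norm_mul, Complex.ofReal_mul, mul_div_mul_comm]

lemma angChar_zero {z : ℂ} (hz : z ≠ 0) : angChar 0 z = 1 := by
  rw [angChar_of_ne_zero hz, zpow_zero]

lemma measurable_angChar (n : ℤ) : Measurable (angChar n) := by
  refine Measurable.ite (measurableSet_singleton 0) measurable_const ?_
  cases n with
  | ofNat m => simp only [Int.ofNat_eq_natCast, zpow_natCast]; fun_prop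
  | negSucc m => simp only [zpow_negSucc]; fun_prop

lemma norm_pow_sub_pow_le_of_norm_eq_one {a b : ℂ} (ha : ‖a‖ = 1) (hb : ‖b‖ = 1) (m : ℕ) :
    ‖a ^ m - b ^ m‖ ≤ m * ‖a - b‖ := by
  induction m with
  | zero => simp
  | succ m ih =>
    calc ‖a ^ (m + 1) - b ^ (m + 1)‖
        = ‖(a ^ m - b ^ m) * a + b ^ m * (a - b)‖ := by ring_nf
      _ ≤ ‖a ^ m - b ^ m‖ + ‖a - b‖ := by
        simpa [ha, hb] using norm_add_le ((a ^ m - b ^ m) * a) (b ^ m * (a - b))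
      _ ≤ (m + 1 : ℕ) * ‖a - b‖ := by push_cast; linarith

lemma norm_zpow_sub_zpow_le_of_norm_eq_one {a b : ℂ} (ha : ‖a‖ = 1) (hb : ‖b‖ = 1) (n : ℤ) :
    ‖a ^ n - b ^ n‖ ≤ |(n : ℝ)| * ‖a - b‖ := by
  obtain ⟨m, rfl | rfl⟩ := n.eq_nat_or_neg
  · simpa using norm_pow_sub_pow_le_of_norm_eq_one ha hb m
  · have ha0 : a ≠ 0 := norm_ne_zero_iff.1 (ha.trans_ne one_ne_zero)
    have hb0 : b ≠ 0 := norm_ne_zero_iff.1 (hb.trans_ne one_ne_zero)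
    have hsub : a ^ (-(m : ℤ)) - b ^ (-(m : ℤ)) = -(a ^ m - b ^ m) * (a ^ m)⁻¹ * (b ^ m)⁻¹ := by
      rw [zpow_neg, zpow_neg, zpow_natCast, zpow_natCast]
      field_simp
      ring
    rw [hsub]
    simpa [ha, hb, norm_sub_rev] using norm_pow_sub_pow_le_of_norm_eq_one ha hb m

lemma norm_div_norm_sub_le {z w : ℂ} (hz : z ≠ 0) (hw : w ≠ 0) :
    ‖w / ‖w‖ - z / ‖z‖‖ ≤ 2 * ‖w - z‖ / ‖z‖ := by
  have hz0 : (‖z‖ : ℂ) ≠ 0 := Complex.ofReal_ne_zero.2 (norm_ne_zero_iff.2 hz)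
  have hw0 : (‖w‖ : ℂ) ≠ 0 := Complex.ofReal_ne_zero.2 (norm_ne_zero_iff.2 hw)
  have hsub : w / ‖w‖ - z / ‖z‖ = ((w / ‖w‖) * ((‖z‖ - ‖w‖ : ℝ) : ℂ) + (w - z)) / ‖z‖ := by
    push_cast
    field_simp
    ring
  rw [hsub, norm_div, Complex.norm_real, norm_norm]
  gcongr
  refine (norm_add_le _ _).trans ?_
  rw [norm_mul, norm_div_norm hw, one_mul, Complex.norm_real, Real.norm_eq_abs, two_mul,
    norm_sub_rev w z]
  gcongr
  exact abs_norm_sub_norm_le z w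

lemma norm_angChar_sub_le {z w : ℂ} (hz : z ≠ 0) (hw : w ≠ 0) (n : ℤ) :
    ‖angChar n w - angChar n z‖ ≤ |(n : ℝ)| * (2 * ‖w - z‖ / ‖z‖) := by
  rw [angChar_of_ne_zero hz, angChar_of_ne_zero hw]
  exact (norm_zpow_sub_zpow_le_of_norm_eq_one (norm_div_norm hw) (norm_div_norm hz) n).trans
    (mul_le_mul_of_nonneg_left (norm_div_norm_sub_le hz hw) (abs_nonneg _))

/-! ### Lattice points in discs, weighted by an angular character -/

section FloorGauss

/-- The Gaussian integer at the lower left corner of the unit square containing `z`. -/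
def floorGauss (z : ℂ) : GaussianInt := ⟨⌊z.re⌋, ⌊z.im⌋⟩

lemma norm_floorGauss_sub_le (z : ℂ) : ‖GaussianInt.toComplex (floorGauss z) - z‖ ≤ 2 := by
  have hfloor (x : ℝ) : |(⌊x⌋ : ℝ) - x| ≤ 1 := by
    rw [abs_sub_comm, Int.self_sub_floor, Int.abs_fract]
    exact (Int.fract_lt_one x).le
  refine (Complex.norm_le_abs_re_add_abs_im _).trans ?_
  rw [GaussianInt.toComplex_def₂]
  exact (add_le_add (hfloor z.re) (hfloor z.im)).trans_eq one_add_one_eq_two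

lemma floorGauss_preimage (ω : GaussianInt) : floorGauss ⁻¹' {ω}
    = Complex.measurableEquivRealProd ⁻¹'
      (Ico (ω.re : ℝ) (ω.re + 1) ×ˢ Ico (ω.im : ℝ) (ω.im + 1)) := by
  ext z
  simp [floorGauss, Zsqrtd.ext_iff, Complex.measurableEquivRealProd_apply, Int.floor_eq_iff]

lemma measurableSet_floorGauss_preimage (ω : GaussianInt) :
    MeasurableSet (floorGauss ⁻¹' {ω}) := by
  rw [floorGauss_preimage]
  exact Complex.measurableEquivRealProd.measurable (measurableSet_Ico.prod measurableSet_Ico)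

lemma volume_floorGauss_preimage (ω : GaussianInt) : volume (floorGauss ⁻¹' {ω}) = 1 := by
  rw [floorGauss_preimage, Complex.volume_preserving_equiv_real_prod.measure_preimage
    (measurableSet_Ico.prod measurableSet_Ico).nullMeasurableSet, Measure.volume_eq_prod,
    Measure.prod_prod]
  simp

variable {E : Type*} [NormedAddCommGroup E] {c : GaussianInt → E} {s : Finset GaussianInt}

lemma comp_floorGauss_eq_sum (hc : ∀ ω ∉ s, c ω = 0) :
    (fun z => c (floorGauss z))
      = fun z => ∑ ω ∈ s, (floorGauss ⁻¹' {ω}).indicator (fun _ => c ω) z := by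
  classical
  ext z
  simp only [indicator, mem_preimage, mem_singleton_iff, Finset.sum_ite_eq]
  split_ifs with h
  exacts [rfl, hc _ h]

lemma integrable_indicator_floorGauss_preimage (ω : GaussianInt) (x : E) :
    Integrable ((floorGauss ⁻¹' {ω}).indicator fun _ => x) :=
  (integrable_indicator_iff (measurableSet_floorGauss_preimage ω)).2
    (integrableOn_const (by rw [volume_floorGauss_preimage]; exact ENNReal.one_ne_top))

lemma integrable_comp_floorGauss (hc : ∀ ω ∉ s, c ω = 0) :
    Integrable fun z => c (floorGauss z) := by
  rw [comp_floorGauss_eq_sum hc]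
  exact integrable_finsetSum _ fun ω _ => integrable_indicator_floorGauss_preimage ω (c ω)

lemma integral_comp_floorGauss [NormedSpace ℝ E] [CompleteSpace E] (hc : ∀ ω ∉ s, c ω = 0) :
    ∫ z, c (floorGauss z) = ∑ ω ∈ s, c ω := by
  rw [comp_floorGauss_eq_sum hc,
    integral_finsetSum _ fun ω _ => integrable_indicator_floorGauss_preimage ω (c ω)]
  refine Finset.sum_congr rfl fun ω _ => ?_
  rw [integral_indicator_const _ (measurableSet_floorGauss_preimage ω), Measure.real,
    volume_floorGauss_preimage, ENNReal.toReal_one, one_smul]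

end FloorGauss

section DiscChar

/-- The angular character cut off outside the disc of radius `R`. -/
def discChar (n : ℤ) (R : ℝ) : ℂ → ℂ := (Metric.closedBall 0 R).indicator (angChar n)

variable {n : ℤ} {R : ℝ} {z w : ℂ}

lemma discChar_of_le (hz : ‖z‖ ≤ R) : discChar n R z = angChar n z :=
  indicator_of_mem (mem_closedBall_zero_iff.2 hz) _

lemma discChar_of_lt (hz : R < ‖z‖) : discChar n R z = 0 :=
  indicator_of_notMem (fun h => hz.not_ge (mem_closedBall_zero_iff.1 h)) _

lemma norm_discChar_le (n : ℤ) (R : ℝ) (z : ℂ) : ‖discChar n R z‖ ≤ 1 :=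
  (norm_indicator_le_norm_self _ _).trans (norm_angChar_le n z)

lemma volume_closedBall_ne_top (R : ℝ) : volume (Metric.closedBall (0 : ℂ) R) ≠ ⊤ :=
  (isCompact_closedBall _ _).measure_ne_top

lemma volumeReal_closedBall (hR : 0 ≤ R) :
    volume.real (Metric.closedBall (0 : ℂ) R) = Real.pi * R ^ 2 := by
  rw [Measure.real, Complex.volume_closedBall, ENNReal.toReal_mul, ENNReal.toReal_pow,
    ENNReal.toReal_ofReal hR]
  simp [mul_comm]

lemma integrable_discChar (n : ℤ) (R : ℝ) : Integrable (discChar n R) := by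
  refine (integrable_indicator_iff measurableSet_closedBall).2 ?_
  exact Integrable.mono' (integrableOn_const (volume_closedBall_ne_top R))
    (measurable_angChar n).aestronglyMeasurable (Eventually.of_forall fun z => norm_angChar_le n z)

lemma integral_discChar_zero (hR : 0 ≤ R) :
    ∫ z, discChar 0 R z = ((Real.pi * R ^ 2 : ℝ) : ℂ) := by
  have hae : discChar 0 R =ᵐ[volume] (Metric.closedBall (0 : ℂ) R).indicator fun _ => (1 : ℂ) := by
    filter_upwards [Measure.ae_ne volume (0 : ℂ)] with z hz
    simp [discChar, indicator, angChar_zero hz]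
  rw [integral_congr_ae hae, integral_indicator_const _ measurableSet_closedBall,
    volumeReal_closedBall hR]
  simp

lemma discChar_rotation (a : Circle) (n : ℤ) (R : ℝ) (z : ℂ) :
    discChar n R (rotation a z) = angChar n a * discChar n R z := by
  simp only [discChar, rotation_apply, indicator, Metric.mem_closedBall, dist_zero_right, norm_mul,
    Circle.norm_coe, one_mul, angChar_mul, mul_ite, mul_zero]

lemma angChar_exp_pi_div (hn : n ≠ 0) : angChar n (Circle.exp (Real.pi / n)) = -1 := by
  have hn0 : (n : ℂ) ≠ 0 := Int.cast_ne_zero.2 hn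
  rw [angChar_of_ne_zero (Circle.coe_ne_zero _), Circle.norm_coe, Complex.ofReal_one, div_one,
    Circle.coe_exp, ← Complex.exp_int_mul, ← Complex.exp_pi_mul_I]
  push_cast
  field_simp

/-- Rotation by `π / n` preserves the disc and changes the sign of the integrand. -/
lemma integral_discChar_of_ne_zero (hn : n ≠ 0) (R : ℝ) : ∫ z, discChar n R z = 0 := by
  set a := Circle.exp (Real.pi / n)
  have hrot := (rotation a).measurePreserving.integral_comp
    (rotation a).toHomeomorph.measurableEmbedding (discChar n R)
  simp_rw [discChar_rotation, a, angChar_exp_pi_div hn, neg_one_mul, integral_neg] at hrot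
  exact self_eq_neg.1 hrot.symm

lemma norm_discChar_sub_le_two (n : ℤ) (R : ℝ) (z w : ℂ) :
    ‖discChar n R w - discChar n R z‖ ≤ 2 := by
  linarith [norm_sub_le (discChar n R w) (discChar n R z), norm_discChar_le n R w,
    norm_discChar_le n R z]

lemma norm_discChar_sub_eq_zero (hwz : ‖w - z‖ ≤ 2) (hz : R + 2 < ‖z‖) :
    ‖discChar n R w - discChar n R z‖ = 0 := by
  have hdist := abs_le.1 ((abs_norm_sub_norm_le w z).trans hwz)
  rw [discChar_of_lt (by linarith [hdist.1]), discChar_of_lt (by linarith), sub_zero, norm_zero]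

lemma norm_discChar_sub_le_of_lt (hR : 1 ≤ R) (hwz : ‖w - z‖ ≤ 2) (hz : 2 * √R < ‖z‖)
    (hzR : ‖z‖ < R - 2) : ‖discChar n R w - discChar n R z‖ ≤ 2 * |(n : ℝ)| / √R := by
  have hdist := abs_le.1 ((abs_norm_sub_norm_le w z).trans hwz)
  have hsqrt : 1 ≤ √R := Real.one_le_sqrt.2 hR
  have hz0 : 0 < ‖z‖ := by linarith
  have hw0 : 0 < ‖w‖ := by linarith [hdist.1]
  rw [discChar_of_le (by linarith [hdist.2]), discChar_of_le (by linarith)]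
  calc ‖angChar n w - angChar n z‖
      ≤ |(n : ℝ)| * (2 * ‖w - z‖ / ‖z‖) :=
        norm_angChar_sub_le (norm_pos_iff.1 hz0) (norm_pos_iff.1 hw0) n
    _ ≤ |(n : ℝ)| * (2 * 2 / (2 * √R)) := by gcongr
    _ = 2 * |(n : ℝ)| / √R := by field_simp

/-- The closed annulus of width `4` around the circle of radius `R`. -/
def annulus (R : ℝ) : Set ℂ := Metric.closedBall 0 (R + 2) \ Metric.ball 0 (R - 2)

lemma measurableSet_annulus (R : ℝ) : MeasurableSet (annulus R) :=
  measurableSet_closedBall.diff measurableSet_ball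

lemma volume_annulus_ne_top (R : ℝ) : volume (annulus R) ≠ ⊤ :=
  measure_ne_top_of_subset sdiff_subset (volume_closedBall_ne_top _)

lemma volumeReal_annulus_le (hR : 1 ≤ R) : volume.real (annulus R) ≤ Real.pi * (16 * R) := by
  rcases le_total R 2 with h | h
  · refine (measureReal_mono sdiff_subset (volume_closedBall_ne_top _)).trans ?_
    rw [volumeReal_closedBall (by linarith)]
    exact mul_le_mul_of_nonneg_left (by nlinarith) Real.pi_pos.le
  · have hball : volume.real (Metric.ball (0 : ℂ) (R - 2)) = Real.pi * (R - 2) ^ 2 := by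
      rw [← volumeReal_closedBall (by linarith), Measure.real, Measure.real,
        Complex.volume_closedBall, Complex.volume_ball]
    rw [annulus, measureReal_sdiff (Metric.ball_subset_closedBall.trans
        (Metric.closedBall_subset_closedBall (by linarith))) measurableSet_ball
        (volume_closedBall_ne_top _), volumeReal_closedBall (by linarith), hball]
    nlinarith [Real.pi_pos]

/-- Near the origin `angChar n` oscillates and near the boundary the cut-off jumps; elsewhere the
Lipschitz bound applies. -/
lemma norm_discChar_sub_le (n : ℤ) (hR : 1 ≤ R) (hwz : ‖w - z‖ ≤ 2) :
    ‖discChar n R w - discChar n R z‖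
      ≤ (Metric.closedBall (0 : ℂ) (2 * √R)).indicator (fun _ => (2 : ℝ)) z
        + (annulus R).indicator (fun _ => (2 : ℝ)) z
        + (Metric.closedBall (0 : ℂ) R).indicator (fun _ => 2 * |(n : ℝ)| / √R) z := by
  have hcore : 0 ≤ (Metric.closedBall (0 : ℂ) (2 * √R)).indicator (fun _ => (2 : ℝ)) z :=
    indicator_nonneg (fun _ _ => zero_le_two) z
  have hann : 0 ≤ (annulus R).indicator (fun _ => (2 : ℝ)) z :=
    indicator_nonneg (fun _ _ => zero_le_two) z
  have hdisc : 0 ≤ (Metric.closedBall (0 : ℂ) R).indicator (fun _ => 2 * |(n : ℝ)| / √R) z :=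
    indicator_nonneg (fun _ _ => by positivity) z
  have htwo := norm_discChar_sub_le_two n R z w
  by_cases hz_core : z ∈ Metric.closedBall (0 : ℂ) (2 * √R)
  · rw [indicator_of_mem hz_core]
    linarith
  by_cases hz_ann : z ∈ annulus R
  · rw [indicator_of_mem hz_ann]
    linarith
  rw [mem_closedBall_zero_iff, not_le] at hz_core
  rw [annulus, Set.mem_sdiff, mem_closedBall_zero_iff, mem_ball_zero_iff, not_and, not_not]
    at hz_ann
  rcases le_or_gt ‖z‖ (R + 2) with hzR | hzR
  · have hzR' := hz_ann hzR
    have hle := norm_discChar_sub_le_of_lt (n := n) hR hwz hz_core hzR'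
    rw [indicator_of_mem (mem_closedBall_zero_iff.2 (by linarith)) fun _ => 2 * |(n : ℝ)| / √R]
    linarith
  · linarith [norm_discChar_sub_eq_zero (n := n) hwz hzR]

lemma integrable_indicator_const {s : Set ℂ} (hs : MeasurableSet s) (hfin : volume s ≠ ⊤) (c : ℝ) :
    Integrable (s.indicator fun _ => c) :=
  (integrable_indicator_iff hs).2 (integrableOn_const hfin)

lemma norm_integral_discChar_floorGauss_sub_le (n : ℤ) (hR : 1 ≤ R) :
    ‖∫ z, (discChar n R (GaussianInt.toComplex (floorGauss z)) - discChar n R z)‖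
      ≤ Real.pi * (40 + 2 * |(n : ℝ)|) * (R * √R) := by
  have hR0 : 0 ≤ R := by linarith
  have hcore := integrable_indicator_const measurableSet_closedBall
    (volume_closedBall_ne_top (2 * √R)) 2
  have hann := integrable_indicator_const (measurableSet_annulus R) (volume_annulus_ne_top R) 2
  have hdisc := integrable_indicator_const measurableSet_closedBall (volume_closedBall_ne_top R)
    (2 * |(n : ℝ)| / √R)
  refine (norm_integral_le_of_norm_le ((hcore.add hann).add hdisc) (Eventually.of_forall fun z =>
    norm_discChar_sub_le n hR (norm_floorGauss_sub_le z))).trans ?_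
  rw [integral_add' (hcore.add hann) hdisc, integral_add' hcore hann,
    integral_indicator_const _ measurableSet_closedBall,
    integral_indicator_const _ measurableSet_closedBall,
    integral_indicator_const _ (measurableSet_annulus R),
    volumeReal_closedBall (by positivity), volumeReal_closedBall hR0]
  simp only [smul_eq_mul]
  have hR_le : R ≤ R * √R := le_mul_of_one_le_right hR0 (Real.one_le_sqrt.2 hR)
  have hsq : R ^ 2 / √R = R * √R := by rw [pow_two, mul_div_assoc, Real.div_sqrt]
  calc Real.pi * (2 * √R) ^ 2 * 2 + volume.real (annulus R) * 2
        + Real.pi * R ^ 2 * (2 * |(n : ℝ)| / √R)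
      = Real.pi * (8 * R) + volume.real (annulus R) * 2
        + Real.pi * (2 * |(n : ℝ)|) * (R ^ 2 / √R) := by
        rw [mul_pow, Real.sq_sqrt hR0]
        ring
    _ ≤ Real.pi * (8 * (R * √R)) + Real.pi * (16 * (R * √R)) * 2
        + Real.pi * (2 * |(n : ℝ)|) * (R * √R) := by
        rw [hsq]
        gcongr
        exact (volumeReal_annulus_le hR).trans (by gcongr)
    _ = Real.pi * (40 + 2 * |(n : ℝ)|) * (R * √R) := by ring

end DiscChar

lemma norm_toComplex_sq (ω : GaussianInt) :
    ‖GaussianInt.toComplex ω‖ ^ 2 = ((Zsqrtd.norm ω : ℤ) : ℝ) := by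
  rw [GaussianInt.intCast_real_norm, Complex.normSq_eq_norm_sq]

lemma mem_ball_sq_iff {ω : GaussianInt} {R : ℝ} (hR : 0 ≤ R) :
    ω ∈ ball (R ^ 2) ↔ ‖GaussianInt.toComplex ω‖ ≤ R := by
  rw [← pow_le_pow_iff_left₀ (norm_nonneg _) hR two_ne_zero, norm_toComplex_sq]
  rfl

theorem norm_sum_angChar_sub_le (n : ℤ) : ∃ C : ℝ, ∀ R : ℝ, 1 ≤ R →
    ‖∑ ω ∈ (ball_finite (R ^ 2)).toFinset, angChar n (GaussianInt.toComplex ω)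
      - (if n = 0 then ((Real.pi * R ^ 2 : ℝ) : ℂ) else 0)‖ ≤ C * (R * √R) := by
  refine ⟨Real.pi * (40 + 2 * |(n : ℝ)|), fun R hR => ?_⟩
  have hR0 : 0 ≤ R := by linarith
  have hmem (ω : GaussianInt) :
      ω ∈ (ball_finite (R ^ 2)).toFinset ↔ ‖GaussianInt.toComplex ω‖ ≤ R := by
    rw [Set.Finite.mem_toFinset, mem_ball_sq_iff hR0]
  have hzero : ∀ ω ∉ (ball_finite (R ^ 2)).toFinset, discChar n R (GaussianInt.toComplex ω) = 0 :=
    fun ω hω => discChar_of_lt (not_le.1 ((hmem ω).not.1 hω))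
  have hsum : ∫ z, discChar n R (GaussianInt.toComplex (floorGauss z))
      = ∑ ω ∈ (ball_finite (R ^ 2)).toFinset, angChar n (GaussianInt.toComplex ω) :=
    (integral_comp_floorGauss hzero).trans
      (Finset.sum_congr rfl fun ω hω => discChar_of_le ((hmem ω).1 hω))
  have hintegral : ∫ z, discChar n R z = if n = 0 then ((Real.pi * R ^ 2 : ℝ) : ℂ) else 0 := by
    split_ifs with hn
    exacts [hn ▸ integral_discChar_zero hR0, integral_discChar_of_ne_zero hn R]
  rw [← hsum, ← hintegral,
    ← integral_sub (integrable_comp_floorGauss hzero) (integrable_discChar n R)]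
  exact norm_integral_discChar_floorGauss_sub_le n hR

/-! ### The arithmetic of `ℤ[i]` and its Hecke L-series -/

instance instCountableGaussianInt : Countable GaussianInt :=
  Function.Injective.countable (f := fun ω : GaussianInt => (ω.re, ω.im)) fun a b h => by
    simp only [Prod.mk.injEq] at h
    exact Zsqrtd.ext h.1 h.2

/-- The logarithm `log N(ω)` of the norm; it has the junk value `0` at `ω = 0`. -/
def logNorm (ω : GaussianInt) : ℝ := Real.log ((Zsqrtd.norm ω : ℤ) : ℝ)

lemma one_le_norm {ω : GaussianInt} (hω : ω ≠ 0) : (1 : ℝ) ≤ ((Zsqrtd.norm ω : ℤ) : ℝ) := by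
  exact_mod_cast (GaussianInt.norm_pos.2 hω : 0 < Zsqrtd.norm ω)

lemma logNorm_nonneg (ω : GaussianInt) : 0 ≤ logNorm ω := by
  rcases eq_or_ne ω 0 with rfl | h
  · simp [logNorm]
  · exact Real.log_nonneg (one_le_norm h)

lemma logNorm_mul {a b : GaussianInt} (ha : a ≠ 0) (hb : b ≠ 0) :
    logNorm (a * b) = logNorm a + logNorm b := by
  rw [logNorm, Zsqrtd.norm_mul, Int.cast_mul,
    Real.log_mul (zero_lt_one.trans_le (one_le_norm ha)).ne'
      (zero_lt_one.trans_le (one_le_norm hb)).ne']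
  rfl

lemma norm_eq_one_iff_isUnit (ω : GaussianInt) : Zsqrtd.norm ω = 1 ↔ IsUnit ω :=
  Zsqrtd.norm_eq_one_iff' (by norm_num) ω

lemma logNorm_of_isUnit {ω : GaussianInt} (hω : IsUnit ω) : logNorm ω = 0 := by
  rw [logNorm, (norm_eq_one_iff_isUnit ω).2 hω, Int.cast_one, Real.log_one]

lemma logNorm_eq_of_associated {a b : GaussianInt} (h : Associated a b) :
    logNorm a = logNorm b := by
  obtain ⟨u, rfl⟩ := h
  rcases eq_or_ne a 0 with rfl | ha
  · rw [zero_mul]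
  · rw [logNorm_mul ha u.ne_zero, logNorm_of_isUnit u.isUnit, add_zero]

lemma two_le_norm_of_prime {p : GaussianInt} (hp : Prime p) :
    (2 : ℝ) ≤ ((Zsqrtd.norm p : ℤ) : ℝ) := by
  have hpos : 0 < Zsqrtd.norm p := GaussianInt.norm_pos.2 hp.ne_zero
  have hne : Zsqrtd.norm p ≠ 1 := fun h => hp.not_isUnit ((norm_eq_one_iff_isUnit p).1 h)
  exact_mod_cast (show 2 ≤ Zsqrtd.norm p by omega)

lemma log_two_le_logNorm {p : GaussianInt} (hp : Prime p) : Real.log 2 ≤ logNorm p :=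
  Real.log_le_log two_pos (two_le_norm_of_prime hp)

lemma logNorm_pos_of_prime {p : GaussianInt} (hp : Prime p) : 0 < logNorm p :=
  (Real.log_pos one_lt_two).trans_le (log_two_le_logNorm hp)

/-- The set of the four units `±1, ±i` of `ℤ[i]`. -/
def gaussUnits : Finset GaussianInt := {1, -1, ⟨0, 1⟩, ⟨0, -1⟩}

lemma card_gaussUnits : gaussUnits.card = 4 := by decide

lemma mem_gaussUnits_iff {u : GaussianInt} : u ∈ gaussUnits ↔ IsUnit u := by
  rw [← norm_eq_one_iff_isUnit]
  constructor
  · intro h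
    simp only [gaussUnits, Finset.mem_insert, Finset.mem_singleton] at h
    rcases h with rfl | rfl | rfl | rfl <;> decide
  · intro h
    obtain ⟨a, b⟩ := u
    have hab : a * a + b * b = 1 := by
      rw [← h, Zsqrtd.norm_def]
      ring
    obtain ⟨ha_lower, ha_upper⟩ : -1 ≤ a ∧ a ≤ 1 :=
      ⟨by nlinarith [mul_self_nonneg b], by nlinarith [mul_self_nonneg b]⟩
    obtain ⟨hb_lower, hb_upper⟩ : -1 ≤ b ∧ b ≤ 1 :=
      ⟨by nlinarith [mul_self_nonneg a], by nlinarith [mul_self_nonneg a]⟩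
    interval_cases a <;> interval_cases b <;> simp_all [gaussUnits, Zsqrtd.ext_iff]

lemma mem_image_gaussUnits_mul_iff {p q : GaussianInt} :
    q ∈ gaussUnits.image (· * p) ↔ Associated q p := by
  rw [Finset.mem_image]
  constructor
  · rintro ⟨u, hu, rfl⟩
    exact associated_unit_mul_left _ _ (mem_gaussUnits_iff.1 hu)
  · intro h
    obtain ⟨u, rfl⟩ := h.symm
    exact ⟨u, mem_gaussUnits_iff.2 u.isUnit, mul_comm _ _⟩

open Classical in
/-- The weight function equal to `log N(q)` at the primes `q` of `ℤ[i]` and to `0` elsewhere. -/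
def primeLog (q : GaussianInt) : ℝ := if Prime q then logNorm q else 0

lemma primeLog_of_prime {q : GaussianInt} (hq : Prime q) : primeLog q = logNorm q := if_pos hq

lemma primeLog_of_not_prime {q : GaussianInt} (hq : ¬ Prime q) : primeLog q = 0 := if_neg hq

lemma primeLog_nonneg (q : GaussianInt) : 0 ≤ primeLog q := by
  unfold primeLog
  split_ifs
  exacts [logNorm_nonneg q, le_rfl]

lemma primeLog_le (q : GaussianInt) : primeLog q ≤ logNorm q := by
  unfold primeLog
  split_ifs
  exacts [le_rfl, logNorm_nonneg q]

lemma norm_ofReal_primeLog (q : GaussianInt) : ‖(primeLog q : ℂ)‖ = primeLog q := by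
  rw [Complex.norm_real, Real.norm_of_nonneg (primeLog_nonneg q)]

lemma primeLog_eq_of_associated {p q : GaussianInt} (h : Associated p q) :
    primeLog p = primeLog q := by
  by_cases hp : Prime p
  · rw [primeLog_of_prime hp, primeLog_of_prime (h.prime hp), logNorm_eq_of_associated h]
  · rw [primeLog_of_not_prime hp, primeLog_of_not_prime fun hq => hp (h.symm.prime hq)]

open Classical in
lemma hasSum_primeLog_associated {p : GaussianInt} (hp : Prime p) :
    HasSum (fun q => primeLog q * (if Associated q p then 1 else 0)) (4 * logNorm p) := by
  set T : Finset GaussianInt := gaussUnits.image (· * p)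
  have hcard : T.card = 4 := by
    rw [Finset.card_image_of_injective _ (mul_left_injective₀ hp.ne_zero), card_gaussUnits]
  have hsum : ∑ q ∈ T, primeLog q * (if Associated q p then 1 else 0) = 4 * logNorm p := by
    rw [Finset.sum_congr rfl (g := fun _ => logNorm p), Finset.sum_const, hcard, nsmul_eq_mul,
      Nat.cast_ofNat]
    intro q hq
    have hqp := mem_image_gaussUnits_mul_iff.1 hq
    rw [if_pos hqp, mul_one, primeLog_eq_of_associated hqp, primeLog_of_prime hp]
  rw [← hsum]
  refine hasSum_sum_of_ne_finset_zero fun q hq => ?_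
  rw [if_neg fun h => hq (mem_image_gaussUnits_mul_iff.2 h), mul_zero]

open Classical in
lemma multiplicity_prime_eq_ite {p q : GaussianInt} (hp : Prime p) (hq : Prime q) :
    multiplicity q p = if Associated q p then 1 else 0 := by
  split_ifs with h
  · rw [multiplicity_eq_of_associated_left h.symm, multiplicity_self]
  · exact multiplicity_eq_zero.2 fun hd => h ((hq.dvd_prime_iff_associated hp).1 hd)

-- Every prime has four associates, whence the factor `4` in `∑_q v_q(ω) log N(q) = 4 log N(ω)`.
lemma hasSum_primeLog_mul_multiplicity {ω : GaussianInt} (hω : ω ≠ 0) :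
    HasSum (fun q => primeLog q * (multiplicity q ω : ℝ)) (4 * logNorm ω) := by
  classical
  induction ω using UniqueFactorizationMonoid.induction_on_prime with
  | h₁ => exact absurd rfl hω
  | h₂ x hx =>
    rw [logNorm_of_isUnit hx, mul_zero]
    refine hasSum_zero.congr_fun fun q => ?_
    by_cases hq : Prime q
    · rw [multiplicity_eq_zero.2 fun h => hq.not_isUnit (isUnit_of_dvd_unit h hx), Nat.cast_zero,
        mul_zero]
    · rw [primeLog_of_not_prime hq, zero_mul]
  | h₃ a p ha hp ih =>
    rw [logNorm_mul hp.ne_zero ha, mul_add]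
    refine ((hasSum_primeLog_associated hp).add (ih ha)).congr_fun fun q => ?_
    by_cases hq : Prime q
    · rw [multiplicity_mul hq (FiniteMultiplicity.of_prime_left hq hω),
        multiplicity_prime_eq_ite hp hq]
      push_cast
      ring
    · simp only [primeLog_of_not_prime hq, zero_mul, add_zero]

/-- The general term `χ_n(ω) N(ω)^{-s}` of the Hecke L-series; it vanishes at `ω = 0`. -/
def heckeTerm (n : ℤ) (s : ℂ) (ω : GaussianInt) : ℂ :=
  angChar n (GaussianInt.toComplex ω) * Complex.exp (-s * logNorm ω)

/-- The Hecke L-series `∑ χ_n(ω) N(ω)^{-s}` over all nonzero Gaussian integers. -/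
def heckeL (n : ℤ) (s : ℂ) : ℂ := ∑' ω, heckeTerm n s ω

section HeckeSeries

variable (n : ℤ) {s : ℂ} {σ : ℝ} {q : GaussianInt}

@[simp] lemma heckeTerm_zero (s : ℂ) : heckeTerm n s 0 = 0 := by simp [heckeTerm]

lemma heckeTerm_mul (s : ℂ) (a b : GaussianInt) :
    heckeTerm n s (a * b) = heckeTerm n s a * heckeTerm n s b := by
  rcases eq_or_ne a 0 with rfl | ha
  · rw [zero_mul, heckeTerm_zero, zero_mul]
  rcases eq_or_ne b 0 with rfl | hb
  · rw [mul_zero, heckeTerm_zero, mul_zero]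
  rw [heckeTerm, heckeTerm, heckeTerm, logNorm_mul ha hb, map_mul, angChar_mul,
    Complex.ofReal_add, mul_add, Complex.exp_add]
  ring

lemma norm_heckeTerm (s : ℂ) {ω : GaussianInt} (hω : ω ≠ 0) :
    ‖heckeTerm n s ω‖ = Real.exp (-s.re * logNorm ω) := by
  rw [heckeTerm, norm_mul, norm_angChar (by simpa using hω), one_mul, norm_cexp_neg_mul]

lemma norm_heckeTerm_le (hs : σ ≤ s.re) (ω : GaussianInt) :
    ‖heckeTerm n s ω‖ ≤ Real.exp (-σ * logNorm ω) := by
  rcases eq_or_ne ω 0 with rfl | hω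
  · simp [Real.exp_nonneg]
  · rw [norm_heckeTerm n s hω]
    exact Real.exp_le_exp.2 (mul_le_mul_of_nonneg_right (neg_le_neg hs) (logNorm_nonneg ω))

lemma differentiable_heckeTerm (ω : GaussianInt) :
    Differentiable ℂ fun s => heckeTerm n s ω := by
  unfold heckeTerm
  fun_prop

lemma deriv_heckeTerm (s : ℂ) (ω : GaussianInt) :
    deriv (fun z => heckeTerm n z ω) s = -(logNorm ω : ℂ) * heckeTerm n s ω := by
  have hexp : HasDerivAt (fun z : ℂ => Complex.exp (-z * logNorm ω))
      (Complex.exp (-s * logNorm ω) * (-1 * logNorm ω)) s :=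
    ((hasDerivAt_id s).neg.mul_const _).cexp
  refine (hexp.const_mul (angChar n (GaussianInt.toComplex ω))).deriv.trans ?_
  rw [heckeTerm]
  ring

lemma injective_vecCons_re_im :
    Function.Injective fun ω : GaussianInt => (![ω.re, ω.im] : Fin 2 → ℤ) := fun a b h =>
  Zsqrtd.ext (by simpa using congrFun h 0) (by simpa using congrFun h 1)

lemma norm_vecCons_re_im_sq_le (ω : GaussianInt) :
    ‖(![ω.re, ω.im] : Fin 2 → ℤ)‖ ^ 2 ≤ ((Zsqrtd.norm ω : ℤ) : ℝ) := by
  rw [← norm_toComplex_sq]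
  refine pow_le_pow_left₀ (norm_nonneg _) ?_ 2
  refine (pi_norm_le_iff_of_nonneg (norm_nonneg _)).2 fun i => ?_
  have hre := Complex.abs_re_le_norm (GaussianInt.toComplex ω)
  have him := Complex.abs_im_le_norm (GaussianInt.toComplex ω)
  rw [← GaussianInt.intCast_re] at hre
  rw [← GaussianInt.intCast_im] at him
  fin_cases i
  · simpa [Int.norm_eq_abs] using hre
  · simpa [Int.norm_eq_abs] using him

lemma summable_exp_neg_mul_logNorm (hσ : 1 < σ) :
    Summable fun ω => Real.exp (-σ * logNorm ω) := by
  have hsup := (EisensteinSeries.summable_one_div_norm_rpow (k := 2 * σ)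
    (by linarith)).comp_injective injective_vecCons_re_im
  refine Summable.of_norm_bounded_eventually hsup ?_
  refine (Set.finite_singleton (0 : GaussianInt)).subset fun ω hbound => ?_
  by_contra hω
  refine hbound ?_
  have hpos : 0 < ‖(![ω.re, ω.im] : Fin 2 → ℤ)‖ := by
    rw [norm_pos_iff]
    exact fun h => hω (injective_vecCons_re_im (by simpa using h))
  change ‖Real.exp (-σ * logNorm ω)‖ ≤ ‖(![ω.re, ω.im] : Fin 2 → ℤ)‖ ^ (-(2 * σ))
  rw [Real.norm_of_nonneg (Real.exp_pos _).le, logNorm, mul_comm,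
    ← Real.rpow_def_of_pos (zero_lt_one.trans_le (one_le_norm hω))]
  calc ((Zsqrtd.norm ω : ℤ) : ℝ) ^ (-σ)
      ≤ (‖(![ω.re, ω.im] : Fin 2 → ℤ)‖ ^ 2) ^ (-σ) :=
        Real.rpow_le_rpow_of_nonpos (by positivity) (norm_vecCons_re_im_sq_le ω) (by linarith)
    _ = ‖(![ω.re, ω.im] : Fin 2 → ℤ)‖ ^ (-(2 * σ)) := by
        rw [← Real.rpow_natCast_mul hpos.le, Nat.cast_ofNat, mul_neg]

lemma summable_logNorm_mul_exp (hσ : 1 < σ) :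
    Summable fun ω => logNorm ω * Real.exp (-σ * logNorm ω) := by
  obtain ⟨τ, hτ, hτσ⟩ := exists_between hσ
  refine Summable.of_nonneg_of_le (fun ω => mul_nonneg (logNorm_nonneg ω) (Real.exp_pos _).le)
    (fun ω => ?_) ((summable_exp_neg_mul_logNorm hτ).mul_left (1 / (σ - τ)))
  calc logNorm ω * Real.exp (-σ * logNorm ω)
      ≤ 1 / (σ - τ) * Real.exp ((σ - τ) * logNorm ω) * Real.exp (-σ * logNorm ω) :=
        mul_le_mul_of_nonneg_right (self_le_div_mul_exp (sub_pos.2 hτσ) _) (Real.exp_pos _).le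
    _ = 1 / (σ - τ) * Real.exp (-τ * logNorm ω) := by
        rw [mul_assoc, ← Real.exp_add]
        ring_nf

lemma summable_heckeTerm (hs : 1 < s.re) : Summable fun ω => heckeTerm n s ω :=
  Summable.of_norm_bounded (summable_exp_neg_mul_logNorm hs) (norm_heckeTerm_le n le_rfl)

lemma isOpen_re_gt (a : ℝ) : IsOpen {s : ℂ | a < s.re} :=
  isOpen_lt continuous_const Complex.continuous_re

lemma differentiableOn_heckeL : DifferentiableOn ℂ (heckeL n) {s | 1 < s.re} := by
  intro s hs
  obtain ⟨a, ha, has⟩ := exists_between (show 1 < s.re from hs)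
  exact ((Complex.differentiableOn_tsum_of_summable_norm (summable_exp_neg_mul_logNorm ha)
    (fun ω => (differentiable_heckeTerm n ω).differentiableOn) (isOpen_re_gt a)
    fun ω z hz => norm_heckeTerm_le n (le_of_lt hz) ω).differentiableAt
    ((isOpen_re_gt a).mem_nhds has)).differentiableWithinAt

lemma hasSum_deriv_heckeL (hs : 1 < s.re) :
    HasSum (fun ω => -(logNorm ω : ℂ) * heckeTerm n s ω) (deriv (heckeL n) s) := by
  obtain ⟨a, ha, has⟩ := exists_between hs
  have hsum := Complex.hasSum_deriv_of_summable_norm (summable_exp_neg_mul_logNorm ha)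
    (fun ω => (differentiable_heckeTerm n ω).differentiableOn) (isOpen_re_gt a)
    (fun ω z hz => norm_heckeTerm_le n (le_of_lt hz) ω) has
  simp only [deriv_heckeTerm] at hsum
  exact hsum

lemma norm_heckeTerm_prime_le (hs : 1 ≤ s.re) (hq : Prime q) : ‖heckeTerm n s q‖ ≤ 1 / 2 :=
  calc ‖heckeTerm n s q‖ ≤ Real.exp (-1 * logNorm q) := norm_heckeTerm_le n hs q
    _ ≤ Real.exp (-Real.log 2) := Real.exp_le_exp.2 (by linarith [log_two_le_logNorm hq])
    _ = 1 / 2 := by rw [Real.exp_neg, Real.exp_log two_pos, one_div]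

lemma half_le_norm_one_sub_heckeTerm (hs : 1 ≤ s.re) (hq : Prime q) :
    1 / 2 ≤ ‖1 - heckeTerm n s q‖ := by
  have htri := norm_sub_norm_le (1 : ℂ) (heckeTerm n s q)
  rw [norm_one] at htri
  linarith [norm_heckeTerm_prime_le n hs hq]

lemma one_sub_heckeTerm_ne_zero (hs : 1 ≤ s.re) (hq : Prime q) : 1 - heckeTerm n s q ≠ 0 :=
  norm_pos_iff.1 (one_half_pos.trans_le (half_le_norm_one_sub_heckeTerm n hs hq))

lemma summable_heckeTerm_mul_multiplicity (hs : 1 < s.re) (hq : Prime q) :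
    Summable fun ω => heckeTerm n s ω * (multiplicity q ω : ℂ) := by
  refine Summable.of_norm_bounded ((summable_logNorm_mul_exp hs).mul_left (4 / logNorm q))
    fun ω => ?_
  rcases eq_or_ne ω 0 with rfl | hω
  · simp [logNorm]
  have hmult : logNorm q * (multiplicity q ω : ℝ) ≤ 4 * logNorm ω := by
    rw [← primeLog_of_prime hq]
    exact le_hasSum (hasSum_primeLog_mul_multiplicity hω) q
      fun p _ => mul_nonneg (primeLog_nonneg p) (Nat.cast_nonneg _)
  rw [norm_mul, norm_heckeTerm n s hω, Complex.norm_natCast, mul_comm, ← mul_assoc]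
  refine mul_le_mul_of_nonneg_right ?_ (Real.exp_pos _).le
  rw [div_mul_eq_mul_div, le_div_iff₀ (logNorm_pos_of_prime hq), mul_comm]
  exact hmult

lemma heckeTerm_mul_multiplicity_mul (s : ℂ) (hq : Prime q) (ω : GaussianInt) :
    heckeTerm n s (q * ω) * (multiplicity q (q * ω) : ℂ) =
      heckeTerm n s q * heckeTerm n s ω +
        heckeTerm n s q * (heckeTerm n s ω * (multiplicity q ω : ℂ)) := by
  rcases eq_or_ne ω 0 with rfl | hω
  · simp
  rw [heckeTerm_mul, multiplicity_mul hq
    (FiniteMultiplicity.of_prime_left hq (mul_ne_zero hq.ne_zero hω)), multiplicity_self]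
  push_cast
  ring

lemma tsum_heckeTerm_mul_multiplicity (hs : 1 < s.re) (hq : Prime q) :
    ∑' ω, heckeTerm n s ω * (multiplicity q ω : ℂ)
      = heckeL n s * (heckeTerm n s q / (1 - heckeTerm n s q)) := by
  have hsupp : Function.support (fun ω => heckeTerm n s ω * (multiplicity q ω : ℂ))
      ⊆ range (q * ·) := by
    intro ω hω
    by_contra hdvd
    refine hω ?_
    have hmult : multiplicity q ω = 0 := multiplicity_eq_zero.2 fun ⟨c, hc⟩ => hdvd ⟨c, hc.symm⟩
    simp only [hmult, Nat.cast_zero, mul_zero]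
  have hrec := (mul_right_injective₀ hq.ne_zero).tsum_eq hsupp
  simp_rw [heckeTerm_mul_multiplicity_mul n s hq] at hrec
  rw [((summable_heckeTerm n hs).mul_left _).tsum_add
      ((summable_heckeTerm_mul_multiplicity n hs hq).mul_left _),
    tsum_mul_left, tsum_mul_left] at hrec
  rw [← mul_div_assoc, eq_div_iff (one_sub_heckeTerm_ne_zero n hs.le hq), heckeL]
  linear_combination -hrec

end HeckeSeries

/-- The Dirichlet series `∑_q χ_n(q) log N(q) N(q)^{-s}` over the primes of `ℤ[i]`. -/
def primeSeries (n : ℤ) (s : ℂ) : ℂ := ∑' q, (primeLog q : ℂ) * heckeTerm n s q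

/-- The contribution `∑_q log N(q) ∑_{k ≥ 2} (χ_n(q) N(q)^{-s})^k` of the higher prime powers to
the logarithmic derivative of the Hecke L-series. -/
def primePowerSeries (n : ℤ) (s : ℂ) : ℂ :=
  ∑' q, (primeLog q : ℂ) * (heckeTerm n s q ^ 2 / (1 - heckeTerm n s q))

/-- The entries of the array whose row sums give the Dirichlet series of `heckeL n` with an extra
factor `4 log N(ω)` and whose column sums give its Euler factors. -/
def primeArray (n : ℤ) (s : ℂ) (ω q : GaussianInt) : ℂ :=
  heckeTerm n s ω * ((primeLog q : ℂ) * (multiplicity q ω : ℂ))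

section LogDeriv

variable (n : ℤ) {s : ℂ}

lemma summable_primeSeries (hs : 1 < s.re) :
    Summable fun q => (primeLog q : ℂ) * heckeTerm n s q := by
  refine Summable.of_norm_bounded (summable_logNorm_mul_exp hs) fun q => ?_
  rw [norm_mul, norm_ofReal_primeLog]
  exact mul_le_mul (primeLog_le q) (norm_heckeTerm_le n le_rfl q) (norm_nonneg _)
    (logNorm_nonneg q)

lemma norm_primePowerSeries_term_le (hs : 1 ≤ s.re) (q : GaussianInt) :
    ‖(primeLog q : ℂ) * (heckeTerm n s q ^ 2 / (1 - heckeTerm n s q))‖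
      ≤ 2 * (logNorm q * Real.exp (-2 * logNorm q)) := by
  have hl := logNorm_nonneg q
  by_cases hq : Prime q
  · have hnum : ‖heckeTerm n s q‖ ^ 2 ≤ Real.exp (-2 * logNorm q) := by
      refine (pow_le_pow_left₀ (norm_nonneg _) (norm_heckeTerm_le n hs q) 2).trans_eq ?_
      rw [← Real.exp_nat_mul]
      push_cast
      ring_nf
    have hden := half_le_norm_one_sub_heckeTerm n hs hq
    rw [norm_mul, norm_ofReal_primeLog, norm_div, norm_pow, mul_left_comm]
    refine mul_le_mul (primeLog_le q) ?_ (by positivity) hl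
    rw [div_le_iff₀ (by linarith)]
    nlinarith [Real.exp_pos (-2 * logNorm q)]
  · simp only [primeLog_of_not_prime hq, Complex.ofReal_zero, zero_mul, norm_zero]
    positivity

lemma continuousOn_primePowerSeries : ContinuousOn (primePowerSeries n) {s | 1 ≤ s.re} := by
  refine continuousOn_tsum (fun q => ?_)
    ((summable_logNorm_mul_exp one_lt_two).mul_left 2)
    (fun q s hs => norm_primePowerSeries_term_le n hs q)
  by_cases hq : Prime q
  · have hcont := (differentiable_heckeTerm n q).continuous
    exact continuousOn_const.mul ((hcont.pow 2).continuousOn.div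
      (continuous_const.sub hcont).continuousOn fun s hs => one_sub_heckeTerm_ne_zero n hs hq)
  · simp only [primeLog_of_not_prime hq, Complex.ofReal_zero, zero_mul]
    exact continuousOn_const

lemma hasSum_primeArray_row (s : ℂ) (ω : GaussianInt) :
    HasSum (primeArray n s ω) (heckeTerm n s ω * ((4 * logNorm ω : ℝ) : ℂ)) := by
  rcases eq_or_ne ω 0 with rfl | hω
  · have hzero : primeArray n s 0 = 0 := by
      funext q
      simp [primeArray]
    rw [hzero, heckeTerm_zero, zero_mul]
    exact hasSum_zero
  · have hsum := Complex.hasSum_ofReal.2 (hasSum_primeLog_mul_multiplicity hω)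
    simp only [Complex.ofReal_mul (primeLog _), Complex.ofReal_natCast] at hsum
    exact hsum.mul_left (heckeTerm n s ω)

lemma norm_primeArray (s : ℂ) (ω q : GaussianInt) : ‖primeArray n s ω q‖ =
    ‖heckeTerm n s ω‖ * (primeLog q * (multiplicity q ω : ℝ)) := by
  rw [primeArray, norm_mul, norm_mul, norm_ofReal_primeLog, Complex.norm_natCast]

lemma hasSum_norm_primeArray_row (s : ℂ) (ω : GaussianInt) :
    HasSum (fun q => ‖primeArray n s ω q‖) (‖heckeTerm n s ω‖ * (4 * logNorm ω)) := by
  simp_rw [norm_primeArray]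
  rcases eq_or_ne ω 0 with rfl | hω
  · simp
  · exact (hasSum_primeLog_mul_multiplicity hω).mul_left _

lemma summable_primeArray (hs : 1 < s.re) : Summable (Function.uncurry (primeArray n s)) := by
  refine Summable.of_norm ?_
  rw [summable_prod_of_nonneg fun _ => norm_nonneg _]
  refine ⟨fun ω => (hasSum_norm_primeArray_row n s ω).summable, ?_⟩
  simp only [Function.uncurry_apply_pair, (hasSum_norm_primeArray_row n s _).tsum_eq]
  refine Summable.of_nonneg_of_le (fun ω => mul_nonneg (norm_nonneg _)
    (mul_nonneg zero_le_four (logNorm_nonneg ω))) (fun ω => ?_)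
    ((summable_logNorm_mul_exp hs).mul_left 4)
  linarith [mul_le_mul_of_nonneg_right (norm_heckeTerm_le n le_rfl ω : _ ≤ Real.exp (-s.re * _))
    (mul_nonneg zero_le_four (logNorm_nonneg ω))]

lemma tsum_primeArray_column (hs : 1 < s.re) (q : GaussianInt) :
    ∑' ω, primeArray n s ω q = heckeL n s * ((primeLog q : ℂ) * heckeTerm n s q
      + (primeLog q : ℂ) * (heckeTerm n s q ^ 2 / (1 - heckeTerm n s q))) := by
  by_cases hq : Prime q
  · have hden := one_sub_heckeTerm_ne_zero n hs.le hq
    simp_rw [primeArray, mul_left_comm (heckeTerm n s _)]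
    rw [tsum_mul_left, tsum_heckeTerm_mul_multiplicity n hs hq]
    field_simp
    ring
  · simp [primeArray, primeLog_of_not_prime hq]

-- Stated without denominators because nonvanishing of `heckeL n` is derived from it.
lemma neg_four_mul_deriv_heckeL (hs : 1 < s.re) :
    -4 * deriv (heckeL n) s = heckeL n s * (primeSeries n s + primePowerSeries n s) := by
  have hpowers : Summable fun q =>
      (primeLog q : ℂ) * (heckeTerm n s q ^ 2 / (1 - heckeTerm n s q)) :=
    Summable.of_norm_bounded ((summable_logNorm_mul_exp one_lt_two).mul_left 2)
      (norm_primePowerSeries_term_le n hs.le)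
  calc -4 * deriv (heckeL n) s = ∑' ω, heckeTerm n s ω * ((4 * logNorm ω : ℝ) : ℂ) := by
        rw [← (hasSum_deriv_heckeL n hs).tsum_eq, ← tsum_mul_left]
        refine tsum_congr fun ω => ?_
        push_cast
        ring
    _ = ∑' ω, ∑' q, primeArray n s ω q :=
        tsum_congr fun ω => (hasSum_primeArray_row n s ω).tsum_eq.symm
    _ = ∑' q, ∑' ω, primeArray n s ω q := (summable_primeArray n hs).tsum_comm.symm
    _ = heckeL n s * (primeSeries n s + primePowerSeries n s) := by
        simp_rw [tsum_primeArray_column n hs]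
        rw [tsum_mul_left, (summable_primeSeries n hs).tsum_add hpowers, primeSeries,
          primePowerSeries]

end LogDeriv

/-! ### Analytic continuation of the Hecke L-series -/

/-- The order of the pole of `heckeL n` at `s = 1`. -/
def poleOrder (n : ℤ) : ℕ := if n = 0 then 1 else 0

/-- The error `∑_{0 < N(ω) ≤ e^u} χ_n(ω) - poleOrder n * π * e^u` in the weighted count of lattice
points. -/
def latticeError (n : ℤ) (u : ℝ) : ℂ :=
  summatory (fun ω => angChar n (GaussianInt.toComplex ω)) logNorm u
    - poleOrder n * Real.pi * Complex.exp u

lemma logNorm_le_iff {ω : GaussianInt} (hω : ω ≠ 0) (u : ℝ) :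
    logNorm ω ≤ u ↔ ω ∈ ball (Real.exp u) :=
  Real.log_le_iff_le_exp (zero_lt_one.trans_le (one_le_norm hω))

lemma summatory_logNorm {E : Type*} [AddCommMonoid E] [TopologicalSpace E] {w : GaussianInt → E}
    (hw : w 0 = 0) (u : ℝ) :
    summatory w logNorm u = ∑ ω ∈ (ball_finite (Real.exp u)).toFinset, w ω := by
  classical
  have hterm (ω : GaussianInt) :
      (if logNorm ω ≤ u then w ω else 0) = if ω ∈ ball (Real.exp u) then w ω else 0 := by
    rcases eq_or_ne ω 0 with rfl | hω
    · rw [hw, ite_self, ite_self]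
    · simp only [logNorm_le_iff hω]
  rw [summatory, tsum_congr hterm,
    tsum_eq_sum (s := (ball_finite (Real.exp u)).toFinset)
      fun ω hω => if_neg fun hball => hω ((Set.Finite.mem_toFinset _).2 hball)]
  exact Finset.sum_congr rfl fun ω hω => if_pos ((Set.Finite.mem_toFinset _).1 hω)

lemma norm_latticeError_le (n : ℤ) : ∃ C : ℝ, ∀ u, 0 < u →
    ‖latticeError n u‖ ≤ C * Real.exp (3 / 4 * u) := by
  obtain ⟨C, hC⟩ := norm_sum_angChar_sub_le n
  refine ⟨C, fun u hu => ?_⟩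
  have hbound := hC (Real.exp (u / 2)) (Real.one_le_exp (by linarith))
  have hsq : Real.exp (u / 2) ^ 2 = Real.exp u := by
    rw [← Real.exp_nat_mul]
    push_cast
    ring_nf
  have hsqrt : Real.exp (u / 2) * √(Real.exp (u / 2)) = Real.exp (3 / 4 * u) := by
    rw [← Real.exp_half, ← Real.exp_add]
    ring_nf
  have hmain : (if n = 0 then ((Real.pi * Real.exp u : ℝ) : ℂ) else 0)
      = poleOrder n * Real.pi * Complex.exp u := by
    rw [poleOrder]
    split_ifs <;> simp
  rw [hsqrt, hsq, hmain] at hbound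
  rwa [latticeError, summatory_logNorm (by rw [map_zero, angChar_apply_zero])]

lemma measurable_latticeError (n : ℤ) : Measurable (latticeError n) := by
  unfold latticeError
  exact (measurable_summatory _ _).sub (by fun_prop)

/-- The Laplace transform of the error term; it is holomorphic for `Re s > 3 / 4`. -/
def errorTransform (n : ℤ) (s : ℂ) : ℂ :=
  ∫ u in Ioi (0 : ℝ), latticeError n u * Complex.exp (-s * u)

/-- The analytic continuation of `(s - 1) ^ poleOrder n * heckeL n s` to `Re s > 3 / 4`. -/
def heckeG (n : ℤ) (s : ℂ) : ℂ :=
  s * (poleOrder n * Real.pi + (s - 1) ^ poleOrder n * errorTransform n s)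

section Continuation

variable (n : ℤ) {s : ℂ}

lemma differentiableOn_errorTransform :
    DifferentiableOn ℂ (errorTransform n) {s | 3 / 4 < s.re} := by
  obtain ⟨C, hC⟩ := norm_latticeError_le n
  exact differentiableOn_laplace (measurable_latticeError n) hC

lemma analyticOnNhd_heckeG : AnalyticOnNhd ℂ (heckeG n) {s | 3 / 4 < s.re} := by
  have := differentiableOn_errorTransform n
  refine DifferentiableOn.analyticOnNhd ?_ (isOpen_re_gt _)
  unfold heckeG
  fun_prop

lemma errorTransform_eq (hs : 1 < s.re) :
    errorTransform n s = heckeL n s / s - poleOrder n * Real.pi / (s - 1) := by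
  set χ : GaussianInt → ℂ := fun ω => angChar n (GaussianInt.toComplex ω)
  have hs0 : 0 < s.re := by linarith
  have hs1 : 0 < (s - 1).re := by simpa using hs
  have hsum : Summable fun ω => ‖χ ω‖ * Real.exp (-s.re * logNorm ω) :=
    (summable_exp_neg_mul_logNorm hs).of_nonneg_of_le (fun ω => by positivity) fun ω =>
      mul_le_of_le_one_left (Real.exp_pos _).le (norm_angChar_le n _)
  have hsplit (u : ℝ) : latticeError n u * Complex.exp (-s * u)
      = summatory χ logNorm u * Complex.exp (-s * u)
        - poleOrder n * Real.pi * Complex.exp (-(s - 1) * u) := by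
    have hexp : Complex.exp (-(s - 1) * u) = Complex.exp u * Complex.exp (-s * u) := by
      rw [← Complex.exp_add]
      ring_nf
    rw [hexp, latticeError]
    ring
  simp_rw [errorTransform, hsplit]
  rw [integral_sub (integrableOn_summatory_mul_cexp logNorm_nonneg hs0 hsum)
      ((integrableOn_cexp_neg_mul hs1 0).const_mul _), integral_const_mul,
    integral_summatory_mul_cexp logNorm_nonneg hs0 hsum, integral_cexp_neg_mul_Ioi hs1,
    Complex.ofReal_zero, mul_zero, Complex.exp_zero, mul_one_div]
  rfl

lemma sub_one_ne_zero_of_one_lt_re (hs : 1 < s.re) : s - 1 ≠ 0 :=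
  ne_zero_of_re_pos (by simpa using hs)

lemma heckeG_eq (hs : 1 < s.re) : heckeG n s = (s - 1) ^ poleOrder n * heckeL n s := by
  have hs0 := ne_zero_of_re_pos (one_pos.trans hs)
  have hs1 := sub_one_ne_zero_of_one_lt_re hs
  rw [heckeG, errorTransform_eq n hs, poleOrder]
  split_ifs
  · field_simp
    ring
  · field_simp
    simp

lemma heckeG_zero_one : heckeG 0 1 = Real.pi := by
  simp [heckeG, poleOrder]

-- Stated without dividing by `heckeG n s`, which is not yet known to be nonzero.
lemma four_mul_deriv_heckeG (hs : 1 < s.re) :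
    4 * deriv (heckeG n) s
      = heckeG n s * (4 * poleOrder n / (s - 1) - primeSeries n s - primePowerSeries n s) := by
  have hs1 := sub_one_ne_zero_of_one_lt_re hs
  have hcont : heckeG n =ᶠ[𝓝 s] fun z => (z - 1) ^ poleOrder n * heckeL n z := by
    filter_upwards [(isOpen_re_gt 1).mem_nhds hs] with z hz using heckeG_eq n hz
  have hderivL := ((differentiableOn_heckeL n).differentiableAt
    ((isOpen_re_gt 1).mem_nhds hs)).hasDerivAt
  have hderiv := ((((hasDerivAt_id s).sub_const 1).pow (poleOrder n)).mul hderivL).deriv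
  have hpow : (poleOrder n : ℂ) * (s - 1) ^ (poleOrder n - 1)
      = (s - 1) ^ poleOrder n * (poleOrder n / (s - 1)) := by
    rw [poleOrder]
    split_ifs
    · field_simp
      simp
    · simp
  rw [hcont.deriv_eq, heckeG_eq n hs]
  refine (congrArg (4 * ·) hderiv).trans ?_
  simp only [id_eq, mul_one, hpow, Pi.pow_apply]
  linear_combination (-(s - 1) ^ poleOrder n) * neg_four_mul_deriv_heckeL n hs

end Continuation

/-! ### Units and the Hecke terms -/

lemma heckeTerm_of_isUnit (n : ℤ) (s : ℂ) {u : GaussianInt} (hu : IsUnit u) :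
    heckeTerm n s u = GaussianInt.toComplex u ^ n := by
  have hnorm : ‖GaussianInt.toComplex u‖ = 1 := by
    rw [← sq_eq_sq₀ (norm_nonneg _) zero_le_one, norm_toComplex_sq,
      (norm_eq_one_iff_isUnit u).2 hu, Int.cast_one, one_pow]
  rw [heckeTerm, logNorm_of_isUnit hu, angChar_of_ne_zero (by simpa using hu.ne_zero), hnorm]
  simp

lemma pow_four_eq_one_of_isUnit {u : GaussianInt} (hu : IsUnit u) : u ^ 4 = 1 := by
  have hmem := mem_gaussUnits_iff.2 hu
  simp only [gaussUnits, Finset.mem_insert, Finset.mem_singleton] at hmem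
  rcases hmem with rfl | rfl | rfl | rfl <;> decide

lemma heckeTerm_of_isUnit_of_four_dvd {n : ℤ} (hn : 4 ∣ n) (s : ℂ) {u : GaussianInt}
    (hu : IsUnit u) : heckeTerm n s u = 1 := by
  obtain ⟨k, rfl⟩ := hn
  have hpow : GaussianInt.toComplex u ^ (4 : ℤ) = 1 := by
    rw [zpow_ofNat, ← map_pow, pow_four_eq_one_of_isUnit hu, map_one]
  rw [heckeTerm_of_isUnit _ s hu, zpow_mul, hpow, one_zpow]

-- Multiplication by `i` permutes the primes and multiplies `χ_n` by `i ^ n ≠ 1`.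
lemma primeSeries_eq_zero {n : ℤ} (hn : ¬ 4 ∣ n) (s : ℂ) : primeSeries n s = 0 := by
  have hi : IsUnit (⟨0, 1⟩ : GaussianInt) := mem_gaussUnits_iff.1 (by decide)
  have hterm : heckeTerm n s ⟨0, 1⟩ = Complex.I ^ n := by
    rw [heckeTerm_of_isUnit n s hi]
    simp [GaussianInt.toComplex_def]
  have hsymm : primeSeries n s = Complex.I ^ n * primeSeries n s := by
    conv_lhs => rw [primeSeries, ← (Units.mulLeft hi.unit).tsum_eq]
    rw [primeSeries, ← tsum_mul_left]
    refine tsum_congr fun q => ?_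
    rw [Units.mulLeft_apply, IsUnit.unit_spec, heckeTerm_mul, hterm,
      primeLog_eq_of_associated (associated_unit_mul_left q _ hi)]
    ring
  have hI : Complex.I ^ n ≠ 1 := fun h =>
    hn (mod_cast (Complex.isPrimitiveRoot_I.zpow_eq_one_iff_dvd n).1 h)
  exact (mul_left_eq_self₀.1 hsymm.symm).resolve_left hI

lemma logNorm_pos {ω : GaussianInt} (hω : ω ≠ 0) (hunit : ¬ IsUnit ω) : 0 < logNorm ω :=
  Real.log_pos ((one_le_norm hω).lt_of_ne' fun h =>
    hunit ((norm_eq_one_iff_isUnit ω).1 (mod_cast h)))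

lemma tendsto_heckeL_atTop {n : ℤ} (hn : 4 ∣ n) :
    Tendsto (fun σ : ℝ => heckeL n σ) atTop (𝓝 4) := by
  have hunits : ∑' ω : GaussianInt, (if ω ∈ gaussUnits then (1 : ℂ) else 0) = 4 := by
    rw [tsum_eq_sum (s := gaussUnits) fun ω hω => if_neg hω,
      Finset.sum_congr rfl fun ω hω => if_pos hω, Finset.sum_const, card_gaussUnits]
    norm_num
  rw [← hunits]
  refine tendsto_tsum_of_dominated_convergence (summable_exp_neg_mul_logNorm one_lt_two)
    (fun ω => ?_) ?_
  · split_ifs with hunit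
    · simp only [heckeTerm_of_isUnit_of_four_dvd hn _ (mem_gaussUnits_iff.1 hunit)]
      exact tendsto_const_nhds
    · rcases eq_or_ne ω 0 with rfl | hω
      · simp
      · have hpos := logNorm_pos hω fun h => hunit (mem_gaussUnits_iff.2 h)
        rw [tendsto_zero_iff_norm_tendsto_zero]
        simp_rw [norm_heckeTerm n _ hω, Complex.ofReal_re]
        exact Real.tendsto_exp_atBot.comp (tendsto_neg_atTop_atBot.atBot_mul_const hpos)
  · filter_upwards [eventually_ge_atTop 2] with σ hσ ω using norm_heckeTerm_le n (by simpa) ω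

lemma analyticOrderAt_heckeG_ne_top {n : ℤ} (hn : 4 ∣ n) {s : ℂ} (hs : 3 / 4 < s.re) :
    analyticOrderAt (heckeG n) s ≠ ⊤ := by
  have hlim := (tendsto_heckeL_atTop hn).eventually_ne (show (4 : ℂ) ≠ 0 by norm_num)
  obtain ⟨σ, hL, hσ⟩ := (hlim.and (eventually_gt_atTop 1)).exists
  have hσ1 : 1 < (σ : ℂ).re := by simpa using hσ
  have hσ' : (3 / 4 : ℝ) < (σ : ℂ).re := by linarith
  have hne : heckeG n σ ≠ 0 := by
    rw [heckeG_eq n hσ1]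
    exact mul_ne_zero (pow_ne_zero _ (sub_one_ne_zero_of_one_lt_re hσ1)) hL
  refine AnalyticOnNhd.analyticOrderAt_ne_top_of_isPreconnected (analyticOnNhd_heckeG n)
    (convex_halfSpace_re_gt _).isPreconnected hσ' hs ?_
  rw [((analyticOnNhd_heckeG n) _ hσ').analyticOrderAt_eq_zero.2 hne]
  exact ENat.zero_ne_top

/-! ### The orders of vanishing and nonvanishing on `Re s ≥ 1` -/

lemma tendsto_sub_mul_logDeriv {𝕜 : Type*} [NontriviallyNormedField 𝕜] [CompleteSpace 𝕜]
    {f : 𝕜 → 𝕜} {z₀ : 𝕜} (hf : AnalyticAt 𝕜 f z₀) (hfin : analyticOrderAt f z₀ ≠ ⊤) :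
    Tendsto (fun z => (z - z₀) * logDeriv f z) (𝓝[≠] z₀) (𝓝 (analyticOrderNatAt f z₀)) := by
  obtain ⟨g, hg, hg0, hfg⟩ := hf.analyticOrderAt_ne_top.1 hfin
  set m := analyticOrderNatAt f z₀
  have hcont : ContinuousAt (fun z => (m : 𝕜) + (z - z₀) * logDeriv g z) z₀ :=
    continuousAt_const.add ((continuousAt_id.sub continuousAt_const).mul
      (hg.deriv.continuousAt.div hg.continuousAt hg0))
  have hlim : Tendsto (fun z => (m : 𝕜) + (z - z₀) * logDeriv g z) (𝓝[≠] z₀) (𝓝 m) := by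
    simpa using hcont.tendsto.mono_left nhdsWithin_le_nhds
  refine hlim.congr' ?_
  filter_upwards [(eventually_eventually_nhds.2 hfg).filter_mono nhdsWithin_le_nhds,
    (hg.continuousAt.eventually_ne hg0).filter_mono nhdsWithin_le_nhds,
    hg.eventually_analyticAt.filter_mono nhdsWithin_le_nhds, self_mem_nhdsWithin]
    with z hfgz hgz hgan hz
  have hz0 : z - z₀ ≠ 0 := sub_ne_zero.2 hz
  have hd : DifferentiableAt 𝕜 (fun z => z - z₀) z := by fun_prop
  have hlog : logDeriv (fun z => z - z₀) z = (z - z₀)⁻¹ := by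
    rw [logDeriv_apply, deriv_sub_const, deriv_id'', one_div]
  rw [(logDeriv_congr_nhds hfgz).eq_of_nhds]
  simp only [smul_eq_mul]
  rw [logDeriv_mul (f := fun z => (z - z₀) ^ m) z (pow_ne_zero m hz0) hgz (hd.pow m)
    hgan.differentiableAt, logDeriv_fun_pow hd, hlog]
  field_simp

lemma tendsto_add_ofReal_nhdsNE (s : ℂ) : Tendsto (fun ε : ℝ => s + ε) (𝓝[>] 0) (𝓝[≠] s) := by
  refine tendsto_nhdsWithin_iff.2 ⟨?_, ?_⟩
  · have hcont : Continuous fun ε : ℝ => s + ε := by fun_prop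
    simpa using (hcont.tendsto 0).mono_left nhdsWithin_le_nhds
  · filter_upwards [self_mem_nhdsWithin] with ε hε
    simp [(mem_Ioi.1 hε).ne']

lemma tendsto_ofReal_nhdsGT_zero : Tendsto (fun ε : ℝ => (ε : ℂ)) (𝓝[>] 0) (𝓝 0) := by
  simpa using (Complex.continuous_ofReal.tendsto 0).mono_left nhdsWithin_le_nhds

section Boundary

variable {n : ℤ} {s : ℂ}

lemma tendsto_mul_poleOrder_div (n : ℤ) (s : ℂ) :
    Tendsto (fun ε : ℝ => (ε : ℂ) * (poleOrder n / (s + ε - 1))) (𝓝[>] 0)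
      (𝓝 (if n = 0 ∧ s = 1 then 1 else 0)) := by
  rcases eq_or_ne n 0 with rfl | hn
  swap
  · simp [poleOrder, hn]
  rcases eq_or_ne s 1 with rfl | hs
  · rw [if_pos ⟨rfl, rfl⟩]
    refine tendsto_const_nhds.congr' ?_
    filter_upwards [self_mem_nhdsWithin] with ε hε
    have hε0 : (ε : ℂ) ≠ 0 := Complex.ofReal_ne_zero.2 (mem_Ioi.1 hε).ne'
    simp [poleOrder, hε0]
  · rw [if_neg fun h => hs h.2]
    have hcont : ContinuousAt (fun ε : ℝ => (ε : ℂ) * (poleOrder 0 / (s + ε - 1))) 0 := by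
      refine ContinuousAt.mul (by fun_prop) (ContinuousAt.div (by fun_prop) (by fun_prop) ?_)
      simpa using sub_ne_zero.2 hs
    simpa using hcont.tendsto.mono_left nhdsWithin_le_nhds

lemma tendsto_mul_primePowerSeries (n : ℤ) (hs : 1 ≤ s.re) :
    Tendsto (fun ε : ℝ => (ε : ℂ) * primePowerSeries n (s + ε)) (𝓝[>] 0) (𝓝 0) := by
  have hwithin : Tendsto (fun ε : ℝ => s + ε) (𝓝[>] 0) (𝓝[{s | 1 ≤ s.re}] s) := by
    refine tendsto_nhdsWithin_iff.2
      ⟨(tendsto_add_ofReal_nhdsNE s).mono_right nhdsWithin_le_nhds, ?_⟩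
    filter_upwards [self_mem_nhdsWithin] with ε hε
    have hε0 := mem_Ioi.1 hε
    simp only [Complex.add_re, Complex.ofReal_re]
    linarith
  simpa using tendsto_ofReal_nhdsGT_zero.mul
    ((continuousOn_primePowerSeries n s hs).tendsto.comp hwithin)

lemma tendsto_mul_primeSeries (hn : 4 ∣ n) (hs : 1 ≤ s.re) :
    Tendsto (fun ε : ℝ => (ε : ℂ) * primeSeries n (s + ε)) (𝓝[>] 0)
      (𝓝 (4 * ((if n = 0 ∧ s = 1 then 1 else 0) - analyticOrderNatAt (heckeG n) s))) := by
  have hs' : 3 / 4 < s.re := by linarith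
  have han := analyticOnNhd_heckeG n s hs'
  have hfin := analyticOrderAt_heckeG_ne_top hn hs'
  have hne : ∀ᶠ z in 𝓝[≠] s, heckeG n z ≠ 0 :=
    han.eventually_eq_zero_or_eventually_ne_zero.resolve_left
      fun h => hfin (analyticOrderAt_eq_top.2 h)
  have hlog := (tendsto_sub_mul_logDeriv han hfin).comp (tendsto_add_ofReal_nhdsNE s)
  have hlim := (((tendsto_mul_poleOrder_div n s).sub hlog).const_mul 4).sub
    (tendsto_mul_primePowerSeries n hs)
  rw [sub_zero] at hlim
  refine hlim.congr' ?_
  filter_upwards [(tendsto_add_ofReal_nhdsNE s).eventually hne, self_mem_nhdsWithin] with ε hG hε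
  have hre : 1 < (s + ε).re := by
    rw [Complex.add_re, Complex.ofReal_re]
    linarith [mem_Ioi.1 hε]
  have hderiv : 4 * logDeriv (heckeG n) (s + ε)
      = 4 * poleOrder n / (s + ε - 1) - primeSeries n (s + ε) - primePowerSeries n (s + ε) := by
    rw [logDeriv_apply, ← mul_div_assoc, four_mul_deriv_heckeG n hre, mul_div_cancel_left₀ _ hG]
  rw [Function.comp_apply, add_sub_cancel_left]
  linear_combination (-(ε : ℂ)) * hderiv

lemma analyticOrderNatAt_heckeG_eq_zero_iff (hn : 4 ∣ n) (hs : 1 ≤ s.re) :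
    analyticOrderNatAt (heckeG n) s = 0 ↔ heckeG n s ≠ 0 := by
  have hs' : 3 / 4 < s.re := by linarith
  rw [← (analyticOnNhd_heckeG n s hs').analyticOrderAt_eq_zero,
    ← Nat.cast_analyticOrderNatAt (analyticOrderAt_heckeG_ne_top hn hs'), Nat.cast_eq_zero]

lemma norm_primeSeries_le (n : ℤ) {σ : ℝ} (hσ : 1 < σ) (hs : σ ≤ s.re) :
    ‖primeSeries n s‖ ≤ ∑' q, logNorm q * Real.exp (-σ * logNorm q) := by
  refine tsum_of_norm_bounded (summable_logNorm_mul_exp hσ).hasSum fun q => ?_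
  rw [norm_mul, norm_ofReal_primeLog]
  exact mul_le_mul (primeLog_le q) (norm_heckeTerm_le n hs q) (norm_nonneg _) (logNorm_nonneg q)

lemma heckeG_ne_zero_of_one_lt (hn : 4 ∣ n) (hs : 1 < s.re) : heckeG n s ≠ 0 := by
  have hzero : Tendsto (fun ε : ℝ => (ε : ℂ) * primeSeries n (s + ε)) (𝓝[>] 0) (𝓝 0) := by
    refine tendsto_ofReal_nhdsGT_zero.zero_mul_isBoundedUnder_le
      (isBoundedUnder_of_eventually_le (a := ∑' q, logNorm q * Real.exp (-s.re * logNorm q)) ?_)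
    filter_upwards [self_mem_nhdsWithin] with ε hε
    refine norm_primeSeries_le n hs ?_
    rw [Complex.add_re, Complex.ofReal_re]
    linarith [mem_Ioi.1 hε]
  have hlim := tendsto_nhds_unique hzero (tendsto_mul_primeSeries hn hs.le)
  rw [if_neg fun h => sub_one_ne_zero_of_one_lt_re hs (sub_eq_zero.2 h.2)] at hlim
  rw [← analyticOrderNatAt_heckeG_eq_zero_iff hn hs.le]
  simpa using hlim

end Boundary

lemma angChar_add (n m : ℤ) (z : ℂ) : angChar (n + m) z = angChar n z * angChar m z := by
  rcases eq_or_ne z 0 with rfl | hz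
  · simp
  · rw [angChar_of_ne_zero hz, angChar_of_ne_zero hz, angChar_of_ne_zero hz,
      zpow_add₀ (norm_ne_zero_iff.1 (by rw [norm_div_norm hz]; exact one_ne_zero))]

lemma heckeTerm_add (n m : ℤ) (s t : ℂ) (ω : GaussianInt) :
    heckeTerm (n + m) (s + t) ω = heckeTerm n s ω * heckeTerm m t ω := by
  rw [heckeTerm, heckeTerm, heckeTerm, angChar_add, neg_add, add_mul, Complex.exp_add]
  ring

lemma three_add_four_mul_re_add_re_sq_nonneg {z : ℂ} (hz : ‖z‖ = 1) :
    0 ≤ 3 + 4 * z.re + (z * z).re := by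
  have hsq : z.re ^ 2 + z.im ^ 2 = 1 := by
    rw [← one_pow 2, ← hz, Complex.sq_norm, Complex.normSq_apply]
    ring
  rw [Complex.mul_re]
  nlinarith [sq_nonneg (1 + z.re)]

lemma three_four_one_heckeTerm (n : ℤ) (σ : ℝ) {w : ℂ} (hw : w.re = 0) (ω : GaussianInt) :
    0 ≤ 3 * (heckeTerm 0 σ ω).re + 4 * (heckeTerm n (σ + w) ω).re
      + (heckeTerm (n + n) (σ + (w + w)) ω).re := by
  rcases eq_or_ne ω 0 with rfl | hω
  · simp
  have hreal : heckeTerm 0 σ ω = (Real.exp (-σ * logNorm ω) : ℝ) := by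
    rw [heckeTerm, angChar_zero (by simpa using hω)]
    push_cast
    ring
  have hnorm : ‖heckeTerm n w ω‖ = 1 := by
    rw [norm_heckeTerm n w hω, hw, neg_zero, zero_mul, Real.exp_zero]
  have hmid : heckeTerm n (σ + w) ω = heckeTerm 0 σ ω * heckeTerm n w ω := by
    rw [← heckeTerm_add, zero_add]
  have hlast : heckeTerm (n + n) (σ + (w + w)) ω
      = heckeTerm 0 σ ω * (heckeTerm n w ω * heckeTerm n w ω) := by
    rw [← heckeTerm_add, ← heckeTerm_add, zero_add]
  rw [hmid, hlast, hreal, Complex.re_ofReal_mul, Complex.re_ofReal_mul, Complex.ofReal_re]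
  linarith [mul_nonneg (Real.exp_pos (-σ * logNorm ω)).le
    (three_add_four_mul_re_add_re_sq_nonneg hnorm)]

lemma three_four_one_primeSeries (n : ℤ) {σ : ℝ} (hσ : 1 < σ) {w : ℂ} (hw : w.re = 0) :
    0 ≤ 3 * (primeSeries 0 σ).re + 4 * (primeSeries n (σ + w)).re
      + (primeSeries (n + n) (σ + (w + w))).re := by
  have hasSum_re (m : ℤ) {s : ℂ} (hs : s.re = σ) :
      HasSum (fun q => primeLog q * (heckeTerm m s q).re) (primeSeries m s).re := by
    simpa only [primeSeries, Complex.re_ofReal_mul] using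
      Complex.hasSum_re (summable_primeSeries m (hs ▸ hσ)).hasSum
  refine ((((hasSum_re 0 (Complex.ofReal_re σ)).mul_left 3).add
    ((hasSum_re n (s := σ + w) (by simp [hw])).mul_left 4)).add
    (hasSum_re (n + n) (s := σ + (w + w)) (by simp [hw]))).nonneg fun q => ?_
  linarith [mul_nonneg (primeLog_nonneg q) (three_four_one_heckeTerm n σ hw q)]

lemma tendsto_mul_re_primeSeries {n : ℤ} (hn : 4 ∣ n) {s : ℂ} (hs : 1 ≤ s.re)
    (hpole : ¬ (n = 0 ∧ s = 1)) :
    Tendsto (fun ε : ℝ => ε * (primeSeries n (s + ε)).re) (𝓝[>] 0)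
      (𝓝 (-4 * analyticOrderNatAt (heckeG n) s)) := by
  have hlim := (Complex.continuous_re.tendsto _).comp (tendsto_mul_primeSeries hn hs)
  simpa [hpole, Function.comp_def] using hlim

lemma tendsto_mul_re_primeSeries_zero :
    Tendsto (fun ε : ℝ => ε * (primeSeries 0 (1 + ε)).re) (𝓝[>] 0) (𝓝 4) := by
  have horder : analyticOrderNatAt (heckeG 0) 1 = 0 :=
    (analyticOrderNatAt_heckeG_eq_zero_iff (dvd_zero 4) (by simp)).2
      (by simp [heckeG_zero_one])
  have hlim := (Complex.continuous_re.tendsto _).comp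
    (tendsto_mul_primeSeries (dvd_zero 4) (s := 1) (by simp))
  simpa [horder, Function.comp_def] using hlim

-- The limit of `ε` times the 3-4-1 inequality as `ε → 0⁺`.
lemma four_mul_analyticOrderNatAt_heckeG_le {n : ℤ} (hn : 4 ∣ n) {w : ℂ} (hw : w.re = 0)
    (hpole : ¬ (n = 0 ∧ w = 0)) : 4 * analyticOrderNatAt (heckeG n) (1 + w) ≤ 3 := by
  have hpole₁ : ¬ (n = 0 ∧ 1 + w = 1) := by simpa using hpole
  have hpole₂ : ¬ (n + n = 0 ∧ 1 + (w + w) = 1) := by simpa [← two_mul] using hpole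
  have hlim := ((tendsto_mul_re_primeSeries_zero.const_mul 3).add
    ((tendsto_mul_re_primeSeries hn (by simp [hw]) hpole₁).const_mul 4)).add
    (tendsto_mul_re_primeSeries (hn.add hn) (by simp [hw]) hpole₂)
  have hnonneg := ge_of_tendsto hlim (b := 0) (by
    filter_upwards [self_mem_nhdsWithin] with ε hε
    have hε0 : 0 < ε := hε
    have hineq := mul_nonneg hε0.le (three_four_one_primeSeries n (lt_add_of_pos_right 1 hε0) hw)
    have hcomm (z : ℂ) : 1 + (ε : ℂ) + z = 1 + z + ε := add_right_comm _ _ _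
    rw [Complex.ofReal_add, Complex.ofReal_one, hcomm, hcomm] at hineq
    linarith)
  have hreal : (4 * analyticOrderNatAt (heckeG n) (1 + w) : ℝ) ≤ 3 := by
    linarith [Nat.cast_nonneg (α := ℝ) (analyticOrderNatAt (heckeG (n + n)) (1 + (w + w)))]
  exact_mod_cast hreal

theorem heckeG_ne_zero {n : ℤ} (hn : 4 ∣ n) {s : ℂ} (hs : 1 ≤ s.re) : heckeG n s ≠ 0 := by
  rcases hs.lt_or_eq with hs1 | hs1
  · exact heckeG_ne_zero_of_one_lt hn hs1
  by_cases hpole : n = 0 ∧ s = 1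
  · rw [hpole.1, hpole.2, heckeG_zero_one]
    exact Complex.ofReal_ne_zero.2 Real.pi_ne_zero
  have horder := four_mul_analyticOrderNatAt_heckeG_le hn (w := s - 1) (by simp [← hs1])
    (by rwa [sub_eq_zero])
  rw [add_sub_cancel] at horder
  rw [← analyticOrderNatAt_heckeG_eq_zero_iff hn hs]
  lia

theorem exists_continuousOn_primeSeries (n : ℤ) :
    ∃ R : ℂ → ℂ, ContinuousOn R {s | 1 ≤ s.re} ∧
      ∀ s : ℂ, 1 < s.re → primeSeries n s = 4 * poleOrder n / (s - 1) + R s := by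
  by_cases hn : 4 ∣ n
  swap
  · refine ⟨fun _ => 0, continuousOn_const, fun s _ => ?_⟩
    have hn0 : n ≠ 0 := by
      rintro rfl
      exact hn (dvd_zero 4)
    simp [primeSeries_eq_zero hn, poleOrder, hn0]
  have hG : AnalyticOnNhd ℂ (heckeG n) {s | 1 ≤ s.re} := fun s hs =>
    analyticOnNhd_heckeG n s ((by norm_num : (3 / 4 : ℝ) < 1).trans_le hs)
  refine ⟨fun s => -(4 * logDeriv (heckeG n) s) - primePowerSeries n s, ?_, fun s hs => ?_⟩
  · exact ((hG.deriv.continuousOn.div hG.continuousOn fun s hs =>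
      heckeG_ne_zero hn hs).const_mul 4).neg.sub (continuousOn_primePowerSeries n)
  · simp only [logDeriv_apply, ← mul_div_assoc, four_mul_deriv_heckeG n hs,
      mul_div_cancel_left₀ _ (heckeG_ne_zero hn hs.le)]
    ring

/-! ### Weyl sums over Gaussian primes -/

lemma primeLog_zero : primeLog 0 = 0 := primeLog_of_not_prime not_prime_zero

lemma primeSeries_zero (s : ℂ) :
    primeSeries 0 s = ∑' q, (primeLog q : ℂ) * Complex.exp (-s * logNorm q) := by
  refine tsum_congr fun q => ?_
  rcases eq_or_ne q 0 with rfl | hq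
  · simp [primeLog_zero]
  · rw [heckeTerm, angChar_zero (by simpa using hq), one_mul]

lemma exists_continuousOn_tsum_primeLog :
    ∃ R : ℂ → ℂ, ContinuousOn R {s | 1 ≤ s.re} ∧ ∀ s : ℂ, 1 < s.re →
      ∑' q, (primeLog q : ℂ) * Complex.exp (-s * logNorm q) = (4 : ℝ) / (s - 1) + R s := by
  obtain ⟨R, hR, heq⟩ := exists_continuousOn_primeSeries 0
  refine ⟨R, hR, fun s hs => ?_⟩
  rw [← primeSeries_zero, heq s hs]
  simp [poleOrder]

lemma summable_primeLog_mul_exp {σ : ℝ} (hσ : 1 < σ) :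
    Summable fun q => primeLog q * Real.exp (-σ * logNorm q) :=
  (summable_logNorm_mul_exp hσ).of_nonneg_of_le
    (fun q => mul_nonneg (primeLog_nonneg q) (Real.exp_pos _).le)
    fun q => mul_le_mul_of_nonneg_right (primeLog_le q) (Real.exp_pos _).le

lemma summatory_logNorm_log {E : Type*} [AddCommMonoid E] [TopologicalSpace E]
    {w : GaussianInt → E} (hw : w 0 = 0) {x : ℝ} (hx : 0 < x) :
    summatory w logNorm (Real.log x) = ∑ ω ∈ (ball_finite x).toFinset, w ω := by
  rw [summatory_logNorm hw, Real.exp_log hx]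

-- Each of the four associates of a prime is counted, whence the limit `4`.
theorem tendsto_sum_primeLog :
    Tendsto (fun x => (∑ q ∈ (ball_finite x).toFinset, primeLog q) / x) atTop (𝓝 4) := by
  obtain ⟨R, hR, heq⟩ := exists_continuousOn_tsum_primeLog
  have hlim := tendsto_summatory_mul_exp_neg primeLog_nonneg logNorm_nonneg
    (fun σ hσ => summable_primeLog_mul_exp hσ) four_pos hR heq
  refine (hlim.comp Real.tendsto_log_atTop).congr' ?_
  filter_upwards [eventually_gt_atTop 0] with x hx
  rw [Function.comp_apply, summatory_logNorm_log primeLog_zero hx, Real.exp_neg,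
    Real.exp_log hx, div_eq_mul_inv]

theorem tendsto_sum_primeLog_mul_angChar {n : ℤ} (hn : n ≠ 0) :
    Tendsto (fun x : ℝ => (∑ q ∈ (ball_finite x).toFinset,
      (primeLog q : ℂ) * angChar n (GaussianInt.toComplex q)) / x) atTop (𝓝 0) := by
  obtain ⟨R, hR, heq⟩ := exists_continuousOn_tsum_primeLog
  obtain ⟨R₁, hR₁, heq₁⟩ := exists_continuousOn_primeSeries n
  set w : GaussianInt → ℂ := fun q => primeLog q * angChar n (GaussianInt.toComplex q)
  have hwv (q : GaussianInt) : ‖w q‖ ≤ primeLog q := by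
    rw [norm_mul, norm_ofReal_primeLog]
    exact mul_le_of_le_one_right (primeLog_nonneg q) (norm_angChar_le n _)
  have heqw (s : ℂ) (hs : 1 < s.re) : ∑' q, w q * Complex.exp (-s * logNorm q) = R₁ s := by
    simpa [w, primeSeries, heckeTerm, mul_assoc, poleOrder, hn] using heq₁ s hs
  have hlim := tendsto_summatory_mul_exp_neg_zero hwv logNorm_nonneg
    (fun σ hσ => summable_primeLog_mul_exp hσ) four_pos hR heq hR₁ heqw
  refine (hlim.comp Real.tendsto_log_atTop).congr' ?_
  filter_upwards [eventually_gt_atTop 0] with x hx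
  rw [Function.comp_apply, summatory_logNorm_log (by simp [w]) hx, Complex.exp_neg,
    ← Complex.ofReal_exp, Real.exp_log hx, div_eq_mul_inv]

/-! ### Equidistribution on the circle -/

section Circle

variable {T : ℝ} [hT : Fact (0 < T)]

lemma integral_fourier_haarAddCircle (n : ℤ) :
    ∫ t : AddCircle T, fourier n t ∂AddCircle.haarAddCircle = if n = 0 then 1 else 0 := by
  have hcoeff := congrFun (fourierCoeff_fourier (T := T) n) 0
  rw [fourierCoeff, Pi.single_apply] at hcoeff
  simpa [eq_comm] using hcoeff

lemma integrable_addCircle (μ : Measure (AddCircle T)) [IsFiniteMeasure μ]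
    (f : C(AddCircle T, ℂ)) : Integrable f μ :=
  f.continuous.integrable_of_hasCompactSupport (HasCompactSupport.of_compactSpace f)

variable {ι : Type*} {L : Filter ι}

lemma tendsto_integral_of_mem_span_fourier {μs : ι → ProbabilityMeasure (AddCircle T)}
    {μ : ProbabilityMeasure (AddCircle T)}
    (h : ∀ n : ℤ, Tendsto (fun i => ∫ t, fourier n t ∂(μs i : Measure (AddCircle T))) L
      (𝓝 (∫ t, fourier n t ∂(μ : Measure (AddCircle T)))))
    {f : C(AddCircle T, ℂ)} (hf : f ∈ Submodule.span ℂ (range (@fourier T))) :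
    Tendsto (fun i => ∫ t, f t ∂(μs i : Measure (AddCircle T))) L
      (𝓝 (∫ t, f t ∂(μ : Measure (AddCircle T)))) := by
  induction hf using Submodule.span_induction with
  | mem f hf =>
    obtain ⟨n, rfl⟩ := hf
    exact h n
  | zero => simpa using tendsto_const_nhds
  | add f g _ _ hf hg =>
    simp only [ContinuousMap.add_apply,
      integral_add (integrable_addCircle _ f) (integrable_addCircle _ g)]
    exact hf.add hg
  | smul a f _ hf =>
    simp only [ContinuousMap.smul_apply, integral_smul]
    exact hf.const_smul a

theorem tendsto_of_tendsto_integral_fourier {μs : ι → ProbabilityMeasure (AddCircle T)}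
    {μ : ProbabilityMeasure (AddCircle T)}
    (h : ∀ n : ℤ, Tendsto (fun i => ∫ t, fourier n t ∂(μs i : Measure (AddCircle T))) L
      (𝓝 (∫ t, fourier n t ∂(μ : Measure (AddCircle T))))) :
    Tendsto μs L (𝓝 μ) := by
  refine ProbabilityMeasure.tendsto_of_tight_of_separatesPoints ℂ .of_compactSpace
    (A := fourierSubalgebra.comap (BoundedContinuousFunction.toContinuousMapStarₐ ℂ))
    (fun x y hxy => ?_) fun g hg => ?_
  · obtain ⟨_, ⟨f, hf, rfl⟩, hfxy⟩ := fourierSubalgebra_separatesPoints hxy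
    exact ⟨f, ⟨f, ⟨BoundedContinuousFunction.mkOfCompact f, hf, rfl⟩, rfl⟩, hfxy⟩
  · refine tendsto_integral_of_mem_span_fourier h (f := g.toContinuousMap) ?_
    rw [← fourierSubalgebra_coe]
    exact hg

lemma integral_normalize {Ω E : Type*} [MeasurableSpace Ω] [Nonempty Ω] [NormedAddCommGroup E]
    [NormedSpace ℝ E] {μ : FiniteMeasure Ω} (hμ : μ ≠ 0) (f : Ω → E) :
    ∫ ω, f ω ∂(μ.normalize : Measure Ω) = (μ.mass : ℝ)⁻¹ • ∫ ω, f ω ∂(μ : Measure Ω) := by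
  rw [← FiniteMeasure.average_eq_integral_normalize μ hμ, average_eq]
  rfl

theorem tendsto_measureReal_of_tendsto_integral_fourier
    {μs : ι → FiniteMeasure (AddCircle T)} {μ : ProbabilityMeasure (AddCircle T)}
    (h : ∀ n : ℤ, Tendsto (fun i => ∫ t, fourier n t ∂(μs i : Measure (AddCircle T))) L
      (𝓝 (∫ t, fourier n t ∂(μ : Measure (AddCircle T)))))
    {s : Set (AddCircle T)} (hs : (μ : Measure (AddCircle T)) (frontier s) = 0) :
    Tendsto (fun i => (μs i : Measure (AddCircle T)).real s) L
      (𝓝 ((μ : Measure (AddCircle T)).real s)) := by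
  have hmass : Tendsto (fun i => ((μs i).mass : ℝ)) L (𝓝 1) := by
    have hre := (Complex.continuous_re.tendsto _).comp (h 0)
    simpa [Function.comp_def, fourier_zero] using hre
  have hne : ∀ᶠ i in L, μs i ≠ 0 := by
    filter_upwards [hmass.eventually_ne one_ne_zero] with i hi hzero
    simp [hzero] at hi
  have hweak : Tendsto (fun i => (μs i).normalize) L (𝓝 μ) := by
    refine tendsto_of_tendsto_integral_fourier fun n => ?_
    have hlim := (hmass.inv₀ one_ne_zero).smul (h n)
    rw [inv_one, one_smul] at hlim
    refine hlim.congr' ?_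
    filter_upwards [hne] with i hi using (integral_normalize hi _).symm
  have hset := (NNReal.continuous_coe.tendsto _).comp
    (ProbabilityMeasure.tendsto_measure_of_null_frontier_of_tendsto hweak (E := s)
      ((ProbabilityMeasure.null_iff_toMeasure_null _ _).2 hs))
  have hlim := hmass.mul hset
  rw [one_mul] at hlim
  refine hlim.congr fun i => ?_
  rw [Function.comp_apply, ← NNReal.coe_mul, ← FiniteMeasure.self_eq_mass_mul_normalize]
  rfl

end Circle

/-! ### Arcs -/

/-- The arc `[α, β)` on the circle `ℝ / Tℤ`. -/
def arc (T α β : ℝ) : Set (AddCircle T) := (fun x : ℝ => (x : AddCircle T)) '' Ico α β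

lemma frontier_arc_subset (T α β : ℝ) :
    frontier (arc T α β) ⊆ {(α : AddCircle T), (β : AddCircle T)} := by
  have hclosed : closure (arc T α β) ⊆ (fun x : ℝ => (x : AddCircle T)) '' Icc α β :=
    closure_minimal (image_mono Ico_subset_Icc_self)
      (isCompact_Icc.image (AddCircle.continuous_mk' _)).isClosed
  have hopen : (fun x : ℝ => (x : AddCircle T)) '' Ioo α β ⊆ interior (arc T α β) :=
    interior_maximal (image_mono Ioo_subset_Ico_self)
      (QuotientAddGroup.isOpenMap_coe _ isOpen_Ioo)
  rintro z ⟨hz_closure, hz_interior⟩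
  obtain ⟨x, hx, rfl⟩ := hclosed hz_closure
  rcases hx.1.eq_or_lt with rfl | hαx
  · exact Or.inl rfl
  rcases hx.2.eq_or_lt with rfl | hxβ
  · exact Or.inr rfl
  exact absurd (hopen ⟨x, ⟨hαx, hxβ⟩, rfl⟩) hz_interior

lemma measurableSet_arc (T α β : ℝ) : MeasurableSet (arc T α β) := by
  rcases le_or_gt β α with h | h
  · simp [arc, Ico_eq_empty_of_le h]
  · rw [arc, ← Ioo_union_left h, image_union, image_singleton]
    exact (QuotientAddGroup.isOpenMap_coe _ isOpen_Ioo).measurableSet.union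
      (measurableSet_singleton _)

section Arc

variable {T : ℝ} [hT : Fact (0 < T)]

lemma coe_mem_arc_iff {a α β x : ℝ} (hα : a ≤ α) (hβ : β ≤ a + T) (hx : x ∈ Ico a (a + T)) :
    (x : AddCircle T) ∈ arc T α β ↔ x ∈ Ico α β := by
  refine ⟨?_, fun h => ⟨x, h, rfl⟩⟩
  rintro ⟨y, hy, hyx⟩
  have heq : y = x :=
    (AddCircle.coe_eq_coe_iff_of_mem_Ico ⟨hα.trans hy.1, hy.2.trans_le hβ⟩ hx).1 hyx
  exact heq ▸ hy

lemma volume_singleton_addCircle (z : AddCircle T) : volume {z} = 0 := by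
  rw [← Metric.closedBall_zero, AddCircle.volume_closedBall]
  simp [hT.out.le]

lemma volume_eq_zero_iff_haarAddCircle {s : Set (AddCircle T)} :
    volume s = 0 ↔ AddCircle.haarAddCircle s = 0 := by
  simp [AddCircle.volume_eq_smul_haarAddCircle, hT.out]

lemma haarAddCircle_frontier_arc (α β : ℝ) :
    AddCircle.haarAddCircle (frontier (arc T α β)) = 0 := by
  refine volume_eq_zero_iff_haarAddCircle.1 (measure_mono_null (frontier_arc_subset T α β) ?_)
  rw [← union_singleton]
  exact measure_union_null (volume_singleton_addCircle _) (volume_singleton_addCircle _)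

lemma volume_real_arc {α β : ℝ} (hαβ : α ≤ β) (hβ : β ≤ α + T) :
    (volume : Measure (AddCircle T)).real (arc T α β) = β - α := by
  have hpreimage : (QuotientAddGroup.mk ⁻¹' arc T α β ∩ Ioo α (α + T) : Set ℝ) = Ioo α β := by
    ext x
    refine ⟨fun ⟨hx, hxT⟩ =>
      ⟨hxT.1, ((coe_mem_arc_iff le_rfl hβ (Ioo_subset_Ico_self hxT)).1 hx).2⟩, fun hx => ?_⟩
    exact ⟨⟨x, Ioo_subset_Ico_self hx, rfl⟩, hx.1, hx.2.trans_le hβ⟩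
  rw [Measure.real, ← (AddCircle.measurePreserving_mk T α).measure_preimage
    (measurableSet_arc _ α β).nullMeasurableSet, ← restrict_Ioo_eq_restrict_Ioc,
    Measure.restrict_apply' measurableSet_Ioo, hpreimage, Real.volume_Ioo,
    ENNReal.toReal_ofReal (sub_nonneg.2 hαβ)]

lemma haarAddCircle_real_arc {α β : ℝ} (hαβ : α ≤ β) (hβ : β ≤ α + T) :
    AddCircle.haarAddCircle.real (arc T α β) = (β - α) / T := by
  rw [← volume_real_arc hαβ hβ, AddCircle.volume_eq_smul_haarAddCircle,
    measureReal_ennreal_smul_apply, ENNReal.toReal_ofReal hT.out.le,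
    mul_div_cancel_left₀ _ hT.out.ne']

end Arc

/-! ### Gaussian primes in sectors -/

instance factTwoPiPos : Fact (0 < 2 * Real.pi) := ⟨Real.two_pi_pos⟩

/-- The distribution of the arguments of the Gaussian primes of norm at most `x`, with logarithmic
weights, normalized to have total mass tending to `1`. -/
def argMeasure (x : ℝ) : FiniteMeasure (AddCircle (2 * Real.pi)) :=
  ∑ q ∈ (ball_finite x).toFinset, (primeLog q / (4 * x)).toNNReal •
    (diracProba (arg q : AddCircle (2 * Real.pi))).toFiniteMeasure

lemma integral_argMeasure {E : Type*} [NormedAddCommGroup E] [NormedSpace ℝ E] [CompleteSpace E]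
    (f : AddCircle (2 * Real.pi) → E) {x : ℝ} (hx : 0 < x) :
    ∫ t, f t ∂(argMeasure x : Measure (AddCircle (2 * Real.pi)))
      = ∑ q ∈ (ball_finite x).toFinset, (primeLog q / (4 * x)) • f (arg q) := by
  rw [argMeasure, FiniteMeasure.toMeasure_sum, integral_finsetSum_measure]
  · refine Finset.sum_congr rfl fun q _ => ?_
    rw [FiniteMeasure.toMeasure_smul, integral_smul_nnreal_measure]
    change (primeLog q / (4 * x)).toNNReal • ∫ t, f t ∂(Measure.dirac _) = _
    rw [integral_dirac, NNReal.smul_def, Real.coe_toNNReal _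
      (div_nonneg (primeLog_nonneg q) (by positivity))]
  · intro q _
    rw [FiniteMeasure.toMeasure_smul]
    exact Integrable.smul_measure_nnreal (integrable_dirac (by finiteness))

lemma fourier_arg {q : GaussianInt} (hq : q ≠ 0) (n : ℤ) :
    fourier n (arg q : AddCircle (2 * Real.pi)) = angChar n (GaussianInt.toComplex q) := by
  set z := GaussianInt.toComplex q with hzdef
  have hz : z ≠ 0 := by simpa [hzdef] using hq
  have hcoe : (arg q : AddCircle (2 * Real.pi)) = (Complex.arg z : AddCircle (2 * Real.pi)) :=
    Real.Angle.coe_toIcoMod _ _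
  have hunit : z / ‖z‖ = Complex.exp (Complex.arg z * Complex.I) := by
    rw [div_eq_iff (Complex.ofReal_ne_zero.2 (norm_ne_zero_iff.2 hz)), mul_comm,
      Complex.norm_mul_exp_arg_mul_I]
  have hpi : (Real.pi : ℂ) ≠ 0 := Complex.ofReal_ne_zero.2 Real.pi_ne_zero
  rw [hcoe, fourier_coe_apply, angChar_of_ne_zero hz, hunit, ← Complex.exp_int_mul]
  congr 1
  push_cast
  field_simp

lemma integral_fourier_argMeasure (n : ℤ) {x : ℝ} (hx : 0 < x) :
    ∫ t, fourier n t ∂(argMeasure x : Measure (AddCircle (2 * Real.pi)))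
      = (∑ q ∈ (ball_finite x).toFinset,
        (primeLog q : ℂ) * angChar n (GaussianInt.toComplex q)) / x / 4 := by
  rw [integral_argMeasure _ hx, div_div, Finset.sum_div]
  refine Finset.sum_congr rfl fun q _ => ?_
  rcases eq_or_ne q 0 with rfl | hq
  · simp [primeLog_zero]
  · rw [fourier_arg hq, Complex.real_smul]
    push_cast
    ring

lemma sum_primeLog_mul_angChar_zero (x : ℝ) :
    ∑ q ∈ (ball_finite x).toFinset, (primeLog q : ℂ) * angChar 0 (GaussianInt.toComplex q)
      = (∑ q ∈ (ball_finite x).toFinset, primeLog q : ℝ) := by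
  rw [Complex.ofReal_sum]
  refine Finset.sum_congr rfl fun q _ => ?_
  rcases eq_or_ne q 0 with rfl | hq
  · simp [primeLog_zero]
  · rw [angChar_zero (by simpa using hq), mul_one]

lemma tendsto_integral_fourier_argMeasure (n : ℤ) :
    Tendsto (fun x => ∫ t, fourier n t ∂(argMeasure x : Measure (AddCircle (2 * Real.pi)))) atTop
      (𝓝 (∫ t : AddCircle (2 * Real.pi), fourier n t ∂AddCircle.haarAddCircle)) := by
  rw [integral_fourier_haarAddCircle]
  refine Tendsto.congr' (f₁ := fun x : ℝ => (∑ q ∈ (ball_finite x).toFinset,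
    (primeLog q : ℂ) * angChar n (GaussianInt.toComplex q)) / x / 4) ?_ ?_
  · filter_upwards [eventually_gt_atTop 0] with x hx using (integral_fourier_argMeasure n hx).symm
  split_ifs with hn
  · subst hn
    simp_rw [sum_primeLog_mul_angChar_zero]
    simpa [Function.comp_def] using
      ((Complex.continuous_ofReal.tendsto _).comp tendsto_sum_primeLog).div_const 4
  · simpa using (tendsto_sum_primeLog_mul_angChar hn).div_const 4

lemma arg_mem_Ico (q : GaussianInt) : arg q ∈ Ico 0 (0 + 2 * Real.pi) :=
  toIcoMod_mem_Ico Real.two_pi_pos 0 (Complex.arg (GaussianInt.toComplex q))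

lemma measureReal_argMeasure_arc {α β : ℝ} (hα : 0 ≤ α) (hβ : β ≤ 2 * Real.pi) {x : ℝ}
    (hx : 0 < x) :
    (argMeasure x : Measure (AddCircle (2 * Real.pi))).real (arc (2 * Real.pi) α β)
      = (∑ q ∈ (ball_finite x).toFinset, indicator (arg ⁻¹' Ico α β) primeLog q) / x / 4 := by
  rw [← integral_indicator_one (measurableSet_arc _ α β), integral_argMeasure _ hx, div_div,
    Finset.sum_div]
  refine Finset.sum_congr rfl fun q _ => ?_
  have hiff : (arg q : AddCircle (2 * Real.pi)) ∈ arc (2 * Real.pi) α β ↔ q ∈ arg ⁻¹' Ico α β :=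
    coe_mem_arc_iff hα (by rwa [zero_add]) (arg_mem_Ico q)
  by_cases hq : q ∈ arg ⁻¹' Ico α β
  · rw [indicator_of_mem (hiff.2 hq), indicator_of_mem hq, Pi.one_apply, smul_eq_mul, mul_one,
      mul_comm x]
  · rw [indicator_of_notMem fun h => hq (hiff.1 h), indicator_of_notMem hq, smul_zero, zero_div]

theorem tendsto_sum_primeLog_sector {α β : ℝ} (hα : 0 ≤ α) (hαβ : α ≤ β)
    (hβ : β ≤ 2 * Real.pi) :
    Tendsto (fun x => (∑ q ∈ (ball_finite x).toFinset,
      indicator (arg ⁻¹' Ico α β) primeLog q) / x) atTop (𝓝 (2 / Real.pi * (β - α))) := by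
  have hlim := (tendsto_measureReal_of_tendsto_integral_fourier
    (μ := ⟨AddCircle.haarAddCircle, inferInstance⟩) tendsto_integral_fourier_argMeasure
    (haarAddCircle_frontier_arc α β)).const_mul 4
  have hvalue : 4 * AddCircle.haarAddCircle.real (arc (2 * Real.pi) α β)
      = 2 / Real.pi * (β - α) := by
    rw [haarAddCircle_real_arc hαβ (by linarith)]
    ring
  rw [ProbabilityMeasure.coe_mk, hvalue] at hlim
  refine hlim.congr' ?_
  filter_upwards [eventually_gt_atTop 0] with x hx
  rw [measureReal_argMeasure_arc hα hβ hx, mul_div_cancel₀ _ four_ne_zero]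

/-! ### From logarithmic weights to counting -/

section Count

variable {ι : Type*} {N : ι → ℝ}

lemma sum_log_le_card_mul_log {s : Finset ι} {x : ℝ} (hpos : ∀ i ∈ s, 0 < N i)
    (hle : ∀ i ∈ s, N i ≤ x) : ∑ i ∈ s, Real.log (N i) ≤ s.card * Real.log x := by
  rw [← nsmul_eq_mul]
  exact Finset.sum_le_card_nsmul _ _ _ fun i hi => Real.log_le_log (hpos i hi) (hle i hi)

lemma card_filter_lt_mul_log_le {s : Finset ι} {y : ℝ} (hone : ∀ i ∈ s, 1 ≤ N i) (hy : 0 < y) :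
    ({i ∈ s | y < N i}.card : ℝ) * Real.log y ≤ ∑ i ∈ s, Real.log (N i) := by
  rw [← nsmul_eq_mul]
  refine (Finset.card_nsmul_le_sum _ (fun i => Real.log (N i)) _ fun i hi =>
    Real.log_le_log hy (Finset.mem_filter.1 hi).2.le).trans ?_
  exact Finset.sum_le_sum_of_subset_of_nonneg (Finset.filter_subset _ _)
    fun i hi _ => Real.log_nonneg (hone i hi)

lemma exists_div_one_sub_lt {b c : ℝ} (hcb : c < b) : ∃ δ ∈ Ioo (0 : ℝ) 1, c / (1 - δ) < b := by
  have hcont : ContinuousAt (fun δ : ℝ => c / (1 - δ)) 0 :=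
    ContinuousAt.div (by fun_prop) (by fun_prop) (by norm_num)
  have hlt : ∀ᶠ δ in 𝓝[>] (0 : ℝ), c / (1 - δ) < b :=
    (hcont.tendsto.mono_left nhdsWithin_le_nhds).eventually_lt_const (by simpa using hcb)
  obtain ⟨δ, hδ, hδ_mem⟩ := (hlt.and (Ioo_mem_nhdsGT one_pos)).exists
  exact ⟨δ, hδ_mem, hδ⟩

variable {A : Set ι} {S : ℝ → Finset ι}

lemma card_mul_log_le (hS : ∀ x i, i ∈ S x ↔ i ∈ A ∧ N i ≤ x) (hA : ∀ i ∈ A, 1 ≤ N i)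
    {δ x : ℝ} (hδ : δ < 1) (hx : 1 ≤ x) :
    ((S x).card : ℝ) * Real.log x
      ≤ (∑ i ∈ S x, Real.log (N i)) / (1 - δ) + (S (x ^ (1 - δ))).card * Real.log x := by
  have hx0 : 0 < x := by linarith
  set y := x ^ (1 - δ) with hy
  have hlarge : ({i ∈ S x | y < N i}.card : ℝ) * Real.log x
      ≤ (∑ i ∈ S x, Real.log (N i)) / (1 - δ) := by
    have hsum := card_filter_lt_mul_log_le (s := S x) (y := y)
      (fun i hi => hA i ((hS x i).1 hi).1) (Real.rpow_pos_of_pos hx0 _)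
    rw [hy, Real.log_rpow hx0, ← hy] at hsum
    rw [le_div_iff₀ (by linarith)]
    linarith
  have hsmall : ({i ∈ S x | ¬ y < N i}.card : ℝ) ≤ (S y).card := by
    refine Nat.cast_le.2 (Finset.card_le_card fun i hi => ?_)
    obtain ⟨hix, hiy⟩ := Finset.mem_filter.1 hi
    exact (hS y i).2 ⟨((hS x i).1 hix).1, not_lt.1 hiy⟩
  have hsplit : ((S x).card : ℝ)
      = {i ∈ S x | y < N i}.card + {i ∈ S x | ¬ y < N i}.card := by
    rw [← Nat.cast_add, Finset.card_filter_add_card_filter_not]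
  rw [hsplit, add_mul]
  exact add_le_add hlarge (mul_le_mul_of_nonneg_right hsmall (Real.log_nonneg hx))

/-- Elements of size at most `x ^ (1 - δ)` are negligible in number, and for all others
`log (N i)` lies between `(1 - δ) * log x` and `log x`. -/
theorem tendsto_card_mul_log_div (hS : ∀ x i, i ∈ S x ↔ i ∈ A ∧ N i ≤ x)
    (hA : ∀ i ∈ A, 1 ≤ N i) {C : ℝ} (hC : ∀ x, 1 ≤ x → ((S x).card : ℝ) ≤ C * x) {c : ℝ}
    (h : Tendsto (fun x => (∑ i ∈ S x, Real.log (N i)) / x) atTop (𝓝 c)) :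
    Tendsto (fun x => ((S x).card : ℝ) * Real.log x / x) atTop (𝓝 c) := by
  refine tendsto_order.2 ⟨fun a ha => ?_, fun b hb => ?_⟩
  · filter_upwards [h.eventually_const_lt ha, eventually_ge_atTop 1] with x hax hx
    refine hax.trans_le (div_le_div_of_nonneg_right (sum_log_le_card_mul_log
      (fun i hi => ?_) fun i hi => ((hS x i).1 hi).2) (by linarith))
    exact one_pos.trans_le (hA i ((hS x i).1 hi).1)
  obtain ⟨δ, ⟨hδ_pos, hδ_lt⟩, hδ⟩ := exists_div_one_sub_lt hb
  have hlogpow : Tendsto (fun x : ℝ => Real.log x / x ^ δ) atTop (𝓝 0) :=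
    (isLittleO_log_rpow_atTop hδ_pos).tendsto_div_nhds_zero
  have hlim := (h.div_const (1 - δ)).add (hlogpow.const_mul C)
  rw [mul_zero, add_zero] at hlim
  filter_upwards [hlim.eventually_lt_const hδ, eventually_ge_atTop 1] with x hbx hx
  have hx0 : 0 < x := by linarith
  calc ((S x).card : ℝ) * Real.log x / x
      ≤ ((∑ i ∈ S x, Real.log (N i)) / (1 - δ) + C * x ^ (1 - δ) * Real.log x) / x := by
        have hlog := Real.log_nonneg hx
        have hcard := hC _ (Real.one_le_rpow hx (by linarith : 0 ≤ 1 - δ))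
        refine div_le_div_of_nonneg_right ((card_mul_log_le hS hA hδ_lt hx).trans ?_) hx0.le
        gcongr
    _ = (∑ i ∈ S x, Real.log (N i)) / x / (1 - δ) + C * (Real.log x / x ^ δ) := by
        have hpow := (Real.rpow_pos_of_pos hx0 δ).ne'
        rw [add_div, div_right_comm, Real.rpow_sub hx0, Real.rpow_one]
        field_simp
    _ < b := hbx

end Count

lemma sum_angChar_zero_ball {x : ℝ} (hx : 0 ≤ x) :
    ∑ ω ∈ (ball_finite x).toFinset, angChar 0 (GaussianInt.toComplex ω)
      = ((ball_finite x).toFinset.card : ℂ) - 1 := by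
  have hzero : (0 : GaussianInt) ∈ (ball_finite x).toFinset := by
    rw [Set.Finite.mem_toFinset]
    simpa [ball] using hx
  rw [← Finset.sum_erase_add _ _ hzero, map_zero, angChar_apply_zero, add_zero,
    Finset.sum_congr rfl fun ω hω =>
      angChar_zero (GaussianInt.toComplex_eq_zero.not.2 (Finset.ne_of_mem_erase hω)),
    Finset.sum_const, Finset.card_erase_of_mem hzero, nsmul_one,
    Nat.cast_sub (Finset.card_pos.2 ⟨0, hzero⟩), Nat.cast_one]

lemma sqrt_mul_sqrt_sqrt_le {x : ℝ} (hx : 1 ≤ x) : √x * √(√x) ≤ x := by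
  have hroot : √(√x) ≤ √x := Real.sqrt_le_sqrt (Real.sqrt_le_self_iff.2 (Or.inr hx))
  calc √x * √(√x) ≤ √x * √x := mul_le_mul_of_nonneg_left hroot (Real.sqrt_nonneg x)
    _ = x := Real.mul_self_sqrt (by linarith)

lemma exists_card_ball_le :
    ∃ C : ℝ, ∀ x : ℝ, 1 ≤ x → ((ball_finite x).toFinset.card : ℝ) ≤ C * x := by
  obtain ⟨C, hC⟩ := norm_sum_angChar_sub_le 0
  refine ⟨|C| + Real.pi + 1, fun x hx => ?_⟩
  have hx0 : 0 ≤ x := by linarith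
  have herror := hC (√x) (Real.one_le_sqrt.2 hx)
  simp only [Real.sq_sqrt hx0, if_true, sum_angChar_zero_ball hx0] at herror
  set k := (ball_finite x).toFinset.card
  have hre : ((k : ℂ) - 1 - ((Real.pi * x : ℝ) : ℂ)).re = k - 1 - Real.pi * x := by simp
  have hk : (k : ℝ) - 1 - Real.pi * x ≤ C * (√x * √(√x)) :=
    hre ▸ (Complex.re_le_norm _).trans herror
  have hbound : C * (√x * √(√x)) ≤ |C| * x :=
    mul_le_mul (le_abs_self C) (sqrt_mul_sqrt_sqrt_le hx) (by positivity) (abs_nonneg C)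
  linarith

/-- The finite set of Gaussian primes in `P` of norm at most `x`. -/
def primesIn (P : Set GaussianInt) (x : ℝ) : Finset GaussianInt :=
  ((ball_finite x).inter_of_right (primes ∩ P)).toFinset

section PrimesIn

variable {P : Set GaussianInt} {x : ℝ} {q : GaussianInt}

lemma mem_primesIn : q ∈ primesIn P x ↔ q ∈ primes ∩ P ∧ ((Zsqrtd.norm q : ℤ) : ℝ) ≤ x :=
  Set.Finite.mem_toFinset _

lemma primesIn_subset : primesIn P x ⊆ (ball_finite x).toFinset := fun _ hq =>
  (Set.Finite.mem_toFinset _).2 (mem_primesIn.1 hq).2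

lemma sum_primesIn_logNorm :
    ∑ q ∈ primesIn P x, logNorm q
      = ∑ q ∈ (ball_finite x).toFinset, indicator P primeLog q := by
  classical
  refine Finset.sum_subset_zero_on_sdiff primesIn_subset (fun q hq => ?_) fun q hq => ?_
  · obtain ⟨hq_ball, hq_notMem⟩ := Finset.mem_sdiff.1 hq
    by_cases hP : q ∈ P
    · rw [indicator_of_mem hP, primeLog_of_not_prime]
      exact fun hprime => hq_notMem (mem_primesIn.2
        ⟨⟨hprime, hP⟩, (Set.Finite.mem_toFinset (ball_finite x)).1 hq_ball⟩)
    · exact indicator_of_notMem hP _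
  · obtain ⟨⟨hprime, hP⟩, -⟩ := mem_primesIn.1 hq
    rw [indicator_of_mem hP, primeLog_of_prime hprime]

lemma sectorPrimeCount_eq_card_primesIn (α β x : ℝ) :
    sectorPrimeCount α β x = (primesIn (arg ⁻¹' Ico α β) x).card := by
  rw [sectorPrimeCount, ← Set.ncard_coe_finset]
  congr 1
  ext q
  simp only [mem_ofPred_eq, Finset.mem_coe, mem_primesIn, mem_inter_iff, mem_preimage, mem_Ico,
    ball]
  tauto

end PrimesIn

lemma tendsto_sectorPrimeCount_mul_log_div {α β : ℝ} (hα : 0 ≤ α) (hαβ : α ≤ β)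
    (hβ : β ≤ 2 * Real.pi) :
    Tendsto (fun x => (sectorPrimeCount α β x : ℝ) * Real.log x / x) atTop
      (𝓝 (2 / Real.pi * (β - α))) := by
  obtain ⟨C, hC⟩ := exists_card_ball_le
  have hweighted := tendsto_sum_primeLog_sector hα hαβ hβ
  simp only [← sum_primesIn_logNorm] at hweighted
  simp only [sectorPrimeCount_eq_card_primesIn]
  refine tendsto_card_mul_log_div (fun _ _ => mem_primesIn)
    (fun q hq => one_le_norm (Prime.ne_zero hq.1)) (C := C) (fun x hx => ?_) hweighted
  exact (Nat.cast_le.2 (Finset.card_le_card primesIn_subset)).trans (hC x hx)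

theorem sectorPrimeCount_isEquivalent {α β : ℝ} (hα : 0 ≤ α) (hαβ : α < β)
    (hβ : β ≤ 2 * Real.pi) :
    Asymptotics.IsEquivalent atTop (fun x : ℝ => (sectorPrimeCount α β x : ℝ))
      (fun x : ℝ => 2 / Real.pi * (β - α) * (x / Real.log x)) := by
  have hc : 0 < 2 / Real.pi * (β - α) := mul_pos (by positivity) (by linarith)
  have hlog : ∀ᶠ x : ℝ in atTop, 0 < Real.log x :=
    Real.tendsto_log_atTop.eventually_gt_atTop 0
  rw [Asymptotics.isEquivalent_iff_tendsto_one]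
  · have hlim := (tendsto_sectorPrimeCount_mul_log_div hα hαβ.le hβ).div_const
      (2 / Real.pi * (β - α))
    rw [div_self hc.ne'] at hlim
    refine hlim.congr' ?_
    filter_upwards [hlog] with x hx
    rw [Pi.div_apply]
    field_simp
  · filter_upwards [hlog, eventually_gt_atTop 0] with x hx hx0
    positivity

/-! ### Representatives in the first quadrant -/

lemma arg_eq_of_nonneg {ω : GaussianInt} (h : 0 ≤ Complex.arg (GaussianInt.toComplex ω)) :
    arg ω = Complex.arg (GaussianInt.toComplex ω) :=
  (toIcoMod_eq_self Real.two_pi_pos).2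
    ⟨h, by linarith [Complex.arg_le_pi (GaussianInt.toComplex ω), Real.pi_pos]⟩

lemma arg_eq_of_neg {ω : GaussianInt} (h : Complex.arg (GaussianInt.toComplex ω) < 0) :
    arg ω = Complex.arg (GaussianInt.toComplex ω) + 2 * Real.pi := by
  rw [arg, ← toIcoMod_add_right]
  have hlower := Complex.neg_pi_lt_arg (GaussianInt.toComplex ω)
  exact (toIcoMod_eq_self Real.two_pi_pos).2 ⟨by linarith [Real.pi_pos], by linarith⟩

lemma arg_lt_pi_div_two_iff {ω : GaussianInt} (hω : ω ≠ 0) :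
    arg ω < Real.pi / 2 ↔ 0 < ω.re ∧ 0 ≤ ω.im := by
  set z := GaussianInt.toComplex ω with hz
  have hre : 0 < ω.re ↔ |Complex.arg z| < Real.pi / 2 := by
    rw [Complex.abs_arg_lt_pi_div_two_iff, or_iff_left (by simpa [hz] using hω), hz,
      ← GaussianInt.intCast_re, Int.cast_pos]
  have him : 0 ≤ ω.im ↔ 0 ≤ Complex.arg z := by
    rw [Complex.arg_nonneg_iff, hz, ← GaussianInt.intCast_im, Int.cast_nonneg_iff]
  rw [hre, him]
  rcases le_or_gt 0 (Complex.arg z) with harg | harg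
  · rw [arg_eq_of_nonneg harg, abs_of_nonneg harg, and_iff_left harg]
  · rw [arg_eq_of_neg harg]
    have hlower := Complex.neg_pi_lt_arg z
    exact iff_of_false (by linarith) fun h => harg.not_ge h.2

lemma mem_primesPlus_iff {p : GaussianInt} : p ∈ primesPlus ↔ Prime p ∧ 0 < p.re ∧ 0 ≤ p.im :=
  and_congr_right fun hp => by
    rw [and_iff_right (arg_mem_Ico p).1, arg_lt_pi_div_two_iff (Prime.ne_zero hp)]

lemma exists_associated_first_quadrant {ω : GaussianInt} (hω : ω ≠ 0) :
    ∃ η, Associated ω η ∧ 0 < η.re ∧ 0 ≤ η.im := by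
  obtain ⟨a, b⟩ := ω
  have hab : a ≠ 0 ∨ b ≠ 0 := by
    by_contra! h
    exact hω (Zsqrtd.ext h.1 h.2)
  have hassoc : ∀ u ∈ gaussUnits, Associated (⟨a, b⟩ : GaussianInt) (u * ⟨a, b⟩) := fun u hu =>
    (associated_unit_mul_left _ u (mem_gaussUnits_iff.1 hu)).symm
  have hquadrant : (0 < a ∧ 0 ≤ b) ∨ (a < 0 ∧ b ≤ 0) ∨ (a ≤ 0 ∧ 0 < b) ∨ (0 ≤ a ∧ b < 0) := by
    omega
  rcases hquadrant with h | h | h | h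
  · exact ⟨_, hassoc 1 (by decide), by simpa using h⟩
  · exact ⟨_, hassoc (-1) (by decide), by simpa using h⟩
  · exact ⟨_, hassoc ⟨0, -1⟩ (by decide), by simpa [Zsqrtd.re_mul, Zsqrtd.im_mul] using h.symm⟩
  · exact ⟨_, hassoc ⟨0, 1⟩ (by decide), by simpa [Zsqrtd.re_mul, Zsqrtd.im_mul] using h.symm⟩

lemma eq_of_associated_first_quadrant {ω η : GaussianInt} (h : Associated ω η)
    (hω : 0 < ω.re ∧ 0 ≤ ω.im) (hη : 0 < η.re ∧ 0 ≤ η.im) : ω = η := by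
  obtain ⟨u, rfl⟩ := h
  have hu := mem_gaussUnits_iff.2 u.isUnit
  simp only [gaussUnits, Finset.mem_insert, Finset.mem_singleton] at hu
  rw [Zsqrtd.re_mul, Zsqrtd.im_mul] at hη
  rcases hu with hu | hu | hu | hu
  · rw [hu, mul_one]
  all_goals
    simp only [hu, Zsqrtd.re_neg, Zsqrtd.im_neg, Zsqrtd.re_one, Zsqrtd.im_one] at hη
    omega

lemma mem_ball_iff_of_associated {ω η : GaussianInt} (h : Associated ω η) {x : ℝ} :
    ω ∈ ball x ↔ η ∈ ball x := by
  obtain ⟨u, rfl⟩ := h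
  simp only [ball, mem_ofPred_eq, Zsqrtd.norm_mul, (norm_eq_one_iff_isUnit _).2 u.isUnit, mul_one]

lemma image_mk_primes_inter_ball (x : ℝ) :
    Associates.mk '' (primes ∩ ball x) = Associates.mk '' (primesPlus ∩ ball x) := by
  refine Subset.antisymm ?_ (image_mono (inter_subset_inter_left _ fun p hp => hp.1))
  rintro _ ⟨p, ⟨hp, hpx⟩, rfl⟩
  obtain ⟨η, hη, hquadrant⟩ := exists_associated_first_quadrant (Prime.ne_zero hp)
  exact ⟨η, ⟨mem_primesPlus_iff.2 ⟨hη.prime_iff.1 hp, hquadrant⟩,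
    (mem_ball_iff_of_associated hη).1 hpx⟩, (Associates.mk_eq_mk_iff_associated.2 hη).symm⟩

lemma injOn_associates_mk_primesPlus : InjOn Associates.mk primesPlus := fun _ hp _ hq hpq =>
  eq_of_associated_first_quadrant (Associates.mk_eq_mk_iff_associated.1 hpq)
    (mem_primesPlus_iff.1 hp).2 (mem_primesPlus_iff.1 hq).2

theorem primeCount_eq_ncard (x : ℝ) : primeCount x = (primesPlus ∩ ball x).ncard := by
  rw [primeCount, image_mk_primes_inter_ball]
  exact (injOn_associates_mk_primesPlus.mono inter_subset_left).ncard_image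

lemma primeCount_eq_sectorPrimeCount (x : ℝ) :
    primeCount x = sectorPrimeCount 0 (Real.pi / 2) x := by
  rw [primeCount_eq_ncard, sectorPrimeCount]
  congr 1
  ext p
  simp only [primesPlus, mem_inter_iff, mem_ofPred_eq]
  tauto

end HeckePNT

end

theorem theorem5p25 :
    ((∀ x : ℝ, GaussianPNT.primeCount x = (GaussianPNT.primesPlus ∩ GaussianPNT.ball x).ncard) ∧
      Asymptotics.IsEquivalent Filter.atTop
        (fun x : ℝ => (GaussianPNT.primeCount x : ℝ))
        (fun x : ℝ => x / Real.log x)) ∧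
    (∀ α β : ℝ, 0 ≤ α → α < β → β ≤ 2 * Real.pi →
      Asymptotics.IsEquivalent Filter.atTop
        (fun x : ℝ => (GaussianPNT.sectorPrimeCount α β x : ℝ))
        (fun x : ℝ => 2 / Real.pi * (β - α) * (x / Real.log x))) := by
  refine ⟨⟨HeckePNT.primeCount_eq_ncard, ?_⟩,
    fun _ _ hα hαβ hβ => HeckePNT.sectorPrimeCount_isEquivalent hα hαβ hβ⟩
  have hpi := Real.pi_pos
  have hquadrant := HeckePNT.sectorPrimeCount_isEquivalent (α := 0) (β := Real.pi / 2) le_rfl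
    (by linarith) (by linarith)
  have hconst : 2 / Real.pi * (Real.pi / 2 - 0) = 1 := by
    field_simp
    norm_num
  simpa only [hconst, one_mul, ← HeckePNT.primeCount_eq_sectorPrimeCount] using hquadrant
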